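/- For a lattice $L\subset\mathbb R^n$ with dual lattice $L^*=\{y\in\mathbb R^n:\langle x,y\rangle\in\mathbb Z\ \text{for all } x\in L\}$ and $\varepsilon>0$, the smoothing parameter $\eta_\varepsilon(L)$ is the smallest $s>0$ such that $\sum_{w\in L^*\setminus\{0\}}e^{-\pi s^2\|w\|^2}\le\varepsilon$. For functions $\gamma,\varepsilon_Y,\varepsilon_N$ of the dimension $n\ge 1$, an instance of the promise problem $\gamma\text{-}\mathrm{GapSPP}_{\varepsilon_Y,\varepsilon_N}$ is a basis $B\in\mathbb Q^{n\times n}$, written in binary, of a full-rank lattice $L=L(B)\subset\mathbb R^n$. It is a YES instance if $\eta_{\varepsilon_Y(n)}(L)\le 1$ and a NO instance if $\eta_{\varepsilon_N(n)}(L)>\gamma(n)$. A promise problem is in $\mathrm{AM}$ if it has a two-message public-coin proof system: Arthur sends polynomially many uniform random bits, Merlin (computationally unbounded) answers with a string of polynomial length, and Arthur decides in deterministic time polynomial in the length of the instance; some answer leads to acceptance with probability at least $2/3$ over the coins on every YES instance, and with probability at most $1/3$ on every NO instance. It is in $\mathrm{coAM}$ if the problem with YES and NO instances exchanged is in $\mathrm{AM}$.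 A positive function $\varepsilon$ is called efficiently approximable if, given $n\ge1$ and $k$, an integer within distance $1$ of $k\ln\varepsilon(n)$ can be computed in time polynomial in $n+k$ (that is, $\varepsilon(n)$ can be approximated up to a factor $e^{\pm1/k}$). **Theorem.** Let $\alpha,\varepsilon_Y,\varepsilon_N$ be real-valued functions of $n\ge 1$ with $\varepsilon_Y(n)>0$ such that, for some polynomials $p,q$ that are positive on $n \geq 1$ and for all $n\ge1$, $$\alpha(n)\ \ge\ \frac1{p(n)}\qquad\text{and}\qquad \varepsilon_N(n)\ \ge\ \Bigl(1+\frac1{q(n)}\Bigr)\varepsilon_Y(n),$$ and such that at least one of $\varepsilon_Y,\varepsilon_N$ is efficiently approximable. Then $(1+\alpha)\text{-}\mathrm{GapSPP}_{\varepsilon_Y,\varepsilon_N}\in\mathrm{coAM}$. -/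

import Mathlib

open scoped ENNReal

namespace LatticeAM

/-! ## Lattices, Gaussian mass and the smoothing parameter -/

noncomputable section

/-- The Gaussian mass `ρ_s(A) = ∑_{v ∈ A} exp (-π ‖v‖² / s²)` of a set `A`, as an unconditional sum
in `[0, ∞]`. -/
def gaussianMass {n : ℕ} (s : ℝ) (A : Set (EuclideanSpace ℝ (Fin n))) : ℝ≥0∞ :=
  ∑' v : A, ENNReal.ofReal (Real.exp (-Real.pi * ‖(v : EuclideanSpace ℝ (Fin n))‖ ^ 2 / s ^ 2))

/-- The dual lattice `L* = {y | ⟪y, x⟫ ∈ ℤ for all x ∈ L}`. -/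
def dualLattice {n : ℕ} (L : Submodule ℤ (EuclideanSpace ℝ (Fin n))) :
    Submodule ℤ (EuclideanSpace ℝ (Fin n)) :=
  LinearMap.BilinForm.dualSubmodule (innerₗ (EuclideanSpace ℝ (Fin n))) L

/-- The smoothing parameter `η_ε(L)`: the smallest `s > 0` with `ρ_{1/s}(L* \ {0}) ≤ ε`. -/
def smoothingParameter {n : ℕ} (ε : ℝ) (L : Submodule ℤ (EuclideanSpace ℝ (Fin n))) : ℝ :=
  sInf {s : ℝ | 0 < s ∧
    gaussianMass (1 / s) ((dualLattice L : Set (EuclideanSpace ℝ (Fin n))) \ {0})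
      ≤ ENNReal.ofReal ε}

/-- The lattice `L(B)`: all integer combinations of the columns of the rational matrix `B`. -/
def latticeOf {n : ℕ} (B : Matrix (Fin n) (Fin n) ℚ) :
    Submodule ℤ (EuclideanSpace ℝ (Fin n)) :=
  Submodule.span ℤ (Set.range fun j : Fin n => WithLp.toLp 2 fun i : Fin n => ((B i j : ℚ) : ℝ))

end

/-! ## Binary encoding of instances -/

/-- Self-delimiting binary code of a natural number: each binary digit `b` is written `1b`, and the
code ends in `0`. -/
def encodeNat (k : ℕ) : List Bool :=
  (Nat.bits k).flatMap (fun b => [true, b]) ++ [false]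

/-- A sign bit followed by the absolute value. -/
def encodeInt (z : ℤ) : List Bool :=
  decide (z < 0) :: encodeNat z.natAbs

/-- Numerator and denominator in lowest terms. -/
def encodeRat (q : ℚ) : List Bool :=
  encodeInt q.num ++ encodeNat q.den

/-- The dimension followed by the entries, row by row. -/
def encodeMatrix {n : ℕ} (B : Matrix (Fin n) (Fin n) ℚ) : List Bool :=
  encodeNat n ++ (List.ofFn fun i => (List.ofFn fun j => encodeRat (B i j)).flatten).flatten

/-! ## A machine model with logarithmic (bit) cost -/

/-- The contents of the registers; each register holds a natural number of arbitrary size. -/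
abbrev Store := ℕ → ℕ

inductive ArithOp where
  | add | sub | mul | div

/-- Truncated subtraction, and integer division rounding down (with `a / 0 = 0`). -/
def ArithOp.eval : ArithOp → ℕ → ℕ → ℕ
  | .add, a, b => a + b
  | .sub, a, b => a - b
  | .mul, a, b => a * b
  | .div, a, b => a / b

/-- Structured programs for a register machine; `x`, `y`, `z` are names of registers. A program
mentions only finitely many registers. -/
inductive Cmd where
  | skip : Cmd
  /-- `x := k` -/
  | const (x k : ℕ) : Cmd
  /-- `x := y ∘ z` -/
  | arith (o : ArithOp) (x y z : ℕ) : Cmd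
  | seq (c d : Cmd) : Cmd
  /-- if `x ≠ 0` then `c` else `d` -/
  | ite (x : ℕ) (c d : Cmd) : Cmd
  /-- while `x ≠ 0` do `c` -/
  | loop (x : ℕ) (c : Cmd) : Cmd

/-- `Runs c σ t τ`: started in the store `σ`, the program `c` halts in the store `τ` after time `t`.
Time is bit cost: `Nat.size` is the binary length, a test or a constant costs the length of the
number plus one, and an arithmetic operation costs the product of the lengths of its operands (each
plus one), as the schoolbook algorithms do. -/
inductive Runs : Cmd → Store → ℕ → Store → Prop where
  | skip (σ : Store) : Runs .skip σ 1 σ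
  | const (x k : ℕ) (σ : Store) :
      Runs (.const x k) σ (Nat.size k + 1) (Function.update σ x k)
  | arith (o : ArithOp) (x y z : ℕ) (σ : Store) :
      Runs (.arith o x y z) σ ((Nat.size (σ y) + 1) * (Nat.size (σ z) + 1))
        (Function.update σ x (o.eval (σ y) (σ z)))
  | seq {c d : Cmd} {σ τ υ : Store} {s t : ℕ} :
      Runs c σ s τ → Runs d τ t υ → Runs (.seq c d) σ (s + t) υ
  | ite_true {x : ℕ} {c d : Cmd} {σ τ : Store} {t : ℕ} :
      σ x ≠ 0 → Runs c σ t τ → Runs (.ite x c d) σ (Nat.size (σ x) + 1 + t) τ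
  | ite_false {x : ℕ} {c d : Cmd} {σ τ : Store} {t : ℕ} :
      σ x = 0 → Runs d σ t τ → Runs (.ite x c d) σ (Nat.size (σ x) + 1 + t) τ
  | loop_done {x : ℕ} {c : Cmd} {σ : Store} :
      σ x = 0 → Runs (.loop x c) σ (Nat.size (σ x) + 1) σ
  | loop_step {x : ℕ} {c : Cmd} {σ τ υ : Store} {s t : ℕ} :
      σ x ≠ 0 → Runs c σ s τ → Runs (.loop x c) τ t υ →
      Runs (.loop x c) σ (Nat.size (σ x) + 1 + s + t) υ

/-- The initial store: the arguments are in the first registers, all others hold `0`. -/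
def initStore (args : List ℕ) : Store := fun i => args.getD i 0

/-- A bit string as one number: its bits, the first one least significant, below a leading `1`. -/
def codeBits : List Bool → ℕ
  | [] => 1
  | b :: l => 2 * codeBits l + b.toNat

/-! ## Promise problems, `AM` and `coAM` -/

/-- A promise problem over bit strings, given by its YES and its NO instances. -/
structure PromiseProblem where
  yes : Set (List Bool)
  no : Set (List Bool)

/-- The complement: YES and NO instances exchange their roles. -/
def PromiseProblem.compl (P : PromiseProblem) : PromiseProblem := ⟨P.no, P.yes⟩

/-- The verifier `V` accepts input `x` with coins `r` and prover message `m`: it halts with a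
nonzero number in register `0`. Strings of coins and messages of length `ℓ` are identified with
the numbers below `2 ^ ℓ`. -/
def Accepts (V : Cmd) (x : List Bool) (r m : ℕ) : Prop :=
  ∃ t τ, Runs V (initStore [codeBits x, r, m]) t τ ∧ τ 0 ≠ 0

open Classical in
/-- The probability, over `ℓ` uniform public coins `r`, that some message `m` of length `ℓ` makes
the verifier accept: the success probability of an optimal prover, who answers after seeing `r`. -/
noncomputable def acceptProb (V : Cmd) (ℓ : ℕ) (x : List Bool) : ℝ :=
  (((Finset.range (2 ^ ℓ)).filter fun r => ∃ m < 2 ^ ℓ, Accepts V x r m).card : ℝ) / 2 ^ ℓ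

/-- The class `AM` of promise problems with a two-message public-coin proof system: Arthur sends
polynomially many uniform coins, Merlin answers with a message of polynomial length, and Arthur
decides in deterministic polynomial time; completeness `2/3` and soundness error `1/3`. -/
def InAM (P : PromiseProblem) : Prop :=
  ∃ (V : Cmd) (ℓ q : Polynomial ℕ),
    (∀ (x : List Bool) (r m : ℕ), r < 2 ^ ℓ.eval x.length → m < 2 ^ ℓ.eval x.length →
      ∃ t τ, Runs V (initStore [codeBits x, r, m]) t τ ∧ t ≤ q.eval x.length) ∧
    (∀ x ∈ P.yes, 2 / 3 ≤ acceptProb V (ℓ.eval x.length) x) ∧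
    (∀ x ∈ P.no, acceptProb V (ℓ.eval x.length) x ≤ 1 / 3)

/-- `coAM`: the complement is in `AM`. -/
def InCoAM (P : PromiseProblem) : Prop := InAM P.compl

/-! ## The problem `γ-GapSPP_{εY, εN}` -/

/-- An instance is (the encoding of) a basis of an `n`-dimensional lattice `L`, `n ≥ 1`. It is a YES
instance if `η_{εY(n)}(L) ≤ 1` and a NO instance if `η_{εN(n)}(L) > γ(n)`. -/
def gapSPP (γ εY εN : ℕ → ℝ) : PromiseProblem where
  yes := {x | ∃ (n : ℕ) (B : Matrix (Fin n) (Fin n) ℚ), 0 < n ∧ B.det ≠ 0 ∧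
    x = encodeMatrix B ∧ smoothingParameter (εY n) (latticeOf B) ≤ 1}
  no := {x | ∃ (n : ℕ) (B : Matrix (Fin n) (Fin n) ℚ), 0 < n ∧ B.det ≠ 0 ∧
    x = encodeMatrix B ∧ γ n < smoothingParameter (εN n) (latticeOf B)}

/-- A positive function `ε` is efficiently approximable if some program, given `n ≥ 1` and `k`,
computes in time polynomial in `n + k` an integer (a difference of two naturals) within `1` of
`k * log (ε n)`; so `log (ε n)` is found up to `1 / k`, and `ε n` up to a factor `exp (± 1 / k)`. -/
def EfficientlyApproximable (ε : ℕ → ℝ) : Prop :=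
  ∃ (c : Cmd) (q : Polynomial ℕ), ∀ n k : ℕ, 0 < n →
    ∃ t τ, Runs c (initStore [n, k]) t τ ∧ t ≤ q.eval (n + k) ∧
      |((τ 0 : ℝ) - (τ 1 : ℝ)) - k * Real.log (ε n)| ≤ 1

end LatticeAM

/-!
On a YES instance the Gaussian sum of the dual lattice at `s = 1` is at most `εY`; on a NO instance
some finite part of the sum at `s = 1 + α` exceeds `εN ≥ (1 + 1 / q) εY`. The Goldwasser–Sipser
protocol for set size lower bounds lets Merlin prove to Arthur that the latter sum is large. The set
consists of the pairs of a nonzero dual vector `w` and a number below an integer weight proportional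
to `exp (-π ‖w‖ ^ 2)`, and a NO instance has `exp (1 / poly)` times as many of them.
Passing to `N`-tuples amplifies the ratio to a constant, and the affine hash `u ↦ a u + b` modulo
`Q` with random key `(a, b)` tells the two cases apart: the coins are the key, and Merlin answers
with a tuple of small hash value.

Arthur only computes with integers. Writing `ε = exp (-T)` and `y = π ‖w‖ ^ 2`, the weight of `w` is
`(M D + τ - ⌊D y⌋ - 1)₊ ^ M`, where `τ / D` approximates `T` and a rational upper bound from Wallis'
product replaces `π`; it is at most `(M D) ^ M exp (T - y)` up to the precision `1 / D`. In the other
direction `(1 - x / M) ^ M ≥ exp (-x - O (x ^ 2 / M))` is only useful for small `|x|`. There the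
factor `exp (-α y)` gained from `s = 1 + α` absorbs the error, and it bounds the contribution of
large `y`: either a single term is already large or the terms with moderate `y` carry most of the
sum. Finally, Merlin's message contains the parse of the encoded basis and its inverse matrix, so
that Arthur verifies arithmetic identities instead of parsing and inverting.
-/

namespace LatticeAM

/-! ## The machine model -/

section Machine

theorem size_add_le (a b : ℕ) : Nat.size (a + b) ≤ max (Nat.size a) (Nat.size b) + 1 := by
  rw [Nat.size_le, pow_succ]
  have ha := (Nat.lt_size_self a).trans_le
    (Nat.pow_le_pow_right two_pos (le_max_left (Nat.size a) (Nat.size b)))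
  have hb := (Nat.lt_size_self b).trans_le
    (Nat.pow_le_pow_right two_pos (le_max_right (Nat.size a) (Nat.size b)))
  omega

theorem size_mul_le (a b : ℕ) : Nat.size (a * b) ≤ Nat.size a + Nat.size b := by
  rw [Nat.size_le, pow_add]
  exact Nat.mul_lt_mul'' (Nat.lt_size_self a) (Nat.lt_size_self b)

theorem size_le_self (a : ℕ) : Nat.size a ≤ a :=
  Nat.size_le.2 Nat.lt_two_pow_self

theorem size_two : Nat.size 2 = 2 := Nat.size_pow (n := 1)

theorem size_eq_size_div_two_add_one {a : ℕ} (ha : a ≠ 0) :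
    Nat.size a = Nat.size (a / 2) + 1 := by
  have hbit : Nat.bit a.bodd (a / 2) = a := by rw [← Nat.div2_val, Nat.bit_bodd_div2]
  conv_lhs => rw [← hbit]
  exact Nat.size_bit (by rwa [hbit])

theorem ArithOp.size_eval_le (o : ArithOp) (a b : ℕ) :
    Nat.size (o.eval a b) ≤ Nat.size a + Nat.size b + 1 := by
  cases o with
  | add => exact (size_add_le a b).trans (by omega)
  | sub => exact (Nat.size_le_size (Nat.sub_le a b)).trans (by omega)
  | mul => exact (size_mul_le a b).trans (by omega)
  | div => exact (Nat.size_le_size (Nat.div_le_self a b)).trans (by omega)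

theorem Runs.deterministic {c : Cmd} {σ τ τ' : Store} {t t' : ℕ} (h : Runs c σ t τ)
    (h' : Runs c σ t' τ') : t = t' ∧ τ = τ' := by
  induction h generalizing t' τ' with
  | skip | const | arith => cases h'; exact ⟨rfl, rfl⟩
  | seq _ _ ih₁ ih₂ =>
    cases h' with
    | seq h₁ h₂ =>
      obtain ⟨rfl, rfl⟩ := ih₁ h₁
      obtain ⟨rfl, rfl⟩ := ih₂ h₂
      exact ⟨rfl, rfl⟩
  | ite_true hx _ ih =>
    cases h' with
    | ite_true _ h₁ => obtain ⟨rfl, rfl⟩ := ih h₁; exact ⟨rfl, rfl⟩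
    | ite_false hx' _ => exact absurd hx' hx
  | ite_false hx _ ih =>
    cases h' with
    | ite_true hx' _ => exact absurd hx hx'
    | ite_false _ h₁ => obtain ⟨rfl, rfl⟩ := ih h₁; exact ⟨rfl, rfl⟩
  | loop_done hx =>
    cases h' with
    | loop_done _ => exact ⟨rfl, rfl⟩
    | loop_step hx' _ _ => exact absurd hx hx'
  | loop_step hx _ _ ih₁ ih₂ =>
    cases h' with
    | loop_done hx' => exact absurd hx' hx
    | loop_step _ h₁ h₂ =>
      obtain ⟨rfl, rfl⟩ := ih₁ h₁
      obtain ⟨rfl, rfl⟩ := ih₂ h₂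
      exact ⟨rfl, rfl⟩

theorem Runs.size_le_add_time {c : Cmd} {σ τ : Store} {t : ℕ} (h : Runs c σ t τ) :
    ∀ {B : ℕ}, (∀ i, Nat.size (σ i) ≤ B) → ∀ i, Nat.size (τ i) ≤ B + t := by
  induction h with
  | skip σ => exact fun hB i => (hB i).trans (by omega)
  | const x k σ =>
    intro B hB i
    rcases eq_or_ne i x with rfl | hi
    · rw [Function.update_self]; omega
    · rw [Function.update_of_ne hi]; exact (hB i).trans (by omega)
  | arith o x y z σ =>
    intro B hB i
    rcases eq_or_ne i x with rfl | hi
    · rw [Function.update_self]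
      nlinarith [o.size_eval_le (σ y) (σ z), hB y, Nat.zero_le (Nat.size (σ y) * Nat.size (σ z))]
    · rw [Function.update_of_ne hi]; exact (hB i).trans (by omega)
  | seq _ _ ih₁ ih₂ | loop_step _ _ _ ih₁ ih₂ =>
    exact fun hB i => (ih₂ (ih₁ hB) i).trans (by omega)
  | ite_true _ _ ih | ite_false _ _ ih => exact fun hB i => (ih hB i).trans (by omega)
  | loop_done _ => exact fun hB i => (hB i).trans (by omega)

/-! ### Total correctness with a time bound -/

/-- The total correctness assertion: started in `σ`, the program `c` halts within time `T` in a
store that satisfies `Q`. -/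
def HaltsWithin (c : Cmd) (σ : Store) (T : ℕ) (Q : Store → Prop) : Prop :=
  ∃ t τ, Runs c σ t τ ∧ t ≤ T ∧ Q τ

namespace HaltsWithin

variable {c d : Cmd} {σ : Store} {S T : ℕ} {P Q : Store → Prop}

theorem imp (h : HaltsWithin c σ T P) (hPQ : ∀ τ, P τ → Q τ) : HaltsWithin c σ T Q :=
  let ⟨t, τ, hr, ht, hP⟩ := h
  ⟨t, τ, hr, ht, hPQ τ hP⟩

theorem mono (h : HaltsWithin c σ S Q) (hST : S ≤ T) : HaltsWithin c σ T Q :=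
  let ⟨t, τ, hr, ht, hQ⟩ := h
  ⟨t, τ, hr, ht.trans hST, hQ⟩

theorem skip (h : Q σ) : HaltsWithin .skip σ 1 Q := ⟨_, σ, .skip σ, le_rfl, h⟩

theorem const {x k : ℕ} (h : Q (Function.update σ x k)) :
    HaltsWithin (.const x k) σ (Nat.size k + 1) Q :=
  ⟨_, _, .const x k σ, le_rfl, h⟩

theorem arith {o : ArithOp} {x y z : ℕ} (h : Q (Function.update σ x (o.eval (σ y) (σ z)))) :
    HaltsWithin (.arith o x y z) σ ((Nat.size (σ y) + 1) * (Nat.size (σ z) + 1)) Q :=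
  ⟨_, _, .arith o x y z σ, le_rfl, h⟩

theorem seq (h : HaltsWithin c σ S fun τ => HaltsWithin d τ T Q) :
    HaltsWithin (.seq c d) σ (S + T) Q :=
  let ⟨_, _, hc, hs, _, υ, hd, ht, hQ⟩ := h
  ⟨_, υ, .seq hc hd, Nat.add_le_add hs ht, hQ⟩

/-- The index of the invariant counts the remaining iterations. -/
theorem loop {x B : ℕ} {I : ℕ → Store → Prop} (hzero : ∀ σ, I 0 σ → σ x = 0)
    (hsucc : ∀ k σ, I (k + 1) σ → σ x ≠ 0 ∧ Nat.size (σ x) ≤ B ∧ HaltsWithin c σ T (I k)) :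
    ∀ (m : ℕ) (σ : Store), I m σ → HaltsWithin (.loop x c) σ (m * (B + 1 + T) + 1) (I 0)
  | 0, σ, hσ => ⟨_, σ, .loop_done (hzero σ hσ), by simp [hzero σ hσ], hσ⟩
  | m + 1, σ, hσ => by
    obtain ⟨hx, hB, t, τ, hc, ht, hτ⟩ := hsucc m σ hσ
    obtain ⟨t', υ, hl, ht', hυ⟩ := loop hzero hsucc m τ hτ
    refine ⟨_, υ, .loop_step hx hc hl, ?_, hυ⟩
    rw [Nat.succ_mul]
    omega

theorem copy {x y z : ℕ} (hzy : z ≠ y)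
    (h : Q (Function.update (Function.update σ z 0) x (σ y))) :
    HaltsWithin (.seq (.const z 0) (.arith .add x y z)) σ (Nat.size (σ y) + 2) Q := by
  have hy : Function.update σ z 0 y = σ y := Function.update_of_ne hzy.symm _ _
  refine (seq (const (arith ?_))).mono ?_
  · simpa only [hy, Function.update_self, ArithOp.eval, Nat.add_zero] using h
  · simp only [hy, Function.update_self, Nat.size_zero]
    omega

end HaltsWithin

theorem eqOn_Iio_update {s x : ℕ} (hsx : s ≤ x) (σ : Store) (k : ℕ) :
    Set.EqOn (Function.update σ x k) σ (Set.Iio s) :=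
  fun _ hi => Function.update_of_ne (ne_of_lt (lt_of_lt_of_le hi hsx)) _ _

/-! ### Relocation of programs -/

/-- The program with every register `i` renamed to `s + i`, which frees the registers below `s`. -/
def Cmd.shift (s : ℕ) : Cmd → Cmd
  | .skip => .skip
  | .const x k => .const (s + x) k
  | .arith o x y z => .arith o (s + x) (s + y) (s + z)
  | .seq c d => .seq (c.shift s) (d.shift s)
  | .ite x c d => .ite (s + x) (c.shift s) (d.shift s)
  | .loop x c => .loop (s + x) (c.shift s)

/-- A strict upper bound for the registers that a program mentions, not necessarily the least. -/
def Cmd.width : Cmd → ℕ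
  | .skip => 0
  | .const x _ => x + 1
  | .arith _ x y z => x + y + z + 1
  | .seq c d => c.width + d.width
  | .ite x c d => x + 1 + c.width + d.width
  | .loop x c => x + 1 + c.width

theorem update_shift_apply {σ σ' : Store} {s B : ℕ} (h : ∀ i < B, σ' (s + i) = σ i) (x k : ℕ) :
    ∀ i < B, Function.update σ' (s + x) k (s + i) = Function.update σ x k i := fun i hi => by
  rcases eq_or_ne i x with rfl | hx
  · simp only [Function.update_self]
  · rw [Function.update_of_ne hx, Function.update_of_ne (by omega), h i hi]

theorem Runs.exists_shift {c : Cmd} {σ τ : Store} {t : ℕ} (h : Runs c σ t τ) (s B : ℕ) :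
    c.width ≤ B → ∀ σ' : Store, (∀ i < B, σ' (s + i) = σ i) →
      ∃ τ', Runs (c.shift s) σ' t τ' ∧ (∀ i < B, τ' (s + i) = τ i) ∧
        Set.EqOn τ' σ' (Set.Iio s) := by
  induction h with
  | skip σ => exact fun _ σ' h => ⟨σ', .skip _, h, Set.eqOn_refl _ _⟩
  | const x k σ =>
    exact fun _ σ' h => ⟨_, .const _ _ _, update_shift_apply h x k,
      eqOn_Iio_update (Nat.le_add_right s x) _ _⟩
  | arith o x y z σ =>
    intro hw σ' h
    simp only [Cmd.width] at hw
    have run := Runs.arith o (s + x) (s + y) (s + z) σ'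
    rw [h y (by omega), h z (by omega)] at run
    exact ⟨_, run, update_shift_apply h x _, eqOn_Iio_update (Nat.le_add_right s x) _ _⟩
  | seq _ _ ih₁ ih₂ =>
    intro hw σ' h
    simp only [Cmd.width] at hw
    obtain ⟨τ₁, run₁, val₁, frame₁⟩ := ih₁ (by omega) σ' h
    obtain ⟨τ₂, run₂, val₂, frame₂⟩ := ih₂ (by omega) τ₁ val₁
    exact ⟨τ₂, .seq run₁ run₂, val₂, frame₂.trans frame₁⟩
  | @ite_true x c d σ τ t hx _ ih =>
    intro hw σ' h
    simp only [Cmd.width] at hw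
    obtain ⟨τ₁, run₁, val₁, frame₁⟩ := ih (by omega) σ' h
    rw [← h x (by omega)] at hx ⊢
    exact ⟨τ₁, .ite_true hx run₁, val₁, frame₁⟩
  | @ite_false x c d σ τ t hx _ ih =>
    intro hw σ' h
    simp only [Cmd.width] at hw
    obtain ⟨τ₁, run₁, val₁, frame₁⟩ := ih (by omega) σ' h
    rw [← h x (by omega)] at hx ⊢
    exact ⟨τ₁, .ite_false hx run₁, val₁, frame₁⟩
  | @loop_done x c σ hx =>
    intro hw σ' h
    simp only [Cmd.width] at hw
    rw [← h x (by omega)] at hx ⊢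
    exact ⟨σ', .loop_done hx, h, Set.eqOn_refl _ _⟩
  | @loop_step x c σ τ υ t₁ t₂ hx _ _ ih₁ ih₂ =>
    intro hw σ' h
    have hx_lt : x < B := by simp only [Cmd.width] at hw; omega
    obtain ⟨τ₁, run₁, val₁, frame₁⟩ := ih₁ (by simp only [Cmd.width] at hw; omega) σ' h
    obtain ⟨τ₂, run₂, val₂, frame₂⟩ := ih₂ hw τ₁ val₁
    rw [← h x hx_lt] at hx ⊢
    exact ⟨τ₂, .loop_step hx run₁ run₂, val₂, frame₂.trans frame₁⟩

/-- The program that sets the registers `s, …, s + b - 1` to `0`. -/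
def Cmd.clear (s : ℕ) : ℕ → Cmd
  | 0 => .skip
  | b + 1 => .seq (Cmd.clear s b) (.const (s + b) 0)

theorem HaltsWithin.clear (s : ℕ) (σ : Store) : ∀ b : ℕ, HaltsWithin (Cmd.clear s b) σ (b + 1)
    fun τ => (∀ i < b, τ (s + i) = 0) ∧ Set.EqOn τ σ (Set.Iio s)
  | 0 => .skip ⟨by simp, Set.eqOn_refl _ _⟩
  | b + 1 => .seq <| (HaltsWithin.clear s σ b).imp fun τ ⟨hzero, hframe⟩ => .const
    ⟨fun i hi => by
      rcases eq_or_ne i b with rfl | hib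
      · exact Function.update_self ..
      · rw [Function.update_of_ne (by omega), hzero i (by omega)],
    (eqOn_Iio_update (Nat.le_add_right s b) _ _).trans hframe⟩

end Machine

/-! ## Functions computable in polynomial time -/

/-- Inputs of a program: the contents of the argument registers, and the length of the input in
which running times are measured. The length may exceed the number of bits, so that some arguments
can be measured in unary. -/
class ProgramInput (Ω : Type*) where
  args : Ω → List ℕ
  length : Ω → ℕ
  size_le_length : ∀ ω, ∀ x ∈ args ω, Nat.size x ≤ length ω

open ProgramInput

/-- An input together with an index, which is measured in unary. -/
instance {Ω : Type*} [ProgramInput Ω] : ProgramInput (ℕ × Ω) where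
  args p := p.1 :: args p.2
  length p := p.1 + length p.2
  size_le_length p x hx := by
    rcases List.mem_cons.1 hx with rfl | hx
    · exact (size_le_self _).trans (Nat.le_add_right _ _)
    · exact (size_le_length p.2 x hx).trans (Nat.le_add_left _ _)

theorem polynomial_eval_mono (P : Polynomial ℕ) : Monotone fun a => P.eval a := fun a b h => by
  simp only [Polynomial.eval_eq_sum_range]
  gcongr

section PolyTime

variable {Ω : Type*} [ProgramInput Ω]

/-- The values of `f` are bounded by a polynomial in the length of the input. -/
def PolyBounded (f : Ω → ℕ) : Prop := ∃ P : Polynomial ℕ, ∀ ω, f ω ≤ P.eval (length ω)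

namespace PolyBounded

variable {f g : Ω → ℕ}

theorem mono (hg : PolyBounded g) (h : ∀ ω, f ω ≤ g ω) : PolyBounded f :=
  let ⟨P, hP⟩ := hg
  ⟨P, fun ω => (h ω).trans (hP ω)⟩

theorem const (k : ℕ) : PolyBounded (fun _ : Ω => k) := ⟨Polynomial.C k, fun _ => by simp⟩

theorem length : PolyBounded (length : Ω → ℕ) := ⟨Polynomial.X, fun _ => by simp⟩

theorem add (hf : PolyBounded f) (hg : PolyBounded g) : PolyBounded fun ω => f ω + g ω :=
  let ⟨P, hP⟩ := hf
  let ⟨R, hR⟩ := hg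
  ⟨P + R, fun ω => by rw [Polynomial.eval_add]; exact Nat.add_le_add (hP ω) (hR ω)⟩

theorem mul (hf : PolyBounded f) (hg : PolyBounded g) : PolyBounded fun ω => f ω * g ω :=
  let ⟨P, hP⟩ := hf
  let ⟨R, hR⟩ := hg
  ⟨P * R, fun ω => by rw [Polynomial.eval_mul]; exact Nat.mul_le_mul (hP ω) (hR ω)⟩

theorem polynomial_eval (hf : PolyBounded f) (R : Polynomial ℕ) :
    PolyBounded fun ω => R.eval (f ω) :=
  let ⟨P, hP⟩ := hf
  ⟨R.comp P, fun ω => by rw [Polynomial.eval_comp]; exact polynomial_eval_mono R (hP ω)⟩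

theorem index : PolyBounded (fun p : ℕ × Ω => p.1) :=
  PolyBounded.length.mono fun p => Nat.le_add_right p.1 _

theorem comp_snd (hf : PolyBounded f) : PolyBounded (fun p : ℕ × Ω => f p.2) :=
  let ⟨P, hP⟩ := hf
  ⟨P, fun p => (hP p.2).trans (polynomial_eval_mono P (Nat.le_add_left _ p.1))⟩

theorem exists_uniform {g : ℕ × Ω → ℕ} {N : Ω → ℕ} (hg : PolyBounded g) (hN : PolyBounded N) :
    ∃ G : Ω → ℕ, PolyBounded G ∧ ∀ ω, ∀ i ≤ N ω, g (i, ω) ≤ G ω :=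
  let ⟨P, hP⟩ := hg
  ⟨_, (hN.add .length).polynomial_eval P, fun ω i hi =>
    (hP (i, ω)).trans (polynomial_eval_mono P (Nat.add_le_add_right hi _))⟩

end PolyBounded

/-- The program `c` computes `f` within time `T`: it finds the arguments in the registers `ρ`,
writes the result to the register `s` and leaves the registers below `s` untouched. -/
def Cmd.Computes (c : Cmd) (ρ : List ℕ) (s : ℕ) (T f : Ω → ℕ) : Prop :=
  ∀ (ω : Ω) (σ : Store), ρ.map σ = args ω →
    HaltsWithin c σ (T ω) fun τ => τ s = f ω ∧ Set.EqOn τ σ (Set.Iio s)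

/-- `f` is computable in polynomial time, wherever the program is told to find its arguments and to
put the result. As registers outside the arguments may hold anything, the bound on the size of the
values does not follow from the bound on the time. -/
structure PolyTime (f : Ω → ℕ) : Prop where
  size_polyBounded : PolyBounded fun ω => Nat.size (f ω)
  exists_program : ∀ (ρ : List ℕ) (s : ℕ), (∀ r ∈ ρ, r < s) →
    ∃ (c : Cmd) (T : Ω → ℕ), PolyBounded T ∧ c.Computes ρ s T f

theorem map_eq_of_eqOn_Iio {ρ : List ℕ} {s : ℕ} (hρ : ∀ r ∈ ρ, r < s) {σ τ : Store}
    (h : Set.EqOn τ σ (Set.Iio s)) : ρ.map τ = ρ.map σ :=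
  List.map_congr_left fun r hr => h (hρ r hr)

/-- The updates at the end of an iteration of a `for` loop: the register `s` accumulates the value
in `s + 3`, while `s + 1` counts the remaining iterations down and `s + 2` counts the index up. -/
def Cmd.accumulate (o : ArithOp) (s : ℕ) : Cmd :=
  .seq (.arith o s s (s + 3)) (.seq (.const (s + 3) 1)
    (.seq (.arith .add (s + 2) (s + 2) (s + 3)) (.arith .sub (s + 1) (s + 1) (s + 3))))

theorem HaltsWithin.accumulate (o : ArithOp) (s : ℕ) (σ : Store) :
    HaltsWithin (Cmd.accumulate o s) σ
      ((Nat.size (σ s) + 1) * (Nat.size (σ (s + 3)) + 1) +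
        (2 + ((Nat.size (σ (s + 2)) + 1) * 2 + (Nat.size (σ (s + 1)) + 1) * 2)))
      fun τ => τ s = o.eval (σ s) (σ (s + 3)) ∧ τ (s + 1) = σ (s + 1) - 1 ∧
        τ (s + 2) = σ (s + 2) + 1 ∧ Set.EqOn τ σ (Set.Iio s) := by
  refine HaltsWithin.mono
    (.seq <| .arith <| .seq <| .const <| .seq <| .arith <| .arith ⟨?_, ?_, ?_, ?_⟩) ?_
  · simp
  · simp [ArithOp.eval]
  · simp [ArithOp.eval]
  · exact (eqOn_Iio_update (by omega) _ _).trans ((eqOn_Iio_update (by omega) _ _).trans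
      ((eqOn_Iio_update (by omega) _ _).trans (eqOn_Iio_update le_rfl _ _)))
  · simp

/-- `k` combined by `o` with the values `f 0, …, f (N - 1)`, from left to right. -/
def ArithOp.fold (o : ArithOp) (k : ℕ) (f : ℕ → ℕ) : ℕ → ℕ
  | 0 => k
  | N + 1 => o.eval (o.fold k f N) (f N)

theorem ArithOp.fold_add_zero (f : ℕ → ℕ) (N : ℕ) :
    ArithOp.add.fold 0 f N = ∑ i ∈ Finset.range N, f i := by
  induction N with
  | zero => rfl
  | succ N ih => rw [Finset.sum_range_succ, ← ih]; rfl

theorem ArithOp.fold_mul_one (f : ℕ → ℕ) (N : ℕ) :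
    ArithOp.mul.fold 1 f N = ∏ i ∈ Finset.range N, f i := by
  induction N with
  | zero => rfl
  | succ N ih => rw [Finset.prod_range_succ, ← ih]; rfl

theorem HaltsWithin.fold (o : ArithOp) {d : Cmd} {s N U G H : ℕ} {f : ℕ → ℕ} {σ₀ : Store}
    (hd : ∀ i < N, ∀ σ : Store, Set.EqOn σ σ₀ (Set.Iio s) → σ (s + 2) = i →
      HaltsWithin d σ U fun τ => τ (s + 3) = f i ∧ Set.EqOn τ σ (Set.Iio (s + 3)))
    (hG : ∀ i ≤ N, Nat.size (o.fold (σ₀ s) f i) ≤ G) (hH : ∀ i < N, Nat.size (f i) ≤ H)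
    (hcount : σ₀ (s + 1) = N) (hindex : σ₀ (s + 2) = 0) :
    HaltsWithin (.loop (s + 1) (.seq d (Cmd.accumulate o s))) σ₀
      (N * (N + 1 + (U + ((G + 1) * (H + 1) + (2 + ((N + 1) * 2 + (N + 1) * 2))))) + 1)
      fun τ => τ s = o.fold (σ₀ s) f N ∧ Set.EqOn τ σ₀ (Set.Iio s) := by
  let I (m : ℕ) (σ : Store) : Prop := m ≤ N ∧ σ (s + 1) = m ∧ σ (s + 2) = N - m ∧
    σ s = o.fold (σ₀ s) f (N - m) ∧ Set.EqOn σ σ₀ (Set.Iio s)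
  refine (HaltsWithin.loop (I := I) (fun σ h => h.2.1)
    (fun m σ ⟨hm, hctr, hidx, hacc, hframe⟩ => ?_) N σ₀
    ⟨le_rfl, hcount, by simpa using hindex, by simp [ArithOp.fold], Set.eqOn_refl _ _⟩).imp
    fun τ ⟨_, _, _, hacc, hframe⟩ => ⟨hacc, hframe⟩
  refine ⟨by omega, (size_le_self _).trans (by omega), .seq <|
    (hd (N - (m + 1)) (by omega) σ hframe hidx).imp fun τ ⟨hval, hkeep⟩ => ?_⟩
  have ctr_τ : τ (s + 1) = m + 1 := (hkeep (by simp)).trans hctr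
  have idx_τ : τ (s + 2) = N - (m + 1) := (hkeep (by simp)).trans hidx
  have acc_τ : τ s = o.fold (σ₀ s) f (N - (m + 1)) := (hkeep (by simp)).trans hacc
  refine HaltsWithin.mono ((HaltsWithin.accumulate o s τ).imp
    fun υ ⟨acc_υ, ctr_υ, idx_υ, frame_υ⟩ => ⟨by omega, by rw [ctr_υ, ctr_τ]; rfl,
      by rw [idx_υ, idx_τ]; omega, ?_, frame_υ.trans
      ((hkeep.mono (Set.Iio_subset_Iio (by omega))).trans hframe)⟩) ?_
  · rw [acc_υ, acc_τ, hval, show N - m = N - (m + 1) + 1 by omega]; rfl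
  · rw [ctr_τ, idx_τ, acc_τ, hval]
    gcongr
    · exact hG _ (by omega)
    · exact hH _ (by omega)
    · exact (size_le_self _).trans (by omega)
    · exact (size_le_self _).trans (by omega)

/-- A loop that counts the binary digits of the register `s + 1` in the register `s`. -/
theorem HaltsWithin.size {s : ℕ} {σ₀ : Store} (hacc : σ₀ s = 0) (hone : σ₀ (s + 2) = 1)
    (htwo : σ₀ (s + 3) = 2) :
    HaltsWithin
      (.loop (s + 1) (.seq (.arith .add s s (s + 2)) (.arith .div (s + 1) (s + 1) (s + 3)))) σ₀
      (Nat.size (σ₀ (s + 1)) * (Nat.size (σ₀ (s + 1)) + 1 +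
        ((Nat.size (σ₀ (s + 1)) + 1) * 2 + (Nat.size (σ₀ (s + 1)) + 1) * 3)) + 1)
      fun τ => τ s = Nat.size (σ₀ (s + 1)) ∧ Set.EqOn τ σ₀ (Set.Iio s) := by
  set L := Nat.size (σ₀ (s + 1))
  let I (m : ℕ) (σ : Store) : Prop := m ≤ L ∧ Nat.size (σ (s + 1)) = m ∧ σ s = L - m ∧
    σ (s + 2) = 1 ∧ σ (s + 3) = 2 ∧ Set.EqOn σ σ₀ (Set.Iio s)
  refine (HaltsWithin.loop (I := I) (fun σ h => Nat.size_eq_zero.1 h.2.1)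
    (fun m σ ⟨hm, hsize, hacc, hone, htwo, hframe⟩ => ?_)
    L σ₀ ⟨le_rfl, rfl, by simpa using hacc, hone, htwo, Set.eqOn_refl _ _⟩).imp
    fun τ ⟨_, _, hacc, _, _, hframe⟩ => ⟨hacc, hframe⟩
  have hpos : σ (s + 1) ≠ 0 := fun h => by simp [h] at hsize
  have hhalf : Nat.size (σ (s + 1) / 2) = m := by
    rw [size_eq_size_div_two_add_one hpos] at hsize; omega
  refine ⟨hpos, hsize.trans_le hm, HaltsWithin.mono
    (.seq <| .arith <| .arith ⟨by omega, ?_, ?_, ?_, ?_, ?_⟩) ?_⟩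
  · simpa [ArithOp.eval, htwo] using hhalf
  · simp [ArithOp.eval, hacc, hone]; omega
  · simpa using hone
  · simpa using htwo
  · exact (eqOn_Iio_update (by omega) _ _).trans ((eqOn_Iio_update le_rfl _ _).trans hframe)
  · have hsize_acc : Nat.size (σ s) ≤ L := (size_le_self _).trans (by omega)
    simp only [ne_eq, Nat.add_eq_left, one_ne_zero, OfNat.ofNat_ne_zero, not_false_eq_true,
      Function.update_of_ne, hone, htwo, Nat.size_one, size_two, hsize]
    omega

namespace PolyTime

variable {f g : Ω → ℕ}

theorem congr (hf : PolyTime f) (h : ∀ ω, g ω = f ω) : PolyTime g := by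
  rwa [show g = f from funext h]

theorem const (k : ℕ) : PolyTime (fun _ : Ω => k) where
  size_polyBounded := .const _
  exists_program _ s _ := ⟨.const s k, fun _ => Nat.size k + 1, .const _, fun _ _ _ =>
    .const ⟨Function.update_self .., eqOn_Iio_update le_rfl _ _⟩⟩

theorem arg (i : ℕ) : PolyTime (fun ω : Ω => (args ω).getD i 0) := by
  have size_le : ∀ ω : Ω, Nat.size ((args ω).getD i 0) ≤ length ω := fun ω => by
    by_cases hi : i < (args ω).length
    · rw [List.getD_eq_getElem _ _ hi]; exact size_le_length ω _ (List.getElem_mem hi)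
    · rw [List.getD_eq_default _ _ (not_lt.1 hi), Nat.size_zero]; exact Nat.zero_le _
  refine ⟨PolyBounded.length.mono size_le, fun ρ s hρ => ?_⟩
  by_cases hi : i < ρ.length
  · have hlt : ρ[i] < s := hρ _ (List.getElem_mem hi)
    refine ⟨.seq (.const s 0) (.arith .add s ρ[i] s), fun ω => length ω + 2,
      PolyBounded.length.add (.const 2), fun ω σ h => ?_⟩
    have harg : (args ω).getD i 0 = σ ρ[i] := by
      rw [← h, List.getD_eq_getElem _ _ (by simpa using hi), List.getElem_map]
    exact (HaltsWithin.copy hlt.ne' ⟨(Function.update_self ..).trans harg.symm,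
      (eqOn_Iio_update le_rfl _ _).trans (eqOn_Iio_update le_rfl _ _)⟩).mono
      (Nat.add_le_add_right (harg ▸ size_le ω) 2)
  · refine ⟨.const s 0, fun _ => 1, .const 1, fun ω σ h => .const
      ⟨(Function.update_self ..).trans ?_, eqOn_Iio_update le_rfl _ _⟩⟩
    change 0 = (args ω).getD i 0
    rw [← h, List.getD_eq_default _ _ (by simpa using hi)]

theorem index : PolyTime (fun p : ℕ × Ω => p.1) := (arg 0).congr fun _ => rfl

theorem comp_snd (hf : PolyTime f) : PolyTime (fun p : ℕ × Ω => f p.2) := by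
  refine ⟨hf.size_polyBounded.comp_snd, fun ρ s hρ => ?_⟩
  cases ρ with
  | nil => exact ⟨.skip, fun _ => 0, .const 0, fun p σ h => (List.cons_ne_nil _ _ h.symm).elim⟩
  | cons r ρ =>
    obtain ⟨c, T, hT, hc⟩ := hf.exists_program ρ s fun r hr => hρ r (List.mem_cons_of_mem _ hr)
    exact ⟨c, _, hT.comp_snd, fun p σ h => hc p.2 σ (List.cons.inj h).2⟩

theorem arith (o : ArithOp) (hf : PolyTime f) (hg : PolyTime g) :
    PolyTime fun ω => o.eval (f ω) (g ω) := by
  have bf := hf.size_polyBounded.add (.const 1)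
  have bg := hg.size_polyBounded.add (.const 1)
  refine ⟨(bf.add bg).mono fun ω => (o.size_eval_le _ _).trans (by omega), fun ρ s hρ => ?_⟩
  obtain ⟨c, T, hT, hc⟩ := hf.exists_program ρ s hρ
  obtain ⟨d, U, hU, hd⟩ := hg.exists_program ρ (s + 1) fun r hr => (hρ r hr).trans s.lt_succ_self
  refine ⟨.seq c (.seq d (.arith o s s (s + 1))), _, hT.add (hU.add (bf.mul bg)), fun ω σ h => ?_⟩
  refine .seq <| (hc ω σ h).imp fun τ ⟨hτ, frame_τ⟩ => .seq <|
    (hd ω τ (by rw [map_eq_of_eqOn_Iio hρ frame_τ, h])).imp fun υ ⟨hυ, frame_υ⟩ => ?_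
  have hυs : υ s = f ω := by rw [frame_υ s.lt_succ_self, hτ]
  refine HaltsWithin.mono (.arith ⟨?_, (eqOn_Iio_update le_rfl _ _).trans
    ((frame_υ.mono (Set.Iio_subset_Iio s.le_succ)).trans frame_τ)⟩) (by rw [hυs, hυ])
  rw [Function.update_self, hυs, hυ]

theorem add (hf : PolyTime f) (hg : PolyTime g) : PolyTime fun ω => f ω + g ω := arith .add hf hg

theorem sub (hf : PolyTime f) (hg : PolyTime g) : PolyTime fun ω => f ω - g ω := arith .sub hf hg

theorem mul (hf : PolyTime f) (hg : PolyTime g) : PolyTime fun ω => f ω * g ω := arith .mul hf hg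

theorem div (hf : PolyTime f) (hg : PolyTime g) : PolyTime fun ω => f ω / g ω := arith .div hf hg

theorem mod (hf : PolyTime f) (hg : PolyTime g) : PolyTime fun ω => f ω % g ω :=
  (hf.sub (hg.mul (hf.div hg))).congr fun ω => by
    have := Nat.div_add_mod (f ω) (g ω); omega

theorem min (hf : PolyTime f) (hg : PolyTime g) : PolyTime fun ω => min (f ω) (g ω) :=
  (hf.sub (hf.sub hg)).congr fun ω => by omega

theorem fold (o : ArithOp) (k : ℕ) {f : ℕ × Ω → ℕ} {N G : Ω → ℕ} (hf : PolyTime f)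
    (hN : PolyTime N) (bN : PolyBounded N) (hG : PolyBounded G)
    (size_le : ∀ ω, ∀ i ≤ N ω, Nat.size (o.fold k (fun j => f (j, ω)) i) ≤ G ω) :
    PolyTime fun ω => o.fold k (fun j => f (j, ω)) (N ω) := by
  refine ⟨hG.mono fun ω => size_le ω _ le_rfl, fun ρ s hρ => ?_⟩
  obtain ⟨c, T, hT, hc⟩ := hN.exists_program ρ (s + 1) fun r hr => (hρ r hr).trans (by omega)
  obtain ⟨d, U, hU, hd⟩ := hf.exists_program ((s + 2) :: ρ) (s + 3) (List.forall_mem_cons.2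
    ⟨by omega, fun r hr => (hρ r hr).trans (by omega)⟩)
  obtain ⟨U', hU', hUU'⟩ := hU.exists_uniform bN
  obtain ⟨F, hF, size_f⟩ := hf.size_polyBounded.exists_uniform bN
  have bN' := bN.add (.const 1)
  refine ⟨.seq c (.seq (.const s k) (.seq (.const (s + 2) 0)
    (.loop (s + 1) (.seq d (Cmd.accumulate o s))))), _,
    hT.add ((PolyBounded.const (Nat.size k + 1)).add ((PolyBounded.const 1).add
      ((bN.mul (bN'.add (hU'.add (((hG.add (.const 1)).mul (hF.add (.const 1))).add
        ((PolyBounded.const 2).add ((bN'.mul (.const 2)).add (bN'.mul (.const 2)))))))).add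
        (.const 1)))), fun ω σ h => ?_⟩
  refine .seq <| (hc ω σ h).imp fun τ ⟨hτ, frame_τ⟩ => .seq <| .const <| .seq <|
    HaltsWithin.mono (.const ?_) (by simp)
  set σ₀ := Function.update (Function.update τ s k) (s + 2) 0 with hσ₀
  have hacc : σ₀ s = k := by simp [hσ₀]
  have frame : Set.EqOn σ₀ σ (Set.Iio s) := (eqOn_Iio_update (by omega) _ _).trans
    ((eqOn_Iio_update le_rfl _ _).trans (frame_τ.mono (Set.Iio_subset_Iio s.le_succ)))
  have run := HaltsWithin.fold o (N := N ω) (f := fun j => f (j, ω)) (U := U' ω) (G := G ω)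
    (H := F ω) (s := s) (d := d) (σ₀ := σ₀) ?_ (hacc ▸ size_le ω)
    (fun i hi => size_f ω i hi.le) (by simp [hσ₀, hτ]) (by simp [hσ₀])
  · exact run.imp fun υ ⟨hυ, frame_υ⟩ => ⟨by rw [hυ, hacc], frame_υ.trans frame⟩
  · rintro i hi σ' frame' rfl
    refine (hd (σ' (s + 2), ω) σ' ?_).mono (hUU' ω _ hi.le)
    rw [List.map_cons, map_eq_of_eqOn_Iio hρ (frame'.trans frame), h]
    rfl

theorem sum {f : ℕ × Ω → ℕ} {N : Ω → ℕ} (hf : PolyTime f) (hN : PolyTime N)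
    (bN : PolyBounded N) : PolyTime fun ω => ∑ i ∈ Finset.range (N ω), f (i, ω) := by
  obtain ⟨F, hF, size_f⟩ := hf.size_polyBounded.exists_uniform bN
  refine (fold .add 0 hf hN bN (bN.add hF) fun ω i hi => ?_).congr
    fun ω => (ArithOp.fold_add_zero ..).symm
  have sum_le : ∑ j ∈ Finset.range i, f (j, ω) ≤ i * 2 ^ F ω := by
    simpa using Finset.sum_le_card_nsmul (Finset.range i) (fun j => f (j, ω)) (2 ^ F ω)
      fun j hj => (Nat.size_le.1 (size_f ω j ((Finset.mem_range.1 hj).le.trans hi))).le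
  rw [ArithOp.fold_add_zero, Nat.size_le, pow_add]
  exact sum_le.trans_lt (Nat.mul_lt_mul_of_pos_right (hi.trans_lt Nat.lt_two_pow_self)
    (Nat.two_pow_pos _))

theorem prod {f : ℕ × Ω → ℕ} {N : Ω → ℕ} (hf : PolyTime f) (hN : PolyTime N)
    (bN : PolyBounded N) : PolyTime fun ω => ∏ i ∈ Finset.range (N ω), f (i, ω) := by
  obtain ⟨F, hF, size_f⟩ := hf.size_polyBounded.exists_uniform bN
  refine (fold .mul 1 hf hN bN ((bN.mul hF).add (.const 1)) fun ω i hi => ?_).congr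
    fun ω => (ArithOp.fold_mul_one ..).symm
  have prod_le : ∏ j ∈ Finset.range i, f (j, ω) ≤ (2 ^ F ω) ^ i := by
    simpa using Finset.prod_le_pow_card (Finset.range i) (fun j => f (j, ω)) (2 ^ F ω)
      fun j hj => (Nat.size_le.1 (size_f ω j ((Finset.mem_range.1 hj).le.trans hi))).le
  rw [ArithOp.fold_mul_one, Nat.size_le]
  refine prod_le.trans_lt ?_
  rw [← pow_mul, mul_comm]
  exact Nat.pow_lt_pow_right one_lt_two (Nat.lt_succ_of_le (Nat.mul_le_mul_right _ hi))

theorem pow (hf : PolyTime f) (hg : PolyTime g) (bg : PolyBounded g) :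
    PolyTime fun ω => f ω ^ g ω :=
  (prod hf.comp_snd hg bg).congr fun ω => by simp

theorem size (hf : PolyTime f) : PolyTime fun ω => Nat.size (f ω) := by
  have bf := hf.size_polyBounded
  refine ⟨bf.mono fun ω => size_le_self _, fun ρ s hρ => ?_⟩
  obtain ⟨c, T, hT, hc⟩ := hf.exists_program ρ (s + 1) fun r hr => (hρ r hr).trans (by omega)
  have bf' := bf.add (.const 1)
  refine ⟨.seq c (.seq (.const s 0) (.seq (.const (s + 2) 1) (.seq (.const (s + 3) 2)
    (.loop (s + 1) (.seq (.arith .add s s (s + 2)) (.arith .div (s + 1) (s + 1) (s + 3))))))),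
    _, hT.add ((PolyBounded.const 6).add
      ((bf.mul (bf'.add ((bf'.mul (.const 2)).add (bf'.mul (.const 3))))).add (.const 1))),
    fun ω σ h => ?_⟩
  refine .seq <| (hc ω σ h).imp fun τ ⟨hτ, frame_τ⟩ => HaltsWithin.mono
    (.seq <| .const <| .seq <| .const <| .seq <| .const <|
      (HaltsWithin.size (by simp) (by simp) (by simp)).imp fun υ ⟨hυ, frame_υ⟩ => ⟨?_, ?_⟩) ?_
  · simpa [hτ] using hυ
  · exact frame_υ.trans ((eqOn_Iio_update (by omega) _ _).trans
      ((eqOn_Iio_update (by omega) _ _).trans ((eqOn_Iio_update le_rfl _ _).trans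
        (frame_τ.mono (Set.Iio_subset_Iio s.le_succ)))))
  · simp only [ne_eq, Nat.add_right_inj, OfNat.one_ne_ofNat, Nat.succ_ne_self, not_false_eq_true,
      Function.update_of_ne, hτ, Nat.size_zero, Nat.size_one, size_two]
    omega

theorem polynomial_eval (hf : PolyTime f) (P : Polynomial ℕ) :
    PolyTime fun ω => P.eval (f ω) := by
  induction P using Polynomial.induction_on' with
  | add P R hP hR => exact (hP.add hR).congr fun ω => by simp
  | monomial k a =>
    exact ((PolyTime.const a).mul (hf.pow (.const k) (.const k))).congr fun ω => by simp

theorem call {c : Cmd} {q : Polynomial ℕ} {h : Ω → ℕ} {j : ℕ} (hf : PolyTime f)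
    (hg : PolyTime g) (bf : PolyBounded f) (bg : PolyBounded g)
    (hc : ∀ ω, HaltsWithin c (initStore [f ω, g ω]) (q.eval (f ω + g ω)) fun τ => τ j = h ω) :
    PolyTime h := by
  have bq := (bf.add bg).polynomial_eval q
  have size_h : ∀ ω, Nat.size (h ω) ≤ f ω + g ω + q.eval (f ω + g ω) := fun ω => by
    obtain ⟨t, τ, run, ht, hτ⟩ := hc ω
    have size_init : ∀ i, Nat.size (initStore [f ω, g ω] i) ≤ f ω + g ω
      | 0 => (size_le_self _).trans (by simp [initStore])
      | 1 => (size_le_self _).trans (by simp [initStore])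
      | i + 2 => by simp [initStore]
    rw [← hτ]
    exact (run.size_le_add_time size_init j).trans (Nat.add_le_add_left ht _)
  refine ⟨((bf.add bg).add bq).mono size_h, fun ρ s hρ => ?_⟩
  obtain ⟨cf, Tf, hTf, hcf⟩ := hf.exists_program ρ s hρ
  obtain ⟨cg, Tg, hTg, hcg⟩ := hg.exists_program ρ (s + 1) fun r hr => (hρ r hr).trans (by omega)
  refine ⟨.seq cf (.seq cg (.seq (Cmd.clear (s + 2) (c.width + j)) (.seq (c.shift s)
      (.seq (.const (s + j + 1) 0) (.arith .add s (s + j) (s + j + 1)))))), _,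
    hTf.add (hTg.add ((PolyBounded.const (c.width + j + 1)).add
      (bq.add (((bf.add bg).add bq).add (.const 2))))), fun ω σ hσ => ?_⟩
  refine .seq <| (hcf ω σ hσ).imp fun τ₁ ⟨hτ₁, frame₁⟩ => .seq <|
    (hcg ω τ₁ (by rw [map_eq_of_eqOn_Iio hρ frame₁, hσ])).imp fun τ₂ ⟨hτ₂, frame₂⟩ => .seq <|
    (HaltsWithin.clear (s + 2) τ₂ (c.width + j)).imp fun τ₃ ⟨hzero, frame₃⟩ => ?_
  obtain ⟨t, τ, run, ht, hτ⟩ := hc ω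
  have hinit : ∀ i < c.width + j + 1, τ₃ (s + i) = initStore [f ω, g ω] i
    | 0, _ => (frame₃ (by simp)).trans ((frame₂ (by simp)).trans hτ₁)
    | 1, _ => (frame₃ (by simp)).trans hτ₂
    | i + 2, hi => by
      rw [← Nat.add_assoc, Nat.add_right_comm, hzero i (by omega)]; simp [initStore]
  obtain ⟨τ₄, run', hτ₄, frame₄⟩ := run.exists_shift s (c.width + j + 1) (by omega) τ₃ hinit
  have hresult : τ₄ (s + j) = h ω := (hτ₄ j (by omega)).trans hτ
  refine .seq ⟨t, τ₄, run', ht, HaltsWithin.mono (.copy (by omega) ⟨?_, ?_⟩) ?_⟩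
  · simp [hresult]
  · exact (eqOn_Iio_update le_rfl _ _).trans ((eqOn_Iio_update (by omega) _ _).trans
      (frame₄.trans ((frame₃.mono (Set.Iio_subset_Iio (by omega))).trans
        ((frame₂.mono (Set.Iio_subset_Iio (by omega))).trans frame₁))))
  · rw [hresult]; exact Nat.add_le_add_right (size_h ω) 2

end PolyTime

/-- Polynomial time functions whose values, and not only their sizes, are polynomially bounded, so
that the value can serve as an exponent or as the number of iterations of a loop. -/
structure PolyTimeUnary (f : Ω → ℕ) : Prop where
  polyTime : PolyTime f
  polyBounded : PolyBounded f

namespace PolyTimeUnary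

variable {f g : Ω → ℕ}

theorem const (k : ℕ) : PolyTimeUnary fun _ : Ω => k := ⟨.const k, .const k⟩

theorem index : PolyTimeUnary fun p : ℕ × Ω => p.1 := ⟨.index, .index⟩

theorem comp_snd (hf : PolyTimeUnary f) : PolyTimeUnary fun p : ℕ × Ω => f p.2 :=
  ⟨hf.1.comp_snd, hf.2.comp_snd⟩

theorem add (hf : PolyTimeUnary f) (hg : PolyTimeUnary g) : PolyTimeUnary fun ω => f ω + g ω :=
  ⟨hf.1.add hg.1, hf.2.add hg.2⟩

theorem mul (hf : PolyTimeUnary f) (hg : PolyTimeUnary g) : PolyTimeUnary fun ω => f ω * g ω :=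
  ⟨hf.1.mul hg.1, hf.2.mul hg.2⟩

theorem polynomial_eval (hf : PolyTimeUnary f) (P : Polynomial ℕ) :
    PolyTimeUnary fun ω => P.eval (f ω) :=
  ⟨hf.1.polynomial_eval P, hf.2.polynomial_eval P⟩

end PolyTimeUnary

theorem PolyTime.size_unary {f : Ω → ℕ} (hf : PolyTime f) :
    PolyTimeUnary fun ω => Nat.size (f ω) := ⟨hf.size, hf.size_polyBounded⟩

/-- Integer-valued functions that are differences of polynomial time functions. -/
def PolyTimeInt (f : Ω → ℤ) : Prop :=
  ∃ p q : Ω → ℕ, PolyTime p ∧ PolyTime q ∧ ∀ ω, f ω = (p ω : ℤ) - q ω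

namespace PolyTimeInt

variable {f g : Ω → ℤ}

theorem ofNat {f : Ω → ℕ} (hf : PolyTime f) : PolyTimeInt fun ω => (f ω : ℤ) :=
  ⟨f, _, hf, .const 0, fun _ => by simp⟩

theorem add : PolyTimeInt f → PolyTimeInt g → PolyTimeInt fun ω => f ω + g ω :=
  fun ⟨_, _, hp, hq, h⟩ ⟨_, _, hp', hq', h'⟩ =>
    ⟨_, _, hp.add hp', hq.add hq', fun ω => by simp only [h, h']; push_cast; ring⟩

theorem sub : PolyTimeInt f → PolyTimeInt g → PolyTimeInt fun ω => f ω - g ω :=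
  fun ⟨_, _, hp, hq, h⟩ ⟨_, _, hp', hq', h'⟩ =>
    ⟨_, _, hp.add hq', hq.add hp', fun ω => by simp only [h, h']; push_cast; ring⟩

theorem mul : PolyTimeInt f → PolyTimeInt g → PolyTimeInt fun ω => f ω * g ω :=
  fun ⟨_, _, hp, hq, h⟩ ⟨_, _, hp', hq', h'⟩ =>
    ⟨_, _, (hp.mul hp').add (hq.mul hq'), (hp.mul hq').add (hq.mul hp'),
      fun ω => by simp only [h, h']; push_cast; ring⟩

theorem comp_snd : PolyTimeInt f → PolyTimeInt fun p : ℕ × Ω => f p.2 :=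
  fun ⟨_, _, hp, hq, h⟩ => ⟨_, _, hp.comp_snd, hq.comp_snd, fun p => h p.2⟩

theorem sum {f : ℕ × Ω → ℤ} {N : Ω → ℕ} (hN : PolyTimeUnary N) :
    PolyTimeInt f → PolyTimeInt fun ω => ∑ i ∈ Finset.range (N ω), f (i, ω) :=
  fun ⟨_, _, hp, hq, h⟩ => ⟨_, _, hp.sum hN.1 hN.2, hq.sum hN.1 hN.2, fun ω => by simp [h]⟩

theorem toNat : PolyTimeInt f → PolyTime fun ω => (f ω).toNat :=
  fun ⟨_, _, hp, hq, h⟩ => (hp.sub hq).congr fun ω => by rw [h]; omega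

end PolyTimeInt

open Classical in
/-- Predicates that are decidable in polynomial time. -/
def PolyTimePred (P : Ω → Prop) : Prop := PolyTime fun ω => if P ω then 1 else 0

namespace PolyTimePred

variable {P Q : Ω → Prop}

theorem congr (hP : PolyTimePred P) (h : ∀ ω, Q ω ↔ P ω) : PolyTimePred Q := by
  rwa [show Q = P from funext fun ω => propext (h ω)]

theorem and (hP : PolyTimePred P) (hQ : PolyTimePred Q) : PolyTimePred fun ω => P ω ∧ Q ω :=
  (PolyTime.mul hP hQ).congr fun ω => by
    by_cases h : P ω <;> by_cases h' : Q ω <;> simp only [h, h', and_self, and_false, false_and,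
      if_true, if_false, mul_one, mul_zero]

theorem not (hP : PolyTimePred P) : PolyTimePred fun ω => ¬ P ω :=
  (PolyTime.sub (.const 1) hP).congr fun ω => by
    by_cases h : P ω <;> simp only [h, not_true, not_false_eq_true, if_true, if_false, Nat.sub_self,
      Nat.sub_zero]

theorem le {f g : Ω → ℕ} (hf : PolyTime f) (hg : PolyTime g) : PolyTimePred fun ω => f ω ≤ g ω :=
  (PolyTime.sub (.const 1) (hf.sub hg)).congr fun ω => by split_ifs <;> omega

theorem lt {f g : Ω → ℕ} (hf : PolyTime f) (hg : PolyTime g) : PolyTimePred fun ω => f ω < g ω :=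
  (le hg hf).not.congr fun _ => not_le.symm

theorem eq {f g : Ω → ℕ} (hf : PolyTime f) (hg : PolyTime g) : PolyTimePred fun ω => f ω = g ω :=
  ((le hf hg).and (le hg hf)).congr fun _ => le_antisymm_iff

theorem int_eq {f g : Ω → ℤ} : PolyTimeInt f → PolyTimeInt g → PolyTimePred fun ω => f ω = g ω :=
  fun ⟨_, _, hp, hq, h⟩ ⟨_, _, hp', hq', h'⟩ =>
    (eq (hp.add hq') (hp'.add hq)).congr fun ω => by rw [h, h']; omega

theorem forall_lt {P : ℕ × Ω → Prop} {N : Ω → ℕ} (hN : PolyTimeUnary N) (hP : PolyTimePred P) :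
    PolyTimePred fun ω => ∀ i < N ω, P (i, ω) :=
  (PolyTime.prod hP hN.1 hN.2).congr fun ω => by
    by_cases h : ∀ i < N ω, P (i, ω)
    · rw [if_pos h, Finset.prod_eq_one fun i hi => if_pos (h i (Finset.mem_range.1 hi))]
    · rw [if_neg h]
      push Not at h
      obtain ⟨i, hi, h⟩ := h
      exact (Finset.prod_eq_zero (Finset.mem_range.2 hi) (if_neg h)).symm

end PolyTimePred

theorem PolyTime.ite {P : Ω → Prop} [DecidablePred P] {f g : Ω → ℕ} (hP : PolyTimePred P)
    (hf : PolyTime f) (hg : PolyTime g) : PolyTime fun ω => if P ω then f ω else g ω :=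
  ((PolyTime.mul hP hf).add (PolyTime.mul hP.not hg)).congr fun ω => by
    by_cases h : P ω <;> simp [h]

end PolyTime

/-! ## Polynomial time verifiers -/

/-- The input of a verifier, as three numbers. -/
structure VerifierInput where
  instanceCode : ℕ
  coins : ℕ
  message : ℕ

instance : ProgramInput VerifierInput where
  args ω := [ω.instanceCode, ω.coins, ω.message]
  length ω := Nat.size ω.instanceCode + Nat.size ω.coins + Nat.size ω.message
  size_le_length ω x hx := by
    simp only [List.mem_cons, List.not_mem_nil, or_false] at hx
    rcases hx with rfl | rfl | rfl <;> omega

namespace PolyTime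

theorem instanceCode : PolyTime VerifierInput.instanceCode := (arg 0).congr fun _ => rfl

theorem coins : PolyTime VerifierInput.coins := (arg 1).congr fun _ => rfl

theorem message : PolyTime VerifierInput.message := (arg 2).congr fun _ => rfl

end PolyTime

theorem size_codeBits (x : List Bool) : Nat.size (codeBits x) = x.length + 1 := by
  induction x with
  | nil => simp [codeBits]
  | cons b l ih =>
    have hpos : codeBits l ≠ 0 := fun h => by simp [h] at ih
    have hbit : codeBits (b :: l) = Nat.bit b (codeBits l) := by rw [Nat.bit_val]; rfl
    rw [hbit, Nat.size_bit (by cases b <;> simp [Nat.bit_val, hpos]), ih]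
    rfl

open Classical in
/-- The coins of length `ℓ` to which some message of length `ℓ` is an accepted answer, when `A r m`
says that the verifier accepts the message `m` to the coins `r`. -/
noncomputable def winningCoins (A : ℕ → ℕ → Prop) (ℓ : ℕ) : Finset ℕ :=
  (Finset.range (2 ^ ℓ)).filter fun r => ∃ m < 2 ^ ℓ, A r m

theorem PolyTimePred.exists_verifier {A : ℕ → ℕ → ℕ → Prop}
    (hA : PolyTimePred fun ω : VerifierInput => A ω.instanceCode ω.coins ω.message) :
    ∃ (V : Cmd) (q : Polynomial ℕ), ∀ X r m, HaltsWithin V (initStore [X, r, m])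
      (q.eval (Nat.size X + Nat.size r + Nat.size m)) fun τ => τ 0 ≠ 0 ↔ A X r m := by
  classical
  obtain ⟨c, T, ⟨P, hP⟩, hc⟩ := hA.exists_program [0, 1, 2] 3 (by simp)
  refine ⟨.seq c (.seq (.const 4 0) (.arith .add 0 3 4)), P + 3, fun X r m => ?_⟩
  refine HaltsWithin.mono (S := T ⟨X, r, m⟩ + 3) (.seq <| (hc ⟨X, r, m⟩ _ rfl).imp
    fun τ ⟨hτ, _⟩ => HaltsWithin.mono (.copy (by omega) ?_) ?_) ?_
  · rw [Function.update_self, hτ, ne_eq, ite_eq_right_iff]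
    simp
  · have : Nat.size (τ 3) ≤ 1 := by rw [hτ]; dsimp only; split_ifs <;> simp
    omega
  · rw [Polynomial.eval_add, Polynomial.eval_ofNat]
    exact Nat.add_le_add_right (hP ⟨X, r, m⟩) 3

theorem inAM_of_winningCoins {P : PromiseProblem} {A : ℕ → ℕ → ℕ → Prop}
    (hA : PolyTimePred fun ω : VerifierInput => A ω.instanceCode ω.coins ω.message)
    (ℓ : Polynomial ℕ)
    (hyes : ∀ x ∈ P.yes, (2 / 3 : ℝ) ≤
      ((winningCoins (A (codeBits x)) (ℓ.eval x.length)).card : ℝ) / 2 ^ ℓ.eval x.length)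
    (hno : ∀ x ∈ P.no,
      ((winningCoins (A (codeBits x)) (ℓ.eval x.length)).card : ℝ) / 2 ^ ℓ.eval x.length ≤ 1 / 3) :
    InAM P := by
  obtain ⟨V, q, hV⟩ := hA.exists_verifier
  have accepts_iff : ∀ x r m, Accepts V x r m ↔ A (codeBits x) r m := fun x r m => by
    obtain ⟨t, τ, run, -, hτ⟩ := hV (codeBits x) r m
    refine ⟨fun ⟨t', τ', run', h⟩ => ?_, fun h => ⟨t, τ, run, hτ.2 h⟩⟩
    exact hτ.1 ((run.deterministic run').2 ▸ h)
  have acceptProb_eq : ∀ x l, acceptProb V l x =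
      ((winningCoins (A (codeBits x)) l).card : ℝ) / 2 ^ l := fun x l => by
    rw [acceptProb, winningCoins]
    congr! 7 with r _ m
    exact accepts_iff x r m
  refine ⟨V, ℓ, q.comp (Polynomial.X + 1 + ℓ + ℓ), fun x r m hr hm => ?_,
    fun x hx => by rw [acceptProb_eq]; exact hyes x hx,
    fun x hx => by rw [acceptProb_eq]; exact hno x hx⟩
  obtain ⟨t, τ, run, ht, -⟩ := hV (codeBits x) r m
  refine ⟨t, τ, run, ht.trans ?_⟩
  rw [Polynomial.eval_comp]
  refine polynomial_eval_mono q ?_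
  simpa [size_codeBits] using Nat.add_le_add (Nat.add_le_add_left (Nat.size_le.2 hr) (x.length + 1))
    (Nat.size_le.2 hm)

/-! ## The binary encoding as arithmetic -/

/-- The number that codes the bit string `encodeNat k ++ t` when `Y` codes `t`. The closed form
makes it polynomial-time computable by a bounded sum. -/
def natCode (k Y : ℕ) : ℕ :=
  ∑ i ∈ Finset.range (Nat.size k), (1 + 2 * (k / 2 ^ i % 2)) * 4 ^ i + 2 ^ (2 * Nat.size k + 1) * Y

theorem natCode_zero_left (Y : ℕ) : natCode 0 Y = 2 * Y := by simp [natCode]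

theorem natCode_of_ne_zero {k : ℕ} (hk : k ≠ 0) (Y : ℕ) :
    natCode k Y = 1 + 2 * (k % 2) + 4 * natCode (k / 2) Y := by
  have hterm : ∀ i, (1 + 2 * (k / 2 ^ (i + 1) % 2)) * 4 ^ (i + 1) =
      4 * ((1 + 2 * (k / 2 / 2 ^ i % 2)) * 4 ^ i) := fun i => by
    rw [Nat.div_div_eq_div_mul, pow_succ' 2, pow_succ]; ring
  rw [natCode, size_eq_size_div_two_add_one hk, Finset.sum_range_succ', natCode, mul_add 4,
    Finset.mul_sum]
  simp only [hterm, pow_zero, Nat.div_one, mul_one]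
  ring

theorem natCode_inj {k k' Y Y' : ℕ} (h : natCode k Y = natCode k' Y') : k = k' ∧ Y = Y' := by
  induction k using Nat.strong_induction_on generalizing k' with
  | _ k ih =>
    rcases eq_or_ne k 0 with rfl | hk <;> rcases eq_or_ne k' 0 with rfl | hk'
    · simp only [natCode_zero_left] at h; omega
    · rw [natCode_zero_left, natCode_of_ne_zero hk'] at h; omega
    · rw [natCode_zero_left, natCode_of_ne_zero hk] at h; omega
    · rw [natCode_of_ne_zero hk, natCode_of_ne_zero hk'] at h
      obtain ⟨hhalf, hY⟩ := ih (k / 2) (by omega) (k' := k' / 2) (by omega)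
      omega

theorem two_mul_le_natCode (k Y : ℕ) : 2 * Y ≤ natCode k Y := by
  refine le_trans ?_ (Nat.le_add_left _ _)
  rw [pow_succ, mul_assoc]
  exact Nat.le_mul_of_pos_left _ (Nat.two_pow_pos _)

theorem le_natCode_left (k : ℕ) {Y : ℕ} (hY : 0 < Y) : k ≤ natCode k Y :=
  calc k ≤ 2 ^ Nat.size k := (Nat.lt_size_self k).le
    _ ≤ 2 ^ (2 * Nat.size k + 1) := Nat.pow_le_pow_right two_pos (by omega)
    _ ≤ 2 ^ (2 * Nat.size k + 1) * Y := Nat.le_mul_of_pos_right _ hY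
    _ ≤ natCode k Y := Nat.le_add_left _ _

theorem bits_eq_bodd_cons {k : ℕ} (hk : k ≠ 0) : Nat.bits k = k.bodd :: Nat.bits (k / 2) := by
  have hbit : Nat.bit k.bodd (k / 2) = k := by rw [← Nat.div2_val, Nat.bit_bodd_div2]
  conv_lhs => rw [← hbit]
  refine Nat.bits_append_bit _ _ fun hhalf => ?_
  by_contra hodd
  rw [hhalf, Bool.eq_false_of_not_eq_true hodd] at hbit
  exact hk hbit.symm

theorem codeBits_encodeNat (k : ℕ) (t : List Bool) :
    codeBits (encodeNat k ++ t) = natCode k (codeBits t) := by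
  induction k using Nat.strong_induction_on with
  | _ k ih =>
    rcases eq_or_ne k 0 with rfl | hk
    · simp [natCode_zero_left, encodeNat, codeBits]
    · rw [natCode_of_ne_zero hk, ← ih (k / 2) (by omega), Nat.mod_two_of_bodd]
      simp only [encodeNat, bits_eq_bodd_cons hk, List.flatMap_cons, List.cons_append,
        List.nil_append, codeBits, Bool.toNat_true]
      ring

theorem codeBits_encodeInt (z : ℤ) (t : List Bool) :
    codeBits (encodeInt z ++ t) =
      (decide (z < 0)).toNat + 2 * natCode z.natAbs (codeBits t) := by
  simp only [encodeInt, List.cons_append, codeBits, codeBits_encodeNat]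
  ring

theorem codeBits_encodeRat (q : ℚ) (t : List Bool) : codeBits (encodeRat q ++ t) =
    (decide (q.num < 0)).toNat + 2 * natCode q.num.natAbs (natCode q.den (codeBits t)) := by
  rw [encodeRat, List.append_assoc, codeBits_encodeInt, codeBits_encodeNat]

theorem codeBits_pos (x : List Bool) : 0 < codeBits x := by
  rw [← Nat.size_pos, size_codeBits]
  exact Nat.succ_pos _

theorem codeBits_lt (x : List Bool) : codeBits x < 2 ^ (x.length + 1) := by
  rw [← size_codeBits]
  exact Nat.lt_size_self _

/-- The entries of a square matrix as a sequence, row by row, continued by `0`. -/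
def rowMajor {R : Type*} [Zero R] {n : ℕ} (B : Matrix (Fin n) (Fin n) R) (e : ℕ) : R :=
  if h : e < n * n then B (Fin.divNat ⟨e, h⟩) (Fin.modNat ⟨e, h⟩) else 0

theorem mul_add_lt_sq {n : ℕ} (i j : Fin n) : (i : ℕ) * n + j < n * n :=
  calc (i : ℕ) * n + j < i * n + n := Nat.add_lt_add_left j.2 _
    _ = (i + 1) * n := (Nat.succ_mul _ _).symm
    _ ≤ n * n := Nat.mul_le_mul_right n i.2

theorem rowMajor_apply {R : Type*} [Zero R] {n : ℕ} (B : Matrix (Fin n) (Fin n) R)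
    (i j : Fin n) : rowMajor B (i * n + j) = B i j := by
  rw [rowMajor, dif_pos (mul_add_lt_sq i j)]
  congr 1
  · ext; simp [Fin.divNat, Nat.mul_comm i.1 n, Nat.mul_add_div i.pos]
  · ext; simp [Fin.modNat, Nat.mod_eq_of_lt j.2]

/-- The code of the part of `encodeMatrix B` that starts at the `e`-th entry. -/
def suffixCode {n : ℕ} (B : Matrix (Fin n) (Fin n) ℚ) (e : ℕ) : ℕ :=
  codeBits ((List.ofFn fun i : Fin (n * n) => encodeRat (rowMajor B i)).drop e).flatten

section

variable {n : ℕ} (B : Matrix (Fin n) (Fin n) ℚ)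

theorem suffixCode_of_le {e : ℕ} (he : n * n ≤ e) : suffixCode B e = 1 := by
  rw [suffixCode, List.drop_of_length_le (by simpa using he)]
  rfl

theorem suffixCode_eq_natCode {e : ℕ} (he : e < n * n) :
    suffixCode B e = (decide ((rowMajor B e).num < 0)).toNat +
      2 * natCode (rowMajor B e).num.natAbs
        (natCode (rowMajor B e).den (suffixCode B (e + 1))) := by
  rw [suffixCode, List.drop_eq_getElem_cons (by simpa using he), List.flatten_cons,
    List.getElem_ofFn, codeBits_encodeRat]
  rfl

theorem codeBits_encodeMatrix : codeBits (encodeMatrix B) = natCode n (suffixCode B 0) := by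
  rw [encodeMatrix, codeBits_encodeNat, suffixCode, List.drop_zero, List.ofFn_mul,
    List.flatten_flatten, List.map_ofFn]
  congr! 5 with i
  refine congrArg _ (congrArg _ (funext fun j => ?_))
  exact (congrArg encodeRat (rowMajor_apply B i j)).symm

theorem suffixCode_pos (e : ℕ) : 0 < suffixCode B e :=
  codeBits_pos _

theorem two_mul_suffixCode_succ_le {e : ℕ} (he : e < n * n) :
    2 * suffixCode B (e + 1) ≤ suffixCode B e := by
  rw [suffixCode_eq_natCode B he]
  have hden := two_mul_le_natCode (rowMajor B e).den (suffixCode B (e + 1))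
  have hnum := two_mul_le_natCode (rowMajor B e).num.natAbs
    (natCode (rowMajor B e).den (suffixCode B (e + 1)))
  omega

theorem two_pow_mul_suffixCode_le {e : ℕ} (he : e ≤ n * n) :
    2 ^ e * suffixCode B e ≤ suffixCode B 0 := by
  induction e with
  | zero => simp
  | succ e ih =>
    refine le_trans ?_ (ih (by omega))
    rw [pow_succ, mul_assoc]
    exact Nat.mul_le_mul_left _ (two_mul_suffixCode_succ_le B he)

theorem suffixCode_le (e : ℕ) : suffixCode B e ≤ suffixCode B 0 := by
  rcases le_total e (n * n) with he | he
  · exact (Nat.le_mul_of_pos_left _ (Nat.two_pow_pos e)).trans (two_pow_mul_suffixCode_le B he)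
  · rw [suffixCode_of_le B he]
    exact suffixCode_pos B 0

theorem suffixCode_lt (e : ℕ) : suffixCode B e < 2 ^ ((encodeMatrix B).length + 1) :=
  calc suffixCode B e ≤ suffixCode B 0 := suffixCode_le B e
    _ ≤ 2 * suffixCode B 0 := Nat.le_mul_of_pos_left _ two_pos
    _ ≤ natCode n (suffixCode B 0) := two_mul_le_natCode n _
    _ = codeBits (encodeMatrix B) := (codeBits_encodeMatrix B).symm
    _ < 2 ^ ((encodeMatrix B).length + 1) := codeBits_lt _

theorem sq_dim_le_length : n * n ≤ (encodeMatrix B).length := by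
  have hpow : 2 ^ (n * n) < 2 ^ ((encodeMatrix B).length + 1) :=
    calc 2 ^ (n * n) ≤ suffixCode B 0 := by
          simpa only [suffixCode_of_le B le_rfl, mul_one] using
            two_pow_mul_suffixCode_le B le_rfl
      _ < _ := suffixCode_lt B 0
  exact Nat.le_of_lt_succ ((Nat.pow_lt_pow_iff_right one_lt_two).1 hpow)

theorem dim_le_length : n ≤ (encodeMatrix B).length :=
  (Nat.le_mul_self n).trans (sq_dim_le_length B)

theorem natAbs_num_lt (e : ℕ) :
    (rowMajor B e).num.natAbs < 2 ^ ((encodeMatrix B).length + 1) := by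
  refine lt_of_le_of_lt ?_ (suffixCode_lt B e)
  by_cases he : e < n * n
  case neg => simp [rowMajor, he]
  have htail := two_mul_le_natCode (rowMajor B e).den (suffixCode B (e + 1))
  have hpos := suffixCode_pos B (e + 1)
  have hnum := le_natCode_left (rowMajor B e).num.natAbs
    (Y := natCode (rowMajor B e).den (suffixCode B (e + 1))) (by omega)
  rw [suffixCode_eq_natCode B he]
  omega

theorem den_lt (e : ℕ) : (rowMajor B e).den < 2 ^ ((encodeMatrix B).length + 1) := by
  refine lt_of_le_of_lt ?_ (suffixCode_lt B e)
  by_cases he : e < n * n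
  case neg =>
    rw [rowMajor, dif_neg he]
    exact suffixCode_pos B e
  have hden := le_natCode_left (rowMajor B e).den (suffixCode_pos B (e + 1))
  have htail := two_mul_le_natCode (rowMajor B e).num.natAbs
    (natCode (rowMajor B e).den (suffixCode B (e + 1)))
  rw [suffixCode_eq_natCode B he]
  omega

/-- If signs `S e`, absolute numerators `A e`, denominators `D e` and remaining codes `Y e` fit
together to the code of `B`, they are those of `B`: this lets a verifier accept the parse of its
instance from the prover. -/
theorem parse_unique {n' : ℕ} {A D S Y : ℕ → ℕ} (hS : ∀ e, S e < 2)
    (hY : codeBits (encodeMatrix B) = natCode n' (Y 0))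
    (hstep : ∀ e < n' * n', Y e = S e + 2 * natCode (A e) (natCode (D e) (Y (e + 1)))) :
    n' = n ∧ ∀ e < n * n, S e = (decide ((rowMajor B e).num < 0)).toNat ∧
      A e = (rowMajor B e).num.natAbs ∧ D e = (rowMajor B e).den := by
  rw [codeBits_encodeMatrix] at hY
  obtain ⟨rfl, hY₀⟩ := natCode_inj hY
  have entry : ∀ e < n * n, Y e = suffixCode B e →
      (S e = (decide ((rowMajor B e).num < 0)).toNat ∧
        A e = (rowMajor B e).num.natAbs ∧ D e = (rowMajor B e).den) ∧
      Y (e + 1) = suffixCode B (e + 1) := fun e he h => by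
    rw [suffixCode_eq_natCode B he, hstep e he] at h
    have hS := hS e
    have hsign := Bool.toNat_le (decide ((rowMajor B e).num < 0))
    have hcode : natCode (A e) (natCode (D e) (Y (e + 1))) =
      natCode (rowMajor B e).num.natAbs (natCode (rowMajor B e).den (suffixCode B (e + 1))) := by
      omega
    obtain ⟨hA, hrest⟩ := natCode_inj hcode
    obtain ⟨hD, htail⟩ := natCode_inj hrest
    exact ⟨⟨by omega, hA, hD⟩, htail⟩
  have code : ∀ e ≤ n * n, Y e = suffixCode B e := fun e => by
    induction e with
    | zero => exact fun _ => hY₀.symm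
    | succ e ih => exact fun he => (entry e he (ih (by omega))).2
  exact ⟨rfl, fun e he => (entry e he (code e he.le)).1⟩

end

/-! ## The dual lattice in coordinates -/

section

variable {n : ℕ} (B : Matrix (Fin n) (Fin n) ℚ)

/-- The matrix whose columns form the basis of the dual lattice dual to the columns of `B`. -/
noncomputable def dualMatrix : Matrix (Fin n) (Fin n) ℝ :=
  ((B.map fun q => (q : ℝ)).transpose)⁻¹

/-- The dual lattice vector with coordinates `z` in the dual basis. -/
noncomputable def dualVec (z : Fin n → ℤ) : EuclideanSpace ℝ (Fin n) :=
  WithLp.toLp 2 ((dualMatrix B).mulVec fun k => (z k : ℝ))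

variable {B}

theorem isUnit_det_transpose_map_cast (hB : B.det ≠ 0) :
    IsUnit ((B.map fun q => (q : ℝ)).transpose).det := by
  have hdet : (B.map fun q => (q : ℝ)).det = ((B.det : ℚ) : ℝ) :=
    (RingHom.map_det (Rat.castHom ℝ) B).symm
  rw [Matrix.det_transpose, isUnit_iff_ne_zero, hdet]
  exact_mod_cast hB

theorem sum_mul_dualVec (hB : B.det ≠ 0) (z : Fin n → ℤ) (j : Fin n) :
    ∑ i, (B i j : ℝ) * dualVec B z i = z j := by
  have h := congrFun (Matrix.mulVec_mulVec (fun k => (z k : ℝ))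
    ((B.map fun q => (q : ℝ)).transpose) (dualMatrix B)) j
  rw [dualMatrix, Matrix.mul_nonsing_inv _ (isUnit_det_transpose_map_cast hB),
    Matrix.one_mulVec] at h
  rw [← h]
  rfl

theorem dualVec_eq_of_sum_mul_eq (hB : B.det ≠ 0) {y : EuclideanSpace ℝ (Fin n)} {z : Fin n → ℤ}
    (h : ∀ j, ∑ i, (B i j : ℝ) * y i = z j) : dualVec B z = y := by
  have hz : (fun k => (z k : ℝ)) = ((B.map fun q => (q : ℝ)).transpose).mulVec y.ofLp :=
    funext fun j => (h j).symm
  rw [dualVec, hz, Matrix.mulVec_mulVec, dualMatrix,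
    Matrix.nonsing_inv_mul _ (isUnit_det_transpose_map_cast hB), Matrix.one_mulVec]

theorem dualVec_injective (hB : B.det ≠ 0) : Function.Injective (dualVec B) := fun z z' h => by
  funext j
  have hj := sum_mul_dualVec hB z j
  rw [h, sum_mul_dualVec hB z' j] at hj
  exact_mod_cast hj.symm

theorem dualVec_zero : dualVec B 0 = 0 := by
  ext i
  simp [dualVec, Matrix.mulVec, dotProduct]

theorem inner_column (y : EuclideanSpace ℝ (Fin n)) (j : Fin n) :
    inner ℝ y (WithLp.toLp 2 fun i : Fin n => ((B i j : ℚ) : ℝ)) = ∑ i, (B i j : ℝ) * y i := by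
  simp [PiLp.inner_apply]

theorem mem_dualLattice_iff (hB : B.det ≠ 0) (y : EuclideanSpace ℝ (Fin n)) :
    y ∈ dualLattice (latticeOf B) ↔ ∃ z, dualVec B z = y := by
  rw [dualLattice, LinearMap.BilinForm.mem_dualSubmodule]
  constructor
  · intro h
    have integral : ∀ j, ∃ a : ℤ, ∑ i, (B i j : ℝ) * y i = a := fun j => by
      obtain ⟨a, ha⟩ := Submodule.mem_one.1 (h _ (Submodule.subset_span ⟨j, rfl⟩))
      exact ⟨a, by rw [← inner_column y j]; simpa using ha.symm⟩
    choose z hz using integral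
    exact ⟨z, dualVec_eq_of_sum_mul_eq hB hz⟩
  · rintro ⟨z, rfl⟩ x hx
    induction hx using Submodule.span_induction with
    | mem x hx =>
      obtain ⟨j, rfl⟩ := hx
      have hinner := (inner_column (dualVec B z) j).trans (sum_mul_dualVec hB z j)
      exact Submodule.mem_one.2 ⟨z j, by simpa using hinner.symm⟩
    | zero => rw [map_zero]; exact Submodule.zero_mem _
    | add x y _ _ hx hy => rw [map_add]; exact Submodule.add_mem _ hx hy
    | smul a x _ hx =>
      have hsmul : (innerₗ (EuclideanSpace ℝ (Fin n))) (dualVec B z) (a • x) =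
          a • (innerₗ (EuclideanSpace ℝ (Fin n))) (dualVec B z) x := map_zsmul _ a x
      rw [hsmul]
      exact Submodule.smul_mem _ _ hx

theorem gaussianMass_dualLattice_eq_tsum (hB : B.det ≠ 0) (s : ℝ) :
    gaussianMass (1 / s) ((dualLattice (latticeOf B) : Set (EuclideanSpace ℝ (Fin n))) \ {0}) =
      ∑' z : {z : Fin n → ℤ // z ≠ 0},
        ENNReal.ofReal (Real.exp (-(Real.pi * s ^ 2 * ‖dualVec B z‖ ^ 2))) := by
  let φ : {z : Fin n → ℤ // z ≠ 0} →
      ((dualLattice (latticeOf B) : Set (EuclideanSpace ℝ (Fin n))) \ {0} : Set _) := fun z =>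
    ⟨dualVec B z, (mem_dualLattice_iff hB _).2 ⟨z, rfl⟩,
      fun h => z.2 (dualVec_injective hB (Eq.trans h dualVec_zero.symm))⟩
  have hφ : Function.Bijective φ := by
    refine ⟨fun z z' h => Subtype.ext (dualVec_injective hB (Subtype.ext_iff.1 h)), ?_⟩
    rintro ⟨y, hy, hy₀⟩
    obtain ⟨z, rfl⟩ := (mem_dualLattice_iff hB y).1 hy
    exact ⟨⟨z, fun h => hy₀ (h ▸ dualVec_zero)⟩, rfl⟩
  rw [gaussianMass, ← (Equiv.ofBijective φ hφ).tsum_eq]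
  refine tsum_congr fun z => congrArg ENNReal.ofReal (congrArg Real.exp ?_)
  simp only [Equiv.ofBijective_apply, φ]
  rw [one_div, inv_pow, div_inv_eq_mul]
  ring

theorem gaussianMass_dualLattice_le_iff (hB : B.det ≠ 0) (s : ℝ) {ε : ℝ} (hε : 0 ≤ ε) :
    gaussianMass (1 / s) ((dualLattice (latticeOf B) : Set (EuclideanSpace ℝ (Fin n))) \ {0}) ≤
      ENNReal.ofReal ε ↔ ∀ F : Finset (Fin n → ℤ), 0 ∉ F →
        ∑ z ∈ F, Real.exp (-(Real.pi * s ^ 2 * ‖dualVec B z‖ ^ 2)) ≤ ε := by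
  have ofReal_sum_le_iff : ∀ F : Finset {z : Fin n → ℤ // z ≠ 0},
      ∑ z ∈ F, ENNReal.ofReal (Real.exp (-(Real.pi * s ^ 2 * ‖dualVec B z‖ ^ 2))) ≤
        ENNReal.ofReal ε ↔ ∑ z ∈ F, Real.exp (-(Real.pi * s ^ 2 * ‖dualVec B z‖ ^ 2)) ≤ ε :=
    fun F => by
      rw [← ENNReal.ofReal_sum_of_nonneg fun _ _ => (Real.exp_pos _).le,
        ENNReal.ofReal_le_ofReal_iff hε]
  rw [gaussianMass_dualLattice_eq_tsum hB, ENNReal.tsum_eq_iSup_sum, iSup_le_iff]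
  simp only [ofReal_sum_le_iff]
  constructor
  · intro h F hF
    rw [← Finset.sum_subtype_of_mem (p := fun z => z ≠ 0) _ fun z hz hz₀ => hF (hz₀ ▸ hz)]
    exact h _
  · intro h F
    refine le_of_eq_of_le ?_ (h (F.map (Function.Embedding.subtype _)) (by simp))
    rw [Finset.sum_map]
    rfl

/-! ## Certificates for the dual basis -/

variable (B)

/-- A common denominator of the entries of `B`. -/
def commonDen : ℕ := ∏ e ∈ Finset.range (n * n), (rowMajor B e).den

/-- The entries of the integer matrix `commonDen B • B`, row by row. -/
def scaledEntry (e : ℕ) : ℤ := (rowMajor B e).num * ((commonDen B / (rowMajor B e).den : ℕ) : ℤ)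

theorem commonDen_pos : 0 < commonDen B := Finset.prod_pos fun _ _ => Rat.den_pos _

theorem commonDen_le {b : ℕ} (h : ∀ e < n * n, (rowMajor B e).den ≤ b) :
    commonDen B ≤ b ^ (n * n) := by
  simpa only [commonDen, Finset.card_range] using
    Finset.prod_le_pow_card (Finset.range (n * n)) (fun e => (rowMajor B e).den) b
      fun e he => h e (Finset.mem_range.1 he)

theorem scaledEntry_cast {e : ℕ} (he : e < n * n) :
    (scaledEntry B e : ℚ) = commonDen B * rowMajor B e := by
  obtain ⟨m, hm⟩ : (rowMajor B e).den ∣ commonDen B :=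
    Finset.dvd_prod_of_mem (fun e => (rowMajor B e).den) (Finset.mem_range.2 he)
  rw [scaledEntry, hm, Nat.mul_div_cancel_left _ (Rat.den_pos _)]
  push_cast
  linear_combination (-(m : ℚ)) * Rat.mul_den_eq_num (rowMajor B e)

theorem scaledEntry_apply (i j : Fin n) :
    (scaledEntry B (i * n + j) : ℚ) = commonDen B * B i j := by
  rw [scaledEntry_cast B (mul_add_lt_sq i j), rowMajor_apply]

theorem scaledEntry_apply_real (i j : Fin n) :
    (scaledEntry B (i * n + j) : ℝ) = commonDen B * (B i j : ℝ) := by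
  exact_mod_cast scaledEntry_apply B i j

/-- The integer matrix `E / d`, with entries listed row by row, is the inverse transpose of
`commonDen B • B`. This makes the dual basis of `B` checkable by integer identities. -/
def IsDualCertificate (E : ℕ → ℤ) (d : ℕ) : Prop :=
  0 < d ∧ ∀ j < n, ∀ k < n, ∑ i ∈ Finset.range n, scaledEntry B (i * n + j) * E (i * n + k) =
    if j = k then (d : ℤ) else 0

/-- The integer `‖E z‖ ^ 2`; for a dual certificate `(E, d)` of `B` it is the squared norm of the
dual vector with coordinates `z`, multiplied by `(d / commonDen B) ^ 2`. -/
def certificateNorm (n : ℕ) (E : ℕ → ℤ) (z : ℕ → ℤ) : ℤ :=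
  ∑ i ∈ Finset.range n, (∑ k ∈ Finset.range n, E (i * n + k) * z k) ^ 2

/-- The integer vector `commonDen B • E z`; for a dual certificate `(E, d)` of `B` it is `d` times
the dual vector with coordinates `z`. -/
def scaledDualVec (E : ℕ → ℤ) (z : Fin n → ℤ) (i : Fin n) : ℤ :=
  commonDen B * ∑ k : Fin n, E (i * n + k) * z k

variable {B}

namespace IsDualCertificate

variable {E : ℕ → ℤ} {d : ℕ}

theorem dualMatrix_eq (h : IsDualCertificate B E d) :
    dualMatrix B = Matrix.of fun i k : Fin n => (commonDen B : ℝ) / d * E (i * n + k) := by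
  have hd : (d : ℝ) ≠ 0 := by exact_mod_cast h.1.ne'
  refine Matrix.inv_eq_right_inv ?_
  ext j k
  have hterm : ∀ i : Fin n, (B i j : ℝ) * (commonDen B / d * E (i * n + k)) =
      ((scaledEntry B (i * n + j) * E (i * n + k) : ℤ) : ℝ) / d := fun i => by
    push_cast
    rw [scaledEntry_apply_real]
    ring
  have hsum := h.2 j j.2 k k.2
  rw [Finset.sum_range] at hsum
  simp only [Matrix.mul_apply, Matrix.transpose_apply, Matrix.map_apply, Matrix.of_apply]
  rw [Finset.sum_congr rfl fun i _ => hterm i, ← Finset.sum_div, ← Int.cast_sum, hsum]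
  rcases eq_or_ne j k with rfl | hjk
  · simp [hd]
  · rw [if_neg (fun h => hjk (Fin.ext h)), Matrix.one_apply_ne hjk, Int.cast_zero, zero_div]

theorem dualVec_apply (h : IsDualCertificate B E d) (z : Fin n → ℤ) (i : Fin n) :
    dualVec B z i = commonDen B / d * ∑ k : Fin n, (E (i * n + k) : ℝ) * z k := by
  rw [dualVec, h.dualMatrix_eq, Finset.mul_sum]
  simp only [Matrix.mulVec, dotProduct, Matrix.of_apply]
  exact Finset.sum_congr rfl fun k _ => mul_assoc _ _ _

theorem norm_dualVec_sq (h : IsDualCertificate B E d) (z : ℕ → ℤ) :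
    ‖dualVec B fun k : Fin n => z k‖ ^ 2 =
      (commonDen B : ℝ) ^ 2 * certificateNorm n E z / (d : ℝ) ^ 2 := by
  rw [EuclideanSpace.norm_sq_eq, certificateNorm, Finset.sum_range]
  push_cast
  rw [Finset.mul_sum, Finset.sum_div]
  refine Finset.sum_congr rfl fun i _ => ?_
  rw [h.dualVec_apply, Real.norm_eq_abs, sq_abs, Finset.sum_range]
  ring

theorem scaledDualVec_cast (h : IsDualCertificate B E d) (z : Fin n → ℤ) (i : Fin n) :
    (scaledDualVec B E z i : ℝ) = d * dualVec B z i := by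
  have hd : (d : ℝ) ≠ 0 := by exact_mod_cast h.1.ne'
  rw [h.dualVec_apply, scaledDualVec]
  push_cast
  field_simp

theorem scaledDualVec_injective (hB : B.det ≠ 0) (h : IsDualCertificate B E d) :
    Function.Injective (scaledDualVec B E) := fun z z' hz => by
  refine dualVec_injective hB (PiLp.ext fun i => ?_)
  have hi := h.scaledDualVec_cast z i
  rw [hz, h.scaledDualVec_cast z' i] at hi
  exact (mul_left_cancel₀ (by exact_mod_cast h.1.ne') hi).symm

theorem sum_abs_scaledDualVec_le (h : IsDualCertificate B E d) (z : Fin n → ℤ) :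
    ∑ i, |(scaledDualVec B E z i : ℝ)| ≤ (d : ℝ) ^ 2 * ‖dualVec B z‖ ^ 2 := by
  rw [EuclideanSpace.norm_sq_eq, Finset.mul_sum]
  refine Finset.sum_le_sum fun i _ => ?_
  rw [Real.norm_eq_abs, ← abs_of_nonneg (Nat.cast_nonneg' d : (0 : ℝ) ≤ d), ← mul_pow, ← abs_mul,
    ← h.scaledDualVec_cast, sq_abs]
  exact_mod_cast show |scaledDualVec B E z i| ≤ scaledDualVec B E z i ^ 2 by
    simpa only [sq_abs] using Int.le_self_sq |scaledDualVec B E z i|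

theorem one_le_sq_mul_norm_dualVec_sq (hB : B.det ≠ 0) (h : IsDualCertificate B E d)
    {z : Fin n → ℤ} (hz : z ≠ 0) : 1 ≤ (d : ℝ) ^ 2 * ‖dualVec B z‖ ^ 2 := by
  have scaledDualVec_zero : scaledDualVec B E 0 = 0 := funext fun i => by simp [scaledDualVec]
  obtain ⟨i, hi⟩ := Function.ne_iff.1
    (scaledDualVec_zero ▸ (h.scaledDualVec_injective hB).ne hz)
  calc (1 : ℝ) ≤ |(scaledDualVec B E z i : ℝ)| := by exact_mod_cast Int.one_le_abs hi
    _ ≤ ∑ i, |(scaledDualVec B E z i : ℝ)| :=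
        Finset.single_le_sum (f := fun i => |(scaledDualVec B E z i : ℝ)|)
          (fun _ _ => abs_nonneg _) (Finset.mem_univ i)
    _ ≤ _ := h.sum_abs_scaledDualVec_le z

end IsDualCertificate

theorem sum_range_exp_neg_mul_le {c : ℝ} (hc : 0 < c) (R : ℕ) :
    ∑ k ∈ Finset.range R, Real.exp (-(c * k)) ≤ 1 + 1 / c := by
  have hlt : Real.exp (-c) < 1 := by rw [Real.exp_lt_one_iff]; linarith
  have hinv : Real.exp (-c) ≤ (1 + c)⁻¹ := by
    rw [Real.exp_neg]
    exact inv_anti₀ (by linarith) (by linarith [Real.add_one_le_exp c])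
  calc ∑ k ∈ Finset.range R, Real.exp (-(c * k)) = ∑ k ∈ Finset.range R, Real.exp (-c) ^ k :=
        Finset.sum_congr rfl fun k _ => by rw [← Real.exp_nat_mul]; ring_nf
    _ ≤ (1 - Real.exp (-c))⁻¹ := by
        rw [← tsum_geometric_of_lt_one (Real.exp_pos _).le hlt]
        exact (summable_geometric_of_lt_one (Real.exp_pos _).le hlt).sum_le_tsum _
          fun _ _ => pow_nonneg (Real.exp_pos _).le _
    _ ≤ (1 - (1 + c)⁻¹)⁻¹ :=
        inv_anti₀ (sub_pos.2 (inv_lt_one_of_one_lt₀ (by linarith))) (by linarith)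
    _ = 1 + 1 / c := by
        have hratio : 1 - (1 + c)⁻¹ = c / (1 + c) := by field_simp; ring
        rw [hratio, inv_div, add_div, div_self hc.ne', add_comm]

theorem sum_int_exp_neg_mul_abs_le {c : ℝ} (hc : 0 < c) (S : Finset ℤ) :
    ∑ v ∈ S, Real.exp (-(c * |(v : ℝ)|)) ≤ 2 * (1 + 1 / c) := by
  obtain ⟨R, hR⟩ : ∃ R : ℕ, ∀ v ∈ S, v.natAbs < R :=
    ⟨S.sup Int.natAbs + 1, fun v hv => Nat.lt_succ_of_le (Finset.le_sup (f := Int.natAbs) hv)⟩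
  have half : ∀ f : ℕ → ℤ, f.Injective → (∀ k, |(f k : ℝ)| = k) →
      ∑ v ∈ (Finset.range R).image f, Real.exp (-(c * |(v : ℝ)|)) ≤ 1 + 1 / c := fun f hf habs => by
    rw [Finset.sum_image fun a _ b _ h => hf h]
    simpa only [habs] using sum_range_exp_neg_mul_le hc R
  set A := (Finset.range R).image fun k : ℕ => (k : ℤ) with hA
  set A' := (Finset.range R).image fun k : ℕ => -(k : ℤ) with hA'
  have hsub : S ⊆ A ∪ A' := fun v hv => by
    simp only [hA, hA', Finset.mem_union, Finset.mem_image, Finset.mem_range]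
    exact (Int.natAbs_eq v).imp (fun h => ⟨v.natAbs, hR v hv, h.symm⟩)
      fun h => ⟨v.natAbs, hR v hv, h.symm⟩
  calc ∑ v ∈ S, Real.exp (-(c * |(v : ℝ)|))
      ≤ ∑ v ∈ A ∪ A', Real.exp (-(c * |(v : ℝ)|)) :=
        Finset.sum_le_sum_of_subset_of_nonneg hsub fun _ _ _ => (Real.exp_pos _).le
    _ ≤ ∑ v ∈ A, Real.exp (-(c * |(v : ℝ)|)) + ∑ v ∈ A', Real.exp (-(c * |(v : ℝ)|)) := by
        rw [← Finset.sum_union_inter]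
        exact le_add_of_nonneg_right (Finset.sum_nonneg fun _ _ => (Real.exp_pos _).le)
    _ ≤ (1 + 1 / c) + (1 + 1 / c) := add_le_add
        (half _ Nat.cast_injective fun k => by simp)
        (half _ (neg_injective.comp Nat.cast_injective) fun k => by simp)
    _ = 2 * (1 + 1 / c) := (two_mul _).symm

theorem sum_exp_neg_mul_sum_abs_le {ι : Type*} [Fintype ι] {c : ℝ} (hc : 0 < c)
    (F : Finset (ι → ℤ)) :
    ∑ v ∈ F, Real.exp (-(c * ∑ i, |(v i : ℝ)|)) ≤ (2 * (1 + 1 / c)) ^ Fintype.card ι := by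
  classical
  let T : Finset ℤ := Finset.univ.biUnion fun i : ι => F.image fun v => v i
  have hsub : F ⊆ Fintype.piFinset fun _ : ι => T := fun v hv =>
    Fintype.mem_piFinset.2 fun i => Finset.mem_biUnion.2
      ⟨i, Finset.mem_univ i, Finset.mem_image_of_mem _ hv⟩
  calc ∑ v ∈ F, Real.exp (-(c * ∑ i, |(v i : ℝ)|))
      = ∑ v ∈ F, ∏ i, Real.exp (-(c * |(v i : ℝ)|)) := Finset.sum_congr rfl fun v _ => by
        rw [← Real.exp_sum, Finset.sum_neg_distrib, Finset.mul_sum]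
    _ ≤ ∑ v ∈ Fintype.piFinset fun _ : ι => T, ∏ i, Real.exp (-(c * |(v i : ℝ)|)) :=
        Finset.sum_le_sum_of_subset_of_nonneg hsub fun _ _ _ =>
          Finset.prod_nonneg fun _ _ => (Real.exp_pos _).le
    _ = (∑ v ∈ T, Real.exp (-(c * |(v : ℝ)|))) ^ Fintype.card ι := by
        rw [← Finset.prod_univ_sum (fun _ : ι => T) fun _ v => Real.exp (-(c * |(v : ℝ)|)),
          Finset.prod_const, Finset.card_univ]
    _ ≤ (2 * (1 + 1 / c)) ^ Fintype.card ι :=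
        pow_le_pow_left₀ (Finset.sum_nonneg fun _ _ => (Real.exp_pos _).le)
          (sum_int_exp_neg_mul_abs_le hc T) _

namespace IsDualCertificate

variable {E : ℕ → ℤ} {d : ℕ}

/-- Since `d • dualVec B z` is an integer vector, `d ^ 2 * ‖dualVec B z‖ ^ 2` dominates its
`ℓ¹` norm, and the sum over all integer vectors of the exponential of the latter factors. -/
theorem sum_exp_le (hB : B.det ≠ 0) (h : IsDualCertificate B E d) {κ : ℝ} (hκ : 0 < κ)
    (F : Finset (Fin n → ℤ)) :
    ∑ z ∈ F, Real.exp (-(κ * ‖dualVec B z‖ ^ 2)) ≤ (2 * (1 + (d : ℝ) ^ 2 / κ)) ^ n := by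
  classical
  have hd : (0 : ℝ) < d := by exact_mod_cast h.1
  calc ∑ z ∈ F, Real.exp (-(κ * ‖dualVec B z‖ ^ 2))
      ≤ ∑ z ∈ F, Real.exp (-(κ / (d : ℝ) ^ 2 * ∑ i, |(scaledDualVec B E z i : ℝ)|)) := by
        refine Finset.sum_le_sum fun z _ => Real.exp_le_exp.2 (neg_le_neg ?_)
        rw [div_mul_eq_mul_div, div_le_iff₀ (by positivity)]
        nlinarith [h.sum_abs_scaledDualVec_le z]
    _ = ∑ v ∈ F.image (scaledDualVec B E),
          Real.exp (-(κ / (d : ℝ) ^ 2 * ∑ i, |(v i : ℝ)|)) := by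
        rw [Finset.sum_image (h.scaledDualVec_injective hB).injOn]
    _ ≤ (2 * (1 + 1 / (κ / (d : ℝ) ^ 2))) ^ Fintype.card (Fin n) :=
        sum_exp_neg_mul_sum_abs_le (by positivity) _
    _ = (2 * (1 + (d : ℝ) ^ 2 / κ)) ^ n := by rw [one_div_div, Fintype.card_fin]

theorem sum_exp_le_exp_mul (hB : B.det ≠ 0) (h : IsDualCertificate B E d) {κ t : ℝ} (hκ : 0 < κ)
    (ht : 0 ≤ t) {F : Finset (Fin n → ℤ)} (hF : 0 ∉ F) :
    ∑ z ∈ F, Real.exp (-((κ + t) * ‖dualVec B z‖ ^ 2)) ≤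
      Real.exp (-(t / (d : ℝ) ^ 2)) * (2 * (1 + (d : ℝ) ^ 2 / κ)) ^ n := by
  have hd : (0 : ℝ) < d := by exact_mod_cast h.1
  refine le_trans ?_ (mul_le_mul_of_nonneg_left (h.sum_exp_le hB hκ F) (Real.exp_pos _).le)
  rw [Finset.mul_sum]
  refine Finset.sum_le_sum fun z hz => ?_
  have hnorm : t / (d : ℝ) ^ 2 ≤ t * ‖dualVec B z‖ ^ 2 := by
    rw [div_le_iff₀ (by positivity), mul_assoc, mul_comm (_ ^ 2)]
    exact le_mul_of_one_le_right ht (h.one_le_sq_mul_norm_dualVec_sq hB fun hz₀ => hF (hz₀ ▸ hz))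
  rw [← Real.exp_add, Real.exp_le_exp]
  linarith

end IsDualCertificate

theorem natAbs_det_le {ι : Type*} [Fintype ι] [DecidableEq ι] {A : Matrix ι ι ℤ} {b : ℕ}
    (hA : ∀ i j, (A i j).natAbs ≤ b) :
    A.det.natAbs ≤ (Fintype.card ι).factorial * b ^ Fintype.card ι := by
  have hdet := Matrix.det_le (A := A) (abv := AbsoluteValue.abs) (x := (b : ℤ)) fun i j => by
    rw [AbsoluteValue.abs_apply, Int.abs_eq_natAbs]
    exact_mod_cast hA i j
  rw [AbsoluteValue.abs_apply, nsmul_eq_mul, Int.abs_eq_natAbs] at hdet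
  exact_mod_cast hdet

theorem natAbs_adjugate_le {ι : Type*} [Fintype ι] [DecidableEq ι] {A : Matrix ι ι ℤ} {b : ℕ}
    (hb : 1 ≤ b) (hA : ∀ i j, (A i j).natAbs ≤ b) (i j : ι) :
    (A.adjugate i j).natAbs ≤ (Fintype.card ι).factorial * b ^ Fintype.card ι := by
  rw [Matrix.adjugate_apply]
  refine natAbs_det_le fun k l => ?_
  rw [Matrix.updateRow_apply, Pi.single_apply]
  split_ifs
  · exact hb
  · exact Nat.zero_le b
  · exact hA k l

variable (B) in
/-- The integer matrix `commonDen B • B`. -/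
def scaledMatrix : Matrix (Fin n) (Fin n) ℤ := Matrix.of fun i j => scaledEntry B (i * n + j)

theorem det_scaledMatrix_ne_zero (hB : B.det ≠ 0) : (scaledMatrix B).det ≠ 0 := by
  have hsmul : (scaledMatrix B).map (fun a => (a : ℚ)) = (commonDen B : ℚ) • B := by
    ext i j
    exact scaledEntry_apply B i j
  have hdet : ((scaledMatrix B).det : ℚ) = (commonDen B : ℚ) ^ n * B.det := by
    have hdet_smul := Matrix.det_smul B (commonDen B : ℚ)
    rw [Fintype.card_fin, ← hsmul] at hdet_smul
    exact (RingHom.map_det (Int.castRingHom ℚ) (scaledMatrix B)).trans hdet_smul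
  have hden : (commonDen B : ℚ) ≠ 0 := by exact_mod_cast (commonDen_pos B).ne'
  exact fun h => mul_ne_zero (pow_ne_zero n hden) hB (by rw [← hdet, h, Int.cast_zero])

/-- Cramer's rule: the adjugate and the determinant of `commonDen B • B` form a certificate. -/
theorem exists_isDualCertificate_le (hB : B.det ≠ 0) {b : ℕ}
    (hb : ∀ e < n * n, (scaledEntry B e).natAbs ≤ b) (hb₁ : 1 ≤ b) :
    ∃ (E : ℕ → ℤ) (d : ℕ), IsDualCertificate B E d ∧ d ≤ n.factorial * b ^ n ∧
      ∀ e, (E e).natAbs ≤ n.factorial * b ^ n := by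
  set C := scaledMatrix B with hC
  have hdet : C.det ≠ 0 := det_scaledMatrix_ne_zero hB
  have entries : ∀ i j, (C i j).natAbs ≤ b := fun i j => hb _ (mul_add_lt_sq i j)
  refine ⟨rowMajor (Matrix.of fun i k => C.det.sign * C.adjugate k i), C.det.natAbs,
    ⟨Int.natAbs_pos.2 hdet, fun j hj k hk => ?_⟩, by simpa using natAbs_det_le entries, fun e => ?_⟩
  · have hterm : ∀ i : Fin n, scaledEntry B (i * n + j) *
        rowMajor (Matrix.of fun i k => C.det.sign * C.adjugate k i) (i * n + k) =
        C.det.sign * (C.adjugate ⟨k, hk⟩ i * C i ⟨j, hj⟩) := fun i => by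
      have happly := rowMajor_apply (Matrix.of fun i k => C.det.sign * C.adjugate k i) i ⟨k, hk⟩
      simp only [Matrix.of_apply] at happly
      rw [happly, hC, scaledMatrix, Matrix.of_apply]
      ring
    rw [Finset.sum_range, Finset.sum_congr rfl fun i _ => hterm i, ← Finset.mul_sum,
      ← Matrix.mul_apply, Matrix.adjugate_mul, Matrix.smul_apply, Matrix.one_apply]
    rcases eq_or_ne j k with rfl | hjk
    · simp
    · rw [if_neg hjk, if_neg (fun h => hjk (Fin.mk.inj_iff.1 h).symm), smul_zero, mul_zero]
  · rw [rowMajor]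
    split_ifs with he
    · rw [Matrix.of_apply, Int.natAbs_mul, Int.natAbs_sign_of_ne_zero hdet, one_mul]
      simpa using natAbs_adjugate_le hb₁ entries _ _
    · exact Nat.zero_le _

theorem exists_isDualCertificate (hB : B.det ≠ 0) :
    ∃ (E : ℕ → ℤ) (d : ℕ), IsDualCertificate B E d := by
  obtain ⟨E, d, h, -⟩ := exists_isDualCertificate_le hB
    (b := 1 + (Finset.range (n * n)).sup fun e => (scaledEntry B e).natAbs)
    (fun e he => (Finset.le_sup (f := fun e => (scaledEntry B e).natAbs)
      (Finset.mem_range.2 he)).trans (Nat.le_add_left _ _)) (Nat.le_add_right _ _)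
  exact ⟨E, d, h⟩

theorem abs_coord_le (hB : B.det ≠ 0) {b : ℝ} (hb : ∀ i j, |(B i j : ℝ)| ≤ b)
    (z : Fin n → ℤ) (j : Fin n) : |(z j : ℝ)| ≤ n * (b * ‖dualVec B z‖) := by
  have hterm : ∀ i ∈ (Finset.univ : Finset (Fin n)), |(B i j : ℝ) * dualVec B z i| ≤
      b * ‖dualVec B z‖ := fun i _ => by
    rw [abs_mul]
    exact mul_le_mul (hb i j) (PiLp.norm_apply_le (dualVec B z) i) (abs_nonneg _)
      ((abs_nonneg _).trans (hb i j))
  rw [← sum_mul_dualVec hB z j]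
  refine (Finset.abs_sum_le_sum_abs _ _).trans ?_
  simpa using Finset.sum_le_card_nsmul _ _ _ hterm

theorem exists_norm_dualVec_eq_commonDen (hB : B.det ≠ 0) (hn : 0 < n) :
    ∃ z : Fin n → ℤ, z ≠ 0 ∧ ‖dualVec B z‖ = commonDen B := by
  let i₀ : Fin n := ⟨0, hn⟩
  let z : Fin n → ℤ := fun j => scaledEntry B (i₀ * n + j)
  have hz : dualVec B z = EuclideanSpace.single i₀ (commonDen B : ℝ) := by
    refine dualVec_eq_of_sum_mul_eq hB fun j => ?_
    rw [scaledEntry_apply_real, Finset.sum_eq_single i₀ (fun i _ hi => by simp [hi]) (by simp)]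
    simp [mul_comm]
  have hnorm : ‖dualVec B z‖ = commonDen B := by simp [hz]
  refine ⟨z, fun hz₀ => ?_, hnorm⟩
  rw [hz₀, dualVec_zero, norm_zero] at hnorm
  exact (commonDen_pos B).ne (by exact_mod_cast hnorm)

/-! ## The smoothing parameter in coordinates -/

theorem exists_gaussianMass_dualLattice_le (hB : B.det ≠ 0) {ε : ℝ} (hε : 0 < ε) :
    ∃ s, 0 < s ∧ gaussianMass (1 / s)
      ((dualLattice (latticeOf B) : Set (EuclideanSpace ℝ (Fin n))) \ {0}) ≤
        ENNReal.ofReal ε := by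
  obtain ⟨E, d, hcert⟩ := exists_isDualCertificate hB
  have hd : (0 : ℝ) < d := by exact_mod_cast hcert.1
  have hpi := Real.pi_pos
  set K : ℝ := (2 * (1 + (d : ℝ) ^ 2 / Real.pi)) ^ n
  have hK₀ : 0 < K := by positivity
  set t : ℝ := (d : ℝ) ^ 2 * |Real.log (K / ε)| with ht
  have ht₀ : 0 ≤ t := by positivity
  refine ⟨√(1 + t / Real.pi), Real.sqrt_pos.2 (by positivity), ?_⟩
  rw [gaussianMass_dualLattice_le_iff hB _ hε.le, Real.sq_sqrt (by positivity), mul_add, mul_one,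
    mul_div_cancel₀ t hpi.ne']
  refine fun F hF => (hcert.sum_exp_le_exp_mul hB hpi ht₀ hF).trans ?_
  rw [ht, mul_div_cancel_left₀ _ (by positivity), ← le_div_iff₀ hK₀]
  calc Real.exp (-|Real.log (K / ε)|) ≤ Real.exp (-Real.log (K / ε)) :=
        Real.exp_le_exp.2 (neg_le_neg (le_abs_self _))
    _ = ε / K := by rw [← Real.log_inv, inv_div, Real.exp_log (by positivity)]

theorem sum_exp_le_of_smoothingParameter_le (hB : B.det ≠ 0) {ε s : ℝ} (hε : 0 < ε)
    (hs : smoothingParameter ε (latticeOf B) ≤ s) {F : Finset (Fin n → ℤ)} (hF : 0 ∉ F) :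
    ∑ z ∈ F, Real.exp (-(Real.pi * s ^ 2 * ‖dualVec B z‖ ^ 2)) ≤ ε := by
  have above : ∀ t : ℝ, s < t →
      ∑ z ∈ F, Real.exp (-(Real.pi * t ^ 2 * ‖dualVec B z‖ ^ 2)) ≤ ε := fun t ht => by
    obtain ⟨s', ⟨hs₀, hs'⟩, hlt⟩ :=
      exists_lt_of_csInf_lt (exists_gaussianMass_dualLattice_le hB hε) (hs.trans_lt ht)
    refine le_trans (Finset.sum_le_sum fun z _ => Real.exp_le_exp.2 (neg_le_neg ?_))
      ((gaussianMass_dualLattice_le_iff hB s' hε.le).1 hs' F hF)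
    gcongr
  have lim : Filter.Tendsto
      (fun t : ℝ => ∑ z ∈ F, Real.exp (-(Real.pi * t ^ 2 * ‖dualVec B z‖ ^ 2)))
      (nhdsWithin s (Set.Ioi s))
      (nhds (∑ z ∈ F, Real.exp (-(Real.pi * s ^ 2 * ‖dualVec B z‖ ^ 2)))) :=
    (Continuous.tendsto (by fun_prop) s).mono_left nhdsWithin_le_nhds
  exact le_of_tendsto lim (Filter.eventually_of_mem self_mem_nhdsWithin above)

theorem exists_lt_sum_exp_of_lt_smoothingParameter (hB : B.det ≠ 0) {ε s : ℝ} (hε : 0 ≤ ε)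
    (hs : 0 < s) (h : s < smoothingParameter ε (latticeOf B)) :
    ∃ F : Finset (Fin n → ℤ), 0 ∉ F ∧
      ε < ∑ z ∈ F, Real.exp (-(Real.pi * s ^ 2 * ‖dualVec B z‖ ^ 2)) := by
  by_contra! hsum
  exact h.not_ge (csInf_le ⟨0, fun t ht => ht.1.le⟩
    ⟨hs, (gaussianMass_dualLattice_le_iff hB s hε).2 hsum⟩)

end

/-! ## Approximating Gaussian weights by powers -/

theorem exp_mul_sub_sq_le_one_add_pow {x : ℝ} (hx : -1 / 2 ≤ x) (M : ℕ) :
    Real.exp (M * (x - 2 * x ^ 2)) ≤ (1 + x) ^ M := by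
  have hpos : 0 < 1 + x := by linarith
  have hratio : x - 2 * x ^ 2 ≤ 1 - (1 + x)⁻¹ := by
    have h : 1 - (1 + x)⁻¹ = x / (1 + x) := by field_simp; ring
    rw [h, le_div_iff₀ hpos]
    nlinarith [mul_nonneg (sq_nonneg x) (show (0 : ℝ) ≤ 1 + 2 * x by linarith)]
  rw [Real.exp_nat_mul]
  exact pow_le_pow_left₀ (Real.exp_pos _).le ((Real.le_log_iff_exp_le hpos).1
    (hratio.trans (Real.one_sub_inv_le_log_of_pos hpos))) M

/-- The integer weight `(M * D + τ - ⌊D * y⌋ - 1)₊ ^ M`. It is about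
`(M * D) ^ M * exp (τ / D - y)`, and Arthur can compute it for rational `y`. -/
noncomputable def powWeight (M D : ℕ) (τ : ℤ) (y : ℝ) : ℕ :=
  ((M * D : ℕ) + τ - (⌊D * y⌋₊ + 1 : ℕ)).toNat ^ M

section PowWeight

variable {M D : ℕ} {τ : ℤ} {T y : ℝ}

theorem powWeight_le (hM : 0 < M) (hD : 0 < D) (hτ : |(τ : ℝ) - D * T| ≤ 1) :
    (powWeight M D τ y : ℝ) ≤ ((M : ℝ) * D) ^ M * Real.exp (T + 1 / D - y) := by
  have hM' : (0 : ℝ) < M := by exact_mod_cast hM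
  have : (0 : ℝ) < D := by exact_mod_cast hD
  set A : ℤ := (M * D : ℕ) + τ - (⌊D * y⌋₊ + 1 : ℕ) with hA
  have hlin : (A : ℝ) ≤ M * D * (1 + (T + 1 / D - y) / M) := by
    have h : (M : ℝ) * D * (1 + (T + 1 / D - y) / M) = M * D + D * T + 1 - D * y := by
      field_simp; ring
    rw [h, hA]
    push_cast
    linarith [Nat.lt_floor_add_one ((D : ℝ) * y), (abs_le.1 hτ).2]
  have hbase : ((A.toNat : ℕ) : ℝ) ≤ M * D * Real.exp ((T + 1 / D - y) / M) := by
    have htoNat : ((A.toNat : ℕ) : ℝ) = max (A : ℝ) 0 := by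
      exact_mod_cast congrArg (Int.cast : ℤ → ℝ) (Int.ofNat_toNat A)
    rw [htoNat]
    exact max_le (hlin.trans (mul_le_mul_of_nonneg_left
      (by linarith [Real.add_one_le_exp ((T + 1 / D - y) / M)]) (by positivity))) (by positivity)
  rw [powWeight, Nat.cast_pow]
  calc ((A.toNat : ℕ) : ℝ) ^ M ≤ (M * D * Real.exp ((T + 1 / D - y) / M)) ^ M :=
        pow_le_pow_left₀ (Nat.cast_nonneg _) hbase M
    _ = ((M : ℝ) * D) ^ M * Real.exp (T + 1 / D - y) := by
        rw [mul_pow, ← Real.exp_nat_mul, mul_div_cancel₀ _ hM'.ne']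

theorem le_powWeight (hM : 0 < M) (hD : 0 < D) (hy : 0 ≤ y) (hτ : |(τ : ℝ) - D * T| ≤ 1)
    (hx : -1 ≤ (T - 2 / D - y) / M) :
    ((M : ℝ) * D) ^ M * (1 + (T - 2 / D - y) / M) ^ M ≤ powWeight M D τ y := by
  have : (0 : ℝ) < M := by exact_mod_cast hM
  have : (0 : ℝ) < D := by exact_mod_cast hD
  set A : ℤ := (M * D : ℕ) + τ - (⌊D * y⌋₊ + 1 : ℕ) with hA
  have hlin : M * D * (1 + (T - 2 / D - y) / M) ≤ (A : ℝ) := by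
    have h : (M : ℝ) * D * (1 + (T - 2 / D - y) / M) = M * D + D * T - 2 - D * y := by
      field_simp; ring
    rw [h, hA]
    push_cast
    linarith [Nat.floor_le (show (0 : ℝ) ≤ D * y by positivity), (abs_le.1 hτ).1]
  have htoNat : (A : ℝ) ≤ ((A.toNat : ℕ) : ℝ) := by exact_mod_cast Int.self_le_toNat A
  rw [powWeight, Nat.cast_pow, ← mul_pow]
  exact pow_le_pow_left₀ (mul_nonneg (by positivity) (by linarith)) (hlin.trans htoNat) M

theorem mul_exp_sub_sq_le_powWeight (hM : 0 < M) (hD : 0 < D) (hy : 0 ≤ y)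
    (hτ : |(τ : ℝ) - D * T| ≤ 1) (hx : -1 / 2 ≤ (T - 2 / D - y) / M) :
    ((M : ℝ) * D) ^ M * Real.exp ((T - 2 / D - y) - 2 * ((T - 2 / D - y) ^ 2 / M)) ≤
      powWeight M D τ y := by
  refine le_trans (mul_le_mul_of_nonneg_left ?_ (by positivity))
    (le_powWeight hM hD hy hτ (by linarith))
  refine le_of_eq_of_le ?_ (exp_mul_sub_sq_le_one_add_pow hx M)
  have hM' : (M : ℝ) ≠ 0 := by exact_mod_cast hM.ne'
  congr 1
  field_simp

theorem two_mul_le_powWeight (hM : 0 < M) (hD : 0 < D) (hy : 0 ≤ y)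
    (hτ : |(τ : ℝ) - D * T| ≤ 1) (hyT : y ≤ T - 2 / D - 1) :
    2 * ((M : ℝ) * D) ^ M ≤ powWeight M D τ y := by
  have hM' : (0 : ℝ) < M := by exact_mod_cast hM
  have hx : 0 ≤ (T - 2 / D - y) / M := div_nonneg (by linarith) hM'.le
  refine le_trans ?_ (le_powWeight hM hD hy hτ (by linarith))
  rw [mul_comm]
  refine mul_le_mul_of_nonneg_left ?_ (by positivity)
  have hbernoulli := one_add_mul_le_pow (a := (T - 2 / D - y) / M) (by linarith) M
  rw [mul_div_cancel₀ _ hM'.ne'] at hbernoulli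
  linarith

end PowWeight

theorem quadratic_error_le {a M T P₀ y : ℝ} (ha : 1 ≤ a) (hM : 64 * a * (P₀ + 1) ^ 2 ≤ M)
    (hM₀ : 0 < M) (hT : |T| ≤ P₀) (hy : 0 ≤ y) (hyM : y ≤ M / (8 * a)) :
    1 / (16 * a) + 2 * ((T - 1 / (16 * a) - y) ^ 2 / M) ≤ 1 / (8 * a) + 1 / a * y := by
  have ha₀ : 0 < a := by linarith
  have hinv : 1 / a ≤ 1 := by rw [div_le_one ha₀]; exact ha
  have hinv₀ : 0 < 1 / a := by positivity
  have e16 : 1 / (16 * a) = 1 / a / 16 := by field_simp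
  have e8 : 1 / (8 * a) = 1 / a / 8 := by field_simp
  have hshift : (T - 1 / (16 * a)) ^ 2 ≤ (P₀ + 1) ^ 2 := by
    apply sq_le_sq' <;> rw [e16] <;> linarith [abs_le.1 hT]
  have hsq : (T - 1 / (16 * a) - y) ^ 2 ≤ 2 * (P₀ + 1) ^ 2 + 2 * y ^ 2 := by
    linarith [sub_sq (T - 1 / (16 * a)) y, add_sq (T - 1 / (16 * a)) y,
      sq_nonneg (T - 1 / (16 * a) + y)]
  have hconst : 4 * (P₀ + 1) ^ 2 ≤ 1 / a / 16 * M := by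
    rw [div_div, div_mul_eq_mul_div, one_mul, le_div_iff₀ (by positivity)]
    linarith
  have hlinear : 4 * y ^ 2 ≤ 1 / a * y * M := by
    rw [le_div_iff₀ (by positivity)] at hyM
    rw [show 1 / a * y * M = y * M / a by field_simp, le_div_iff₀ ha₀]
    nlinarith [mul_le_mul_of_nonneg_left hyM hy, mul_nonneg ha₀.le (sq_nonneg y)]
  have hsum : 2 * ((T - 1 / (16 * a) - y) ^ 2 / M) ≤ 1 / a / 16 + 1 / a * y := by
    rw [mul_div_assoc', div_le_iff₀ hM₀]
    linarith
  linarith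

theorem sum_exp_neg_mul_le {ι : Type*} {G : Finset ι} {y : ι → ℝ} {κ t c P : ℝ}
    (hsum : ∑ z ∈ G, Real.exp (-(κ * y z)) ≤ Real.exp P)
    (hc : ∀ z ∈ G, c + κ * y z ≤ t * y z) :
    ∑ z ∈ G, Real.exp (-(t * y z)) ≤ Real.exp (P - c) := by
  calc ∑ z ∈ G, Real.exp (-(t * y z)) ≤ ∑ z ∈ G, Real.exp (-c) * Real.exp (-(κ * y z)) :=
        Finset.sum_le_sum fun z hz => by
          rw [← Real.exp_add, Real.exp_le_exp]
          linarith [hc z hz]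
    _ ≤ Real.exp (-c) * Real.exp P := by
        rw [← Finset.mul_sum]
        exact mul_le_mul_of_nonneg_left hsum (Real.exp_pos _).le
    _ = Real.exp (P - c) := by rw [← Real.exp_add, neg_add_eq_sub]

theorem exp_three_mul_add_half_le {t : ℝ} (ht : 0 ≤ t) :
    Real.exp (3 * t) + t / 2 ≤ Real.exp (4 * t) := by
  rw [show 4 * t = 3 * t + t by ring, Real.exp_add]
  nlinarith [Real.add_one_le_exp t, Real.one_le_exp (show 0 ≤ 3 * t by linarith)]

section Dichotomy

variable {ι : Type*} {F : Finset ι} {y : ι → ℝ} {a P T : ℝ}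

theorem abs_le_of_exp_lt_sum (hy : ∀ z, 0 ≤ y z) (ha : 1 ≤ a) (hP : 0 ≤ P)
    (hsum : ∑ z ∈ F, Real.exp (-(1 / (2 * a) * y z)) ≤ Real.exp P)
    (hlarge : Real.exp (-T + 1 / (2 * a)) < ∑ z ∈ F, Real.exp (-((1 + 1 / a) * y z)))
    (hno : ∀ z ∈ F, T - 2 < y z) : |T| ≤ a * (2 * P + 6) := by
  have ha₀ : 0 < a := by linarith
  have hinv : 0 < 1 / a := by positivity
  have hinv₁ : 1 / a ≤ 1 := by rw [div_le_one ha₀]; exact ha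
  have e2 : 1 / (2 * a) = 1 / a / 2 := by field_simp
  have hbound : ∀ c, (∀ z ∈ F, c + 1 / (2 * a) * y z ≤ (1 + 1 / a) * y z) →
      -T + 1 / (2 * a) < P - c := fun c hc =>
    Real.exp_lt_exp.1 (hlarge.trans_le (sum_exp_neg_mul_le hsum hc))
  rw [e2] at hbound
  have hlower := hbound 0 fun z _ => by nlinarith [hy z, mul_nonneg hinv.le (hy z)]
  have hupper := hbound ((1 + 1 / a / 2) * (T - 2)) fun z hz => by
    nlinarith [hno z hz, mul_pos hinv (sub_pos.2 (hno z hz))]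
  refine abs_le.2 ⟨by nlinarith, ?_⟩
  have hdiv : 1 / a * T ≤ 2 * P + 6 := by nlinarith
  rwa [one_div_mul_eq_div, div_le_iff₀' ha₀] at hdiv

theorem exp_le_sum_near (hy : ∀ z, 0 ≤ y z) (ha : 1 ≤ a) {R : ℝ}
    (hR : P + T + 16 * a ≤ R)
    (hsum : ∀ G ⊆ F, ∑ z ∈ G, Real.exp (-(1 / (2 * a) * y z)) ≤ Real.exp P)
    (hlarge : Real.exp (-T + 1 / (2 * a)) < ∑ z ∈ F, Real.exp (-((1 + 1 / a) * y z))) :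
    Real.exp (-T + 3 / (8 * a)) ≤
      ∑ z ∈ F with y z ≤ R, Real.exp (-((1 + 1 / a) * y z)) := by
  have ha₀ : 0 < a := by linarith
  have hfar : ∑ z ∈ F with ¬ y z ≤ R, Real.exp (-((1 + 1 / a) * y z)) ≤
      Real.exp (-T) * (1 / (16 * a)) := by
    refine (sum_exp_neg_mul_le (c := R) (hsum _ (Finset.filter_subset _ F)) fun z hz => ?_).trans ?_
    · have hyR := not_le.1 (Finset.mem_filter.1 hz).2
      rw [show 1 / (2 * a) = 1 / a / 2 by field_simp]
      nlinarith [mul_nonneg (one_div_pos.2 ha₀).le (hy z)]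
    · have hexp : Real.exp (-(16 * a)) ≤ 1 / (16 * a) := by
        rw [Real.exp_neg, one_div]
        exact inv_anti₀ (by positivity) (by linarith [Real.add_one_le_exp (16 * a)])
      refine le_trans ?_ (mul_le_mul_of_nonneg_left hexp (Real.exp_pos _).le)
      rw [← Real.exp_add, Real.exp_le_exp]
      linarith
  have hgap : Real.exp (-T + 3 / (8 * a)) + Real.exp (-T) * (1 / (16 * a)) ≤
      Real.exp (-T + 1 / (2 * a)) := by
    have h := mul_le_mul_of_nonneg_left
      (exp_three_mul_add_half_le (show 0 ≤ 1 / (8 * a) by positivity)) (Real.exp_pos (-T)).le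
    rw [mul_add, ← Real.exp_add, ← Real.exp_add] at h
    have e3 : 3 / (8 * a) = 3 * (1 / (8 * a)) := by ring
    have e2 : 1 / (2 * a) = 4 * (1 / (8 * a)) := by field_simp; norm_num
    have e16 : 1 / (16 * a) = 1 / (8 * a) / 2 := by field_simp; norm_num
    rwa [e3, e2, e16]
  linarith [Finset.sum_filter_add_sum_filter_not F (fun z => y z ≤ R)
    fun z => Real.exp (-((1 + 1 / a) * y z))]

/-- Increasing the exponent from `y` to `(1 + 1 / a) * y` makes the far terms negligible, and on
the near terms it compensates the quadratic error of `exp_mul_sub_sq_le_one_add_pow`. -/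
theorem exists_le_or_exp_le_sum_near (hy : ∀ z, 0 ≤ y z) {M : ℝ} (ha : 1 ≤ a)
    (hP : 0 ≤ P) (hsum : ∀ G ⊆ F, ∑ z ∈ G, Real.exp (-(1 / (2 * a) * y z)) ≤ Real.exp P)
    (hM : 64 * a * (a * (2 * P + 6) + 1) ^ 2 ≤ M)
    (hlarge : Real.exp (-T + 1 / (2 * a)) < ∑ z ∈ F, Real.exp (-((1 + 1 / a) * y z))) :
    (∃ z ∈ F, y z ≤ T - 2) ∨
      (Real.exp (1 / (4 * a)) ≤ ∑ z ∈ F with y z ≤ M / (8 * a),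
        Real.exp ((T - 1 / (16 * a) - y z) - 2 * ((T - 1 / (16 * a) - y z) ^ 2 / M)) ∧
      ∀ z, y z ≤ M / (8 * a) → -1 / 2 ≤ (T - 1 / (16 * a) - y z) / M) := by
  refine or_iff_not_imp_left.2 fun hno => ?_
  push Not at hno
  have : 0 < a := by linarith
  have hT := abs_le_of_exp_lt_sum hy ha hP (hsum F subset_rfl) hlarge hno
  set P₀ : ℝ := a * (2 * P + 6)
  have hPP₀ : P + 6 * a ≤ P₀ := by nlinarith
  have hM₀ : 0 < M := lt_of_lt_of_le (by positivity) hM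
  have hPM : 8 * a * (P + P₀ + 16 * a) ≤ M := by nlinarith
  have hP₀M : 16 * (P₀ + 1) ≤ M := by nlinarith
  have hnear := exp_le_sum_near hy ha (R := M / (8 * a))
    (by rw [le_div_iff₀ (by positivity)]; nlinarith [le_abs_self T]) hsum hlarge
  refine ⟨?_, fun z hz => ?_⟩
  · calc Real.exp (1 / (4 * a))
        = Real.exp (T - 1 / (8 * a)) * Real.exp (-T + 3 / (8 * a)) := by
          rw [← Real.exp_add]; congr 1; field_simp; ring
      _ ≤ Real.exp (T - 1 / (8 * a)) *
          ∑ z ∈ F with y z ≤ M / (8 * a), Real.exp (-((1 + 1 / a) * y z)) :=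
          mul_le_mul_of_nonneg_left hnear (Real.exp_pos _).le
      _ ≤ _ := by
          rw [Finset.mul_sum]
          refine Finset.sum_le_sum fun z hz => ?_
          rw [← Real.exp_add, Real.exp_le_exp]
          linarith [quadratic_error_le ha hM hM₀ hT (hy z) (Finset.mem_filter.1 hz).2]
  · have hyM : M / (8 * a) ≤ M / 8 := div_le_div_of_nonneg_left hM₀.le (by norm_num) (by linarith)
    have hinv : 1 / (16 * a) ≤ 1 := by rw [div_le_one (by positivity)]; linarith
    rw [le_div_iff₀ hM₀]
    linarith [neg_abs_le T]

end Dichotomy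

theorem exists_le_or_mul_exp_le_sum_powWeight {ι : Type*} {F : Finset ι}
    {y : ι → ℝ} (hy : ∀ z, 0 ≤ y z) {a P M : ℕ} (ha : 0 < a)
    (hM : 64 * a * (a * (2 * P + 6) + 1) ^ 2 ≤ M)
    (hsum : ∀ G ⊆ F, ∑ z ∈ G, Real.exp (-(1 / (2 * a) * y z)) ≤ Real.exp P)
    {τ : ℤ} {T : ℝ} (hτ : |(τ : ℝ) - (32 * a : ℕ) * T| ≤ 1)
    (hlarge : Real.exp (-T + 1 / (2 * a)) < ∑ z ∈ F, Real.exp (-((1 + 1 / a) * y z))) :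
    (∃ z ∈ F, y z ≤ T - 2) ∨
      ((M : ℝ) * (32 * a : ℕ)) ^ M * Real.exp (1 / (4 * a)) ≤
        ∑ z ∈ F with y z ≤ M / (8 * a), (powWeight M (32 * a) τ (y z) : ℝ) := by
  have hM₀ : 0 < M := lt_of_lt_of_le (by positivity) hM
  have hD : (2 : ℝ) / (32 * a : ℕ) = 1 / (16 * a) := by push_cast; field_simp; norm_num
  refine (exists_le_or_exp_le_sum_near (M := M) hy (by exact_mod_cast ha) P.cast_nonneg hsum
    (by exact_mod_cast hM) hlarge).imp_right fun ⟨hbig, hge⟩ => ?_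
  refine (mul_le_mul_of_nonneg_left hbig (by positivity)).trans ?_
  rw [Finset.mul_sum]
  refine Finset.sum_le_sum fun z hz => ?_
  rw [← hD] at hge ⊢
  exact mul_exp_sub_sq_le_powWeight hM₀ (by positivity) (hy z) hτ
    (hge z (Finset.mem_filter.1 hz).2)

/-! ## Digits -/

/-- The `i`-th digit of `m` in base `b`. Merlin's message, and the codes of lattice vectors in it,
are sequences of digits in this sense. -/
abbrev digit (b m i : ℕ) : ℕ := m / b ^ i % b

theorem exists_digit_eq {b : ℕ} (L : ℕ) (g : ℕ → ℕ) (hg : ∀ i < L, g i < b) :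
    ∃ f < b ^ L, ∀ i < L, digit b f i = g i := by
  let G : Fin L → Fin b := fun i => ⟨g i, hg i i.2⟩
  refine ⟨finFunctionFinEquiv G, (finFunctionFinEquiv G).2, fun i hi => ?_⟩
  exact congrArg Fin.val (congrFun (finFunctionFinEquiv.symm_apply_apply G) ⟨i, hi⟩)

theorem eq_of_digit_eq {b L f f' : ℕ} (hf : f < b ^ L) (hf' : f' < b ^ L)
    (h : ∀ i < L, digit b f i = digit b f' i) : f = f' := by
  have hfin : (⟨f, hf⟩ : Fin (b ^ L)) = ⟨f', hf'⟩ :=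
    finFunctionFinEquiv.symm.injective (funext fun i => Fin.ext (h i i.2))
  exact congrArg Fin.val hfin

theorem card_filter_forall_digit_mem {b N : ℕ} {S : Finset ℕ} (hS : ∀ f ∈ S, f < b) :
    ((Finset.range (b ^ N)).filter fun u => ∀ t < N, digit b u t ∈ S).card = S.card ^ N := by
  classical
  have hcard : (Fintype.piFinset fun _ : Fin N => S).card = S.card ^ N := by simp
  rw [← hcard]
  refine Finset.card_bij (fun u _ t => digit b u t) (fun u hu => ?_) (fun u hu u' hu' h => ?_)
    fun v hv => ?_
  · exact Fintype.mem_piFinset.2 fun t => (Finset.mem_filter.1 hu).2 t t.2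
  · exact eq_of_digit_eq (Finset.mem_range.1 (Finset.mem_filter.1 hu).1)
      (Finset.mem_range.1 (Finset.mem_filter.1 hu').1) fun i hi => congrFun h ⟨i, hi⟩
  · have hvS := Fintype.mem_piFinset.1 hv
    obtain ⟨u, hu, hdigit⟩ := exists_digit_eq (b := b) N
      (fun t => if h : t < N then v ⟨t, h⟩ else 0)
      fun t ht => by rw [dif_pos ht]; exact hS _ (hvS _)
    have hdigit' : ∀ t : Fin N, digit b u t = v t := fun t => by rw [hdigit t t.2, dif_pos t.2]
    exact ⟨u, Finset.mem_filter.2 ⟨Finset.mem_range.2 hu, fun t ht =>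
      (hdigit' ⟨t, ht⟩).symm ▸ hvS _⟩, funext hdigit'⟩

/-! ## Hashing -/

theorem mul_card_filter_modEq_le {g : ℕ} (hg : 0 < g) (I x : ℕ) :
    g * ((Finset.range I).filter fun y => y ≡ x [MOD g]).card ≤ I + g := by
  rw [← Nat.count_eq_card_filter_range, Nat.count_modEq_card _ hg]
  calc g * (I / g + if x % g < I % g then 1 else 0) ≤ g * (I / g + 1) :=
        Nat.mul_le_mul_left g (Nat.add_le_add_left (by split_ifs <;> simp) _)
    _ ≤ I + g := by rw [mul_add_one]; exact Nat.add_le_add_right (Nat.mul_div_le I g) g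

theorem card_filter_add_mul_mod_eq_le {Q Δ : ℕ} (hQ : 0 < Q) (x y : ℕ) :
    ((Finset.range Q).filter fun a => (x + a * Δ) % Q = y).card ≤ Δ.gcd Q := by
  set g := Δ.gcd Q
  have hgQ : g ∣ Q := Nat.gcd_dvd_right _ _
  have hq : 0 < Q / g := Nat.div_pos (Nat.le_of_dvd hQ hgQ) (Nat.gcd_pos_of_pos_right _ hQ)
  conv_rhs => rw [← Finset.card_range g]
  refine Finset.card_le_card_of_injOn (fun a => a / (Q / g)) (fun a ha => ?_)
    fun a ha a' ha' h => ?_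
  · refine Finset.mem_coe.2 (Finset.mem_range.2 ?_)
    rw [Nat.div_lt_iff_lt_mul hq, Nat.mul_div_cancel' hgQ]
    exact Finset.mem_range.1 (Finset.mem_filter.1 ha).1
  · have hmul : a * Δ ≡ a' * Δ [MOD Q] := Nat.ModEq.add_left_cancel' x
      ((Finset.mem_filter.1 ha).2.trans (Finset.mem_filter.1 ha').2.symm)
    have hmod : a % (Q / g) = a' % (Q / g) := by
      have hcancel := Nat.ModEq.cancel_right_div_gcd hQ hmul
      rwa [Nat.gcd_comm] at hcancel
    rw [← Nat.div_add_mod a (Q / g), ← Nat.div_add_mod a' (Q / g), hmod]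
    exact congrArg (fun k => Q / g * k + a' % (Q / g)) h

theorem card_filter_add_mul_mod_lt_le {Q Δ : ℕ} (hQ : 0 < Q) (hΔ : 0 < Δ) (I x : ℕ) :
    ((Finset.range Q).filter fun a => (x + a * Δ) % Q < I).card ≤ I + Δ := by
  have hg : 0 < Δ.gcd Q := Nat.gcd_pos_of_pos_left _ hΔ
  have hmaps : ∀ a ∈ (Finset.range Q).filter fun a => (x + a * Δ) % Q < I,
      (x + a * Δ) % Q ∈ (Finset.range I).filter fun y => y ≡ x [MOD Δ.gcd Q] := fun a ha => by
    refine Finset.mem_filter.2 ⟨Finset.mem_range.2 (Finset.mem_filter.1 ha).2, ?_⟩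
    rw [Nat.ModEq, Nat.mod_mod_of_dvd _ (Nat.gcd_dvd_right _ _), Nat.add_mod,
      Nat.mod_eq_zero_of_dvd ((Nat.gcd_dvd_left _ _).mul_left a), add_zero, Nat.mod_mod]
  refine (Finset.card_le_mul_card_image_of_maps_to hmaps _ fun y _ => ?_).trans
    ((mul_card_filter_modEq_le hg I x).trans (Nat.add_le_add_left (Nat.gcd_le_left _ hΔ) I))
  exact (Finset.card_le_card (Finset.filter_subset_filter _ (Finset.filter_subset _ _))).trans
    (card_filter_add_mul_mod_eq_le hQ x y)

theorem card_filter_add_mod_lt {Q I : ℕ} (hQ : 0 < Q) (hI : I ≤ Q) (c : ℕ) :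
    ((Finset.range Q).filter fun b => (c + b) % Q < I).card = I := by
  conv_rhs => rw [← Finset.card_range I]
  refine Finset.card_bij (fun b _ => (c + b) % Q)
    (fun b hb => Finset.mem_range.2 (Finset.mem_filter.1 hb).2) (fun b hb b' hb' h => ?_)
    fun y hy => ?_
  · exact Nat.ModEq.eq_of_lt_of_lt (Nat.ModEq.add_left_cancel' c h)
      (Finset.mem_range.1 (Finset.mem_filter.1 hb).1)
      (Finset.mem_range.1 (Finset.mem_filter.1 hb').1)
  · have hyI := Finset.mem_range.1 hy
    have hpre : (c + (y + (Q - c % Q)) % Q) % Q = y := by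
      have hc := Nat.mod_lt c hQ
      rw [Nat.add_mod_mod, ← Nat.mod_add_mod, show c % Q + (y + (Q - c % Q)) = y + Q by omega,
        Nat.add_mod_right, Nat.mod_eq_of_lt (by omega)]
    exact ⟨(y + (Q - c % Q)) % Q, Finset.mem_filter.2 ⟨Finset.mem_range.2 (Nat.mod_lt _ hQ),
      by rwa [hpre]⟩, hpre⟩

/-- The affine hash `a * u + b` modulo `Q` of `u`, with the key `(a, b)` read off the coins
`r = a + Q * b`, falls into the window `[0, I)`. -/
abbrev HashHit (Q I r u : ℕ) : Prop := (r % Q * u + r / Q) % Q < I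

theorem card_filter_range_mul {Q : ℕ} (hQ : 0 < Q) (p : ℕ → ℕ → Prop)
    [∀ a b, Decidable (p a b)] :
    ((Finset.range (Q * Q)).filter fun r => p (r % Q) (r / Q)).card =
      ∑ a ∈ Finset.range Q, ((Finset.range Q).filter fun b => p a b).card := by
  rw [← Finset.card_sigma]
  refine Finset.card_bij' (fun r _ => ⟨r % Q, r / Q⟩) (fun s _ => s.1 + Q * s.2) (fun r hr => ?_)
    (fun s hs => ?_) (fun r _ => Nat.mod_add_div r Q) (fun s hs => ?_)
  · obtain ⟨hr, hp⟩ := Finset.mem_filter.1 hr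
    simp only [Finset.mem_sigma, Finset.mem_range, Finset.mem_filter]
    exact ⟨Nat.mod_lt _ hQ, Nat.div_lt_of_lt_mul (Finset.mem_range.1 hr), hp⟩
  · simp only [Finset.mem_sigma, Finset.mem_range, Finset.mem_filter] at hs ⊢
    obtain ⟨ha, hb, hp⟩ := hs
    rw [Nat.add_mul_mod_self_left, Nat.mod_eq_of_lt ha, Nat.add_mul_div_left _ _ hQ,
      Nat.div_eq_of_lt ha, zero_add]
    exact ⟨by nlinarith, hp⟩
  · have ha := Finset.mem_range.1 (Finset.mem_sigma.1 hs).1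
    simp [Nat.mod_eq_of_lt ha, Nat.add_mul_div_left _ _ hQ, Nat.div_eq_of_lt ha]

theorem card_hashHit {Q I : ℕ} (hQ : 0 < Q) (hI : I ≤ Q) (u : ℕ) :
    ((Finset.range (Q * Q)).filter fun r => HashHit Q I r u).card = Q * I := by
  refine (card_filter_range_mul hQ fun a b => (a * u + b) % Q < I).trans ?_
  simp [card_filter_add_mod_lt hQ hI]

theorem card_hashHit_and_hashHit_le_of_lt {Q I u u' : ℕ} (hQ : 0 < Q) (h : u < u') :
    ((Finset.range (Q * Q)).filter fun r => HashHit Q I r u ∧ HashHit Q I r u').card ≤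
      I * (I + u') := by
  obtain ⟨Δ, hΔ, rfl⟩ : ∃ Δ, 0 < Δ ∧ u' = u + Δ := ⟨u' - u, by omega, by omega⟩
  have hshift : ∀ a ∈ Finset.range Q, ((Finset.range Q).filter fun b =>
      (a * u + b) % Q < I ∧ (a * (u + Δ) + b) % Q < I).card ≤
      ((Finset.range I).filter fun y => (y + a * Δ) % Q < I).card := fun a _ => by
    refine Finset.card_le_card_of_injOn (fun b => (a * u + b) % Q) (fun b hb => ?_)
      fun b hb b' hb' hbb' => ?_
    · obtain ⟨-, hu, hu'⟩ := Finset.mem_filter.1 hb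
      refine Finset.mem_coe.2 (Finset.mem_filter.2 ⟨Finset.mem_range.2 hu, ?_⟩)
      rwa [Nat.mod_add_mod, show a * u + b + a * Δ = a * (u + Δ) + b by ring]
    · exact Nat.ModEq.eq_of_lt_of_lt (Nat.ModEq.add_left_cancel' _ hbb')
        (Finset.mem_range.1 (Finset.mem_filter.1 hb).1)
        (Finset.mem_range.1 (Finset.mem_filter.1 hb').1)
  rw [card_filter_range_mul hQ fun a b => (a * u + b) % Q < I ∧ (a * (u + Δ) + b) % Q < I]
  calc _ ≤ ∑ a ∈ Finset.range Q, ((Finset.range I).filter fun y => (y + a * Δ) % Q < I).card :=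
        Finset.sum_le_sum hshift
    _ = ∑ y ∈ Finset.range I, ((Finset.range Q).filter fun a => (y + a * Δ) % Q < I).card := by
        simp only [Finset.card_filter]
        exact Finset.sum_comm
    _ ≤ ∑ _y ∈ Finset.range I, (I + (u + Δ)) := Finset.sum_le_sum fun y _ =>
        (card_filter_add_mul_mod_lt_le hQ hΔ I y).trans (by omega)
    _ = I * (I + (u + Δ)) := by simp

theorem card_hashHit_and_hashHit_le {Q I u u' s : ℕ} (hQ : 0 < Q) (h : u ≠ u') (hu : u ≤ s)
    (hu' : u' ≤ s) :
    ((Finset.range (Q * Q)).filter fun r => HashHit Q I r u ∧ HashHit Q I r u').card ≤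
      I * (I + s) := by
  rcases lt_or_gt_of_ne h with h | h
  · exact (card_hashHit_and_hashHit_le_of_lt hQ h).trans (Nat.mul_le_mul_left _ (by omega))
  · simp only [and_comm (a := HashHit Q I _ u)]
    exact (card_hashHit_and_hashHit_le_of_lt hQ h).trans (Nat.mul_le_mul_left _ (by omega))

theorem sq_sum_card_le_card_exists_mul {α β : Type*} (R : Finset α) (S : Finset β)
    (H : α → β → Prop) [∀ r u, Decidable (H r u)] :
    (∑ u ∈ S, (R.filter fun r => H r u).card) ^ 2 ≤
      (R.filter fun r => ∃ u ∈ S, H r u).card *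
        ∑ u ∈ S, ∑ u' ∈ S, (R.filter fun r => H r u ∧ H r u').card := by
  set A := R.filter fun r => ∃ u ∈ S, H r u
  let hits : α → ℕ := fun r => ∑ u ∈ S, if H r u then 1 else 0
  have hits_eq_zero : ∀ r ∈ R, r ∉ A → hits r = 0 := fun r hr hrA =>
    Finset.sum_eq_zero fun u hu => if_neg fun h => hrA (Finset.mem_filter.2 ⟨hr, u, hu, h⟩)
  have hits_sq : ∀ r, hits r ^ 2 = ∑ u ∈ S, ∑ u' ∈ S, if H r u ∧ H r u' then 1 else 0 :=
    fun r => by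
      rw [sq, Finset.sum_mul_sum]
      refine Finset.sum_congr rfl fun u _ => Finset.sum_congr rfl fun u' _ => ?_
      rw [ite_and, ite_mul, one_mul, zero_mul]
  have hfirst : ∑ r ∈ A, hits r = ∑ u ∈ S, (R.filter fun r => H r u).card := by
    rw [Finset.sum_subset (Finset.filter_subset _ _) hits_eq_zero, Finset.sum_comm]
    simp only [Finset.card_filter]
  have hsecond : ∑ r ∈ A, hits r ^ 2 ≤
      ∑ u ∈ S, ∑ u' ∈ S, (R.filter fun r => H r u ∧ H r u').card := by
    refine (Finset.sum_le_sum_of_subset (Finset.filter_subset _ _)).trans (le_of_eq ?_)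
    simp only [hits_sq, Finset.card_filter]
    rw [Finset.sum_comm]
    exact Finset.sum_congr rfl fun u _ => Finset.sum_comm
  calc _ = (∑ r ∈ A, hits r) ^ 2 := by rw [hfirst]
    _ ≤ A.card * ∑ r ∈ A, hits r ^ 2 := sq_sum_le_card_mul_sum_sq
    _ ≤ _ := Nat.mul_le_mul_left _ hsecond

/-- The keys at which the hash value of some element of `S` is below `I`. -/
def hitKeys (Q I : ℕ) (S : Finset ℕ) : Finset ℕ :=
  (Finset.range (Q * Q)).filter fun r => ∃ u ∈ S, HashHit Q I r u

section

variable {Q I : ℕ}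

theorem card_hitKeys_le (hQ : 0 < Q) (hI : I ≤ Q) (S : Finset ℕ) :
    (hitKeys Q I S).card ≤ S.card * (Q * I) := by
  have hsub : hitKeys Q I S ⊆
      S.biUnion fun u => (Finset.range (Q * Q)).filter fun r => HashHit Q I r u := fun r hr => by
    obtain ⟨hr, u, hu, hhit⟩ := Finset.mem_filter.1 hr
    exact Finset.mem_biUnion.2 ⟨u, hu, Finset.mem_filter.2 ⟨hr, hhit⟩⟩
  refine (Finset.card_le_card hsub).trans (Finset.card_biUnion_le.trans ?_)
  simp [card_hashHit hQ hI]

theorem sq_card_mul_le_card_hitKeys_mul (hQ : 0 < Q) (hI : I ≤ Q) {S : Finset ℕ} {s : ℕ}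
    (hS : ∀ u ∈ S, u ≤ s) :
    (S.card * (Q * I)) ^ 2 ≤
      (hitKeys Q I S).card * (S.card * (Q * I) + S.card ^ 2 * (I * (I + s))) := by
  have hpairs : ∀ u ∈ S, ∑ u' ∈ S,
      ((Finset.range (Q * Q)).filter fun r => HashHit Q I r u ∧ HashHit Q I r u').card ≤
        Q * I + S.card * (I * (I + s)) := fun u hu => by
    rw [← Finset.add_sum_erase S _ hu]
    refine Nat.add_le_add (by simp only [and_self, card_hashHit hQ hI u, le_refl]) ?_
    refine (Finset.sum_le_card_nsmul _ _ (I * (I + s)) fun u' hu' => ?_).trans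
      (Nat.mul_le_mul_right _ (Finset.card_le_card (Finset.erase_subset _ _)))
    exact card_hashHit_and_hashHit_le hQ (Finset.ne_of_mem_erase hu').symm (hS u hu)
      (hS u' (Finset.mem_of_mem_erase hu'))
  have hmoment := sq_sum_card_le_card_exists_mul (Finset.range (Q * Q)) S (HashHit Q I)
  simp only [card_hashHit hQ hI, Finset.sum_const, smul_eq_mul] at hmoment
  refine hmoment.trans (Nat.mul_le_mul_left _ ((Finset.sum_le_card_nsmul _ _ _ hpairs).trans
    (le_of_eq ?_)))
  rw [smul_eq_mul]
  ring

end

theorem three_mul_card_hitKeys_le {Q K I : ℕ} (hQ : 0 < Q) (hI : I ≤ Q) (hK : K * I ≤ Q)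
    {S : Finset ℕ} (hS : 3 * S.card ≤ K) :
    3 * (hitKeys Q I S).card ≤ Q * Q := calc
  3 * (hitKeys Q I S).card ≤ 3 * (S.card * (Q * I)) :=
    Nat.mul_le_mul_left 3 (card_hitKeys_le hQ hI S)
  _ = 3 * S.card * I * Q := by ring
  _ ≤ K * I * Q := by gcongr
  _ ≤ Q * Q := by gcongr

theorem two_mul_sq_le_three_mul_card_hitKeys {Q K I s : ℕ} (hQ : 0 < Q) (hI : I ≤ Q)
    (hK : Q ≤ K * (I + 1)) (hs : 1 + 4 * s ≤ I) {S : Finset ℕ} (hS : ∀ u ∈ S, u ≤ s)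
    (hcard : 4 * K ≤ S.card) :
    2 * (Q * Q) ≤ 3 * (hitKeys Q I S).card := by
  have hmoment := sq_card_mul_le_card_hitKeys_mul hQ hI hS
  set R := (hitKeys Q I S).card
  set k := S.card
  have hK₀ : 0 < K := Nat.pos_of_mul_pos_right (hQ.trans_le hK)
  have hkI : 0 < k * I := Nat.mul_pos (by omega) (by omega)
  have hcollisions : 2 * (Q + k * (I + s)) ≤ 3 * (k * I) := by
    have hwindow : 4 * Q ≤ k * (I + 1) := calc
      4 * Q ≤ 4 * K * (I + 1) := by rw [mul_assoc]; exact Nat.mul_le_mul_left 4 hK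
      _ ≤ k * (I + 1) := Nat.mul_le_mul_right _ hcard
    have hks : k * (1 + 4 * s) ≤ k * I := Nat.mul_le_mul_left k hs
    linarith
  refine Nat.le_of_mul_le_mul_left ?_ (Nat.mul_pos hkI hkI)
  calc k * I * (k * I) * (2 * (Q * Q)) = 2 * (k * (Q * I)) ^ 2 := by ring
    _ ≤ 2 * (R * (k * (Q * I) + k ^ 2 * (I * (I + s)))) := Nat.mul_le_mul_left 2 hmoment
    _ = k * I * (R * (2 * (Q + k * (I + s)))) := by ring
    _ ≤ k * I * (R * (3 * (k * I))) := by gcongr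
    _ = k * I * (k * I) * (3 * R) := by ring

/-! ## A rational upper approximation of `π` -/

/-- The numerator of `piApprox k`. -/
def wallisNum (k : ℕ) : ℕ := 2 * (2 * k + 2) * ∏ i ∈ Finset.range k, (2 * i + 2) * (2 * i + 2)

/-- The denominator of `piApprox k`. -/
def wallisDen (k : ℕ) : ℕ := (2 * k + 1) * ∏ i ∈ Finset.range k, (2 * i + 1) * (2 * i + 3)

/-- A rational approximation of `π` from above with relative error less than `1 / k`, obtained from
Wallis' product. -/
noncomputable def piApprox (k : ℕ) : ℝ := wallisNum k / wallisDen k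

theorem piApprox_eq (k : ℕ) : piApprox k = 2 * Real.Wallis.W k * ((2 * k + 2) / (2 * k + 1)) := by
  have wallis_eq : Real.Wallis.W k = (∏ i ∈ Finset.range k, ((2 * (i : ℝ) + 2) * (2 * i + 2))) /
      ∏ i ∈ Finset.range k, ((2 * (i : ℝ) + 1) * (2 * i + 3)) := by
    rw [Real.Wallis.W, ← Finset.prod_div_distrib]
    exact Finset.prod_congr rfl fun i _ => div_mul_div_comm _ _ _ _
  rw [wallis_eq, piApprox, wallisNum, wallisDen]
  push_cast
  simp only [div_eq_mul_inv, mul_inv]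
  ring

theorem pi_le_piApprox (k : ℕ) : Real.pi ≤ piApprox k := by
  have h := Real.Wallis.le_W k
  rw [div_mul_eq_mul_div, div_le_iff₀ (by positivity)] at h
  rw [piApprox_eq, ← mul_div_assoc, le_div_iff₀ (by positivity)]
  linarith

theorem piApprox_le_mul {k : ℕ} (hk : 0 < k) : piApprox k ≤ Real.pi * (1 + 1 / k) := by
  rw [piApprox_eq]
  refine mul_le_mul (by linarith [Real.Wallis.W_le k]) ?_ (by positivity) Real.pi_pos.le
  have hk' : (0 : ℝ) < k := by exact_mod_cast hk
  rw [div_le_iff₀ (by positivity)]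
  have expand : (1 + 1 / (k : ℝ)) * (2 * k + 1) = 2 * k + 1 + (2 + 1 / k) := by field_simp
  linarith [one_div_pos.2 hk']

theorem two_le_piApprox (k : ℕ) : 2 ≤ piApprox k := Real.two_le_pi.trans (pi_le_piApprox k)

/-! ## Counting weighted lattice points -/

/-- The integer vector whose coordinates are the first `n` digits of `f`, shifted so that they range
over an interval around `0`. -/
def digitVec (n b f : ℕ) (k : Fin n) : ℤ := (digit b f k : ℤ) - (b / 2 : ℕ)

/-- The numbers whose `n + 1` digits in base `b` encode a nonzero integer vector together with a
natural number below the weight of this vector. -/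
def weightedPoints (n b : ℕ) (wt : (Fin n → ℤ) → ℕ) : Finset ℕ :=
  (Finset.range (b ^ (n + 1))).filter fun f =>
    digitVec n b f ≠ 0 ∧ digit b f n < wt (digitVec n b f)

theorem mem_weightedPoints {n b f : ℕ} {wt : (Fin n → ℤ) → ℕ} :
    f ∈ weightedPoints n b wt ↔
      f < b ^ (n + 1) ∧ digitVec n b f ≠ 0 ∧ digit b f n < wt (digitVec n b f) := by
  rw [weightedPoints, Finset.mem_filter, Finset.mem_range]

theorem eq_of_digitVec_eq_of_digit_eq {n b f f' : ℕ} (hf : f < b ^ (n + 1)) (hf' : f' < b ^ (n + 1))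
    (hvec : digitVec n b f = digitVec n b f') (hdigit : digit b f n = digit b f' n) : f = f' := by
  refine eq_of_digit_eq hf hf' fun i hi => ?_
  rcases Nat.lt_succ_iff_lt_or_eq.1 hi with hi | rfl
  · exact_mod_cast sub_left_inj.1 (congrFun hvec ⟨i, hi⟩)
  · exact hdigit

theorem exists_digitVec_eq {n b : ℕ} {z : Fin n → ℤ} {j : ℕ}
    (hz : ∀ k, |z k| < (b / 2 : ℕ)) (hj : j < b) :
    ∃ f < b ^ (n + 1), digitVec n b f = z ∧ digit b f n = j := by
  obtain ⟨f, hf, hdigit⟩ := exists_digit_eq (b := b) (n + 1)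
    (fun i => if h : i < n then (z ⟨i, h⟩ + (b / 2 : ℕ)).toNat else j) fun i _ => by
      split_ifs with h
      · have := abs_lt.1 (hz ⟨i, h⟩)
        omega
      · exact hj
  refine ⟨f, hf, funext fun k => ?_, by rw [hdigit n (by omega), dif_neg (by omega)]⟩
  rw [digitVec, hdigit k (by omega), dif_pos k.2]
  have := abs_lt.1 (hz k)
  simp only [Fin.eta]
  omega

theorem exists_card_weightedPoints_le_sum (n b : ℕ) (wt : (Fin n → ℤ) → ℕ) :
    ∃ F : Finset (Fin n → ℤ), 0 ∉ F ∧ (weightedPoints n b wt).card ≤ ∑ z ∈ F, wt z := by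
  refine ⟨(weightedPoints n b wt).image (digitVec n b), fun h => ?_, ?_⟩
  · obtain ⟨f, hf, hzero⟩ := Finset.mem_image.1 h
    exact (mem_weightedPoints.1 hf).2.1 hzero
  rw [Finset.card_eq_sum_card_image (digitVec n b)]
  refine Finset.sum_le_sum fun z _ => ?_
  rw [← Finset.card_range (wt z)]
  refine Finset.card_le_card_of_injOn (fun f => digit b f n) (fun f hf => ?_)
    fun f hf f' hf' hdigit => ?_
  · obtain ⟨hmem, rfl⟩ := Finset.mem_filter.1 hf
    exact Finset.mem_coe.2 (Finset.mem_range.2 (mem_weightedPoints.1 hmem).2.2)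
  · obtain ⟨hf, hz⟩ := Finset.mem_filter.1 hf
    obtain ⟨hf', hz'⟩ := Finset.mem_filter.1 hf'
    exact eq_of_digitVec_eq_of_digit_eq (mem_weightedPoints.1 hf).1 (mem_weightedPoints.1 hf').1
      (hz.trans hz'.symm) hdigit

theorem sum_min_le_card_weightedPoints {n b : ℕ} (wt : (Fin n → ℤ) → ℕ) {G : Finset (Fin n → ℤ)}
    (hzero : 0 ∉ G) (hG : ∀ z ∈ G, ∀ k, |z k| < (b / 2 : ℕ)) :
    ∑ z ∈ G, min b (wt z) ≤ (weightedPoints n b wt).card := by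
  let pairs := G.sigma fun z => Finset.range (min b (wt z))
  have mem_pairs : ∀ s ∈ pairs, s.1 ∈ G ∧ s.2 < b ∧ s.2 < wt s.1 := fun s hs =>
    ⟨(Finset.mem_sigma.1 hs).1, lt_min_iff.1 (Finset.mem_range.1 (Finset.mem_sigma.1 hs).2)⟩
  choose! φ φ_lt φ_vec φ_digit using fun s (hs : s ∈ pairs) =>
    exists_digitVec_eq (hG s.1 (mem_pairs s hs).1) (mem_pairs s hs).2.1
  have card_pairs : pairs.card = ∑ z ∈ G, min b (wt z) := by
    simp only [pairs, Finset.card_sigma, Finset.card_range]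
  rw [← card_pairs]
  refine Finset.card_le_card_of_injOn φ (fun s hs => Finset.mem_coe.2 (mem_weightedPoints.2
    ⟨φ_lt s hs, ?_, ?_⟩)) fun s hs s' hs' h => ?_
  · rw [φ_vec s hs]
    exact fun h => hzero (h ▸ (mem_pairs s hs).1)
  · rw [φ_vec s hs, φ_digit s hs]
    exact (mem_pairs s hs).2.2
  · exact Sigma.ext (by rw [← φ_vec s hs, h, φ_vec s' hs'])
      (heq_of_eq (by rw [← φ_digit s hs, h, φ_digit s' hs']))

theorem min_sum_le_sum_min {ι : Type*} (b : ℕ) (G : Finset ι) (f : ι → ℕ) :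
    min b (∑ z ∈ G, f z) ≤ ∑ z ∈ G, min b (f z) := by
  classical
  induction G using Finset.induction_on with
  | empty => simp
  | insert z G hz ih =>
    rw [Finset.sum_insert hz, Finset.sum_insert hz]
    omega

theorem min_sum_le_card_weightedPoints {n b : ℕ} (wt : (Fin n → ℤ) → ℕ) {G : Finset (Fin n → ℤ)}
    (hzero : 0 ∉ G) (hG : ∀ z ∈ G, ∀ k, |z k| < (b / 2 : ℕ)) :
    min b (∑ z ∈ G, wt z) ≤ (weightedPoints n b wt).card :=
  (min_sum_le_sum_min b G wt).trans (sum_min_le_card_weightedPoints wt hzero hG)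

/-! ## Bounds in terms of the length of the instance -/

section InstanceBounds

variable {n : ℕ} (B : Matrix (Fin n) (Fin n) ℚ)

theorem commonDen_le_two_pow :
    commonDen B ≤ 2 ^ (((encodeMatrix B).length + 1) * (encodeMatrix B).length) := by
  refine (commonDen_le B fun e _ => (den_lt B e).le).trans ?_
  rw [← pow_mul]
  exact Nat.pow_le_pow_right two_pos (Nat.mul_le_mul_left _ (sq_dim_le_length B))

theorem natAbs_scaledEntry_le (e : ℕ) :
    (scaledEntry B e).natAbs ≤ 2 ^ ((encodeMatrix B).length + 1) ^ 2 := by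
  rw [scaledEntry, Int.natAbs_mul, Int.natAbs_natCast]
  refine (Nat.mul_le_mul (natAbs_num_lt B e).le ((Nat.div_le_self _ _).trans
    (commonDen_le_two_pow B))).trans ?_
  rw [← pow_add]
  exact Nat.pow_le_pow_right two_pos (by ring_nf; omega)

theorem factorial_mul_pow_le :
    n.factorial * (2 ^ ((encodeMatrix B).length + 1) ^ 2) ^ n ≤
      2 ^ ((encodeMatrix B).length + 1) ^ 3 := by
  set l := (encodeMatrix B).length
  have factorial_le : n.factorial ≤ 2 ^ l := by
    refine (Nat.factorial_le_pow n).trans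
      ((Nat.pow_le_pow_left (Nat.lt_two_pow_self (n := n)).le n).trans ?_)
    rw [← pow_mul]
    exact Nat.pow_le_pow_right two_pos (sq_dim_le_length B)
  have pow_le : (2 ^ (l + 1) ^ 2) ^ n ≤ 2 ^ ((l + 1) ^ 2 * l) := by
    rw [← pow_mul]
    exact Nat.pow_le_pow_right two_pos (Nat.mul_le_mul_left _ (dim_le_length B))
  refine (Nat.mul_le_mul factorial_le pow_le).trans ?_
  rw [← pow_add]
  exact Nat.pow_le_pow_right two_pos (by ring_nf; omega)

theorem abs_entry_le (i j : Fin n) : |(B i j : ℝ)| ≤ 2 ^ ((encodeMatrix B).length + 1) := by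
  have num_le := (natAbs_num_lt B (i * n + j)).le
  rw [rowMajor_apply] at num_le
  have abs_eq : |B i j| = ((B i j).num.natAbs : ℚ) / (B i j).den := by
    conv_lhs => rw [← Rat.num_div_den (B i j)]
    rw [abs_div, Nat.abs_cast, Nat.cast_natAbs, Int.cast_abs]
  have abs_le : |B i j| ≤ ((2 ^ ((encodeMatrix B).length + 1) : ℕ) : ℚ) := by
    rw [abs_eq]
    exact (div_le_self (Nat.cast_nonneg _) (by exact_mod_cast (B i j).den_pos)).trans
      (by exact_mod_cast num_le)
  exact_mod_cast abs_le

variable {B}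

theorem exists_isDualCertificate_le_two_pow (hB : B.det ≠ 0) :
    ∃ (E : ℕ → ℤ) (d : ℕ), IsDualCertificate B E d ∧
      d ≤ 2 ^ ((encodeMatrix B).length + 1) ^ 3 ∧
      ∀ e, (E e).natAbs ≤ 2 ^ ((encodeMatrix B).length + 1) ^ 3 := by
  obtain ⟨E, d, h, d_le, E_le⟩ := exists_isDualCertificate_le hB
    (fun e _ => natAbs_scaledEntry_le B e) Nat.one_le_two_pow
  exact ⟨E, d, h, d_le.trans (factorial_mul_pow_le B),
    fun e => (E_le e).trans (factorial_mul_pow_le B)⟩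

theorem norm_dualVec_le_two_pow {M : ℕ} {z : Fin n → ℤ} (hz : ‖dualVec B z‖ ≤ commonDen B + M) :
    ‖dualVec B z‖ ≤
      2 ^ (((encodeMatrix B).length + 1) * (encodeMatrix B).length + M + 1) := by
  set k := ((encodeMatrix B).length + 1) * (encodeMatrix B).length
  have commonDen_le : commonDen B ≤ 2 ^ (k + M) :=
    (commonDen_le_two_pow B).trans (Nat.pow_le_pow_right two_pos (by omega))
  have M_le : M ≤ 2 ^ (k + M) :=
    Nat.lt_two_pow_self.le.trans (Nat.pow_le_pow_right two_pos (by omega))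
  refine hz.trans ?_
  rw [pow_succ]
  exact_mod_cast (by omega : commonDen B + M ≤ 2 ^ (k + M) * 2)

theorem abs_coord_lt (hB : B.det ≠ 0) {M h : ℕ} {z : Fin n → ℤ}
    (hz : ‖dualVec B z‖ ≤ commonDen B + M)
    (hh : M + 4 * ((encodeMatrix B).length + 1) ^ 3 + 4 ≤ h) (k : Fin n) :
    |z k| < ((2 ^ h / 2 : ℕ) : ℤ) := by
  have norm_le := norm_dualVec_le_two_pow hz
  have coord_le := abs_coord_le hB (abs_entry_le B) z k
  have dim_le : (n : ℝ) ≤ 2 ^ (encodeMatrix B).length := by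
    exact_mod_cast (dim_le_length B).trans Nat.lt_two_pow_self.le
  set l := (encodeMatrix B).length
  have exponent_lt : l + (l + 1 + ((l + 1) * l + M + 1)) < h - 1 := by
    have cube : 4 * (l + 1) ^ 3 = 4 * l ^ 3 + 12 * l ^ 2 + 12 * l + 4 := by ring
    have square : (l + 1) * l = l ^ 2 + l := by ring
    omega
  have half_eq : 2 ^ h / 2 = 2 ^ (h - 1) := by
    obtain ⟨h', rfl⟩ : ∃ h', h = h' + 1 := ⟨h - 1, by omega⟩
    rw [pow_succ, Nat.mul_div_cancel _ two_pos, Nat.add_sub_cancel]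
  have coord_lt : |(z k : ℝ)| < 2 ^ (h - 1) := calc
    |(z k : ℝ)| ≤ 2 ^ l * (2 ^ (l + 1) * 2 ^ ((l + 1) * l + M + 1)) :=
        coord_le.trans (mul_le_mul dim_le (mul_le_mul_of_nonneg_left norm_le (by positivity))
          (by positivity) (by positivity))
    _ = 2 ^ (l + (l + 1 + ((l + 1) * l + M + 1))) := by rw [← pow_add, ← pow_add]
    _ < 2 ^ (h - 1) := pow_lt_pow_right₀ one_lt_two exponent_lt
  rw [half_eq]
  exact_mod_cast coord_lt

theorem two_mul_add_le_exp {a m d : ℕ} {κ : ℝ} (ha : 0 < a) (hd : 0 < d) (hdm : d ≤ 2 ^ m)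
    (hκ : 1 / a ≤ κ) : 2 * (1 + (d : ℝ) ^ 2 / κ) ≤ Real.exp (2 + a + 2 * m : ℕ) := by
  have ha' : (1 : ℝ) ≤ a := by exact_mod_cast ha
  have hd' : (1 : ℝ) ≤ d := by exact_mod_cast hd
  have div_le : (d : ℝ) ^ 2 / κ ≤ a * (d : ℝ) ^ 2 := by
    have one_le : 1 ≤ κ * a := (div_le_iff₀ (by linarith)).1 hκ
    rw [div_le_iff₀ ((by positivity : (0 : ℝ) < 1 / a).trans_le hκ)]
    nlinarith [sq_nonneg (d : ℝ)]
  have one_le : (1 : ℝ) ≤ a * (d : ℝ) ^ 2 := by nlinarith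
  calc 2 * (1 + (d : ℝ) ^ 2 / κ) ≤ 4 * (a * (d : ℝ) ^ 2) := by linarith
    _ ≤ 4 * (2 ^ a * (2 ^ m) ^ 2) := by
        have a_le : a ≤ 2 ^ a := Nat.lt_two_pow_self.le
        gcongr <;> exact_mod_cast ‹_›
    _ = 2 ^ (2 + a + 2 * m) := by
        rw [pow_add, pow_add, ← pow_mul, mul_comm m]
        ring
    _ ≤ Real.exp 1 ^ (2 + a + 2 * m) :=
        pow_le_pow_left₀ zero_le_two (by linarith [Real.add_one_le_exp 1]) _
    _ = Real.exp (2 + a + 2 * m : ℕ) := Real.exp_one_pow _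

theorem sum_exp_le_exp (hB : B.det ≠ 0) {a P : ℕ} (ha : 0 < a)
    (hP : (encodeMatrix B).length * (2 + a + 2 * ((encodeMatrix B).length + 1) ^ 3) ≤ P)
    (F : Finset (Fin n → ℤ)) :
    ∑ z ∈ F, Real.exp (-(1 / (2 * a) * (piApprox a * ‖dualVec B z‖ ^ 2))) ≤ Real.exp P := by
  obtain ⟨E, d, hE, hd, -⟩ := exists_isDualCertificate_le_two_pow hB
  have ha' : (0 : ℝ) < a := by exact_mod_cast ha
  set κ := 1 / (2 * a) * piApprox a with hκ
  have le_κ : 1 / a ≤ κ := by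
    rw [hκ, div_mul_eq_mul_div, div_le_div_iff₀ ha' (by positivity)]
    nlinarith [two_le_piApprox a]
  simp only [← mul_assoc, ← hκ]
  calc ∑ z ∈ F, Real.exp (-(κ * ‖dualVec B z‖ ^ 2))
      ≤ (2 * (1 + (d : ℝ) ^ 2 / κ)) ^ n :=
        hE.sum_exp_le hB ((by positivity : (0 : ℝ) < 1 / a).trans_le le_κ) F
    _ ≤ Real.exp (2 + a + 2 * ((encodeMatrix B).length + 1) ^ 3 : ℕ) ^ n :=
        pow_le_pow_left₀ (by have := (one_div_pos.2 ha').trans_le le_κ; positivity)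
          (two_mul_add_le_exp ha hE.1 hd le_κ) n
    _ ≤ Real.exp P := by
        rw [← Real.exp_nat_mul, Real.exp_le_exp]
        exact_mod_cast (Nat.mul_le_mul_right _ (dim_le_length B)).trans hP

theorem exists_norm_dualVec_le (hB : B.det ≠ 0) {z₀ : Fin n → ℤ} (hz₀ : z₀ ≠ 0) :
    ∃ z : Fin n → ℤ, z ≠ 0 ∧ ‖dualVec B z‖ ≤ commonDen B ∧ ‖dualVec B z‖ ≤ ‖dualVec B z₀‖ := by
  have hn : 0 < n := Nat.pos_of_ne_zero fun h => hz₀ (funext fun k => (h ▸ k).elim0)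
  obtain ⟨z₁, hz₁, norm_eq⟩ := exists_norm_dualVec_eq_commonDen hB hn
  rcases le_total ‖dualVec B z₀‖ ‖dualVec B z₁‖ with hle | hle
  · exact ⟨z₀, hz₀, norm_eq ▸ hle, le_rfl⟩
  · exact ⟨z₁, hz₁, norm_eq.le, hle⟩

end InstanceBounds

/-! ## The number of weighted dual vectors separates the two kinds of instances -/

section LatticeWeight

variable {n : ℕ} {B : Matrix (Fin n) (Fin n) ℚ} {a M D : ℕ} {τ : ℤ} {T : ℝ}

/-- An integer approximation of a multiple of `exp (T - π ‖w‖ ^ 2)`, where `w` is the dual vector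
with coordinates `z` and `τ` is close to `D * T`. -/
noncomputable def latticeWeight (B : Matrix (Fin n) (Fin n) ℚ) (a M D : ℕ) (τ : ℤ)
    (z : Fin n → ℤ) : ℕ :=
  powWeight M D τ (piApprox a * ‖dualVec B z‖ ^ 2)

theorem card_weightedPoints_latticeWeight_le {b : ℕ} (hM : 0 < M) (hD : 0 < D)
    (hτ : |(τ : ℝ) - D * T| ≤ 1)
    (hsmall : ∀ F : Finset (Fin n → ℤ), 0 ∉ F →
      ∑ z ∈ F, Real.exp (-(Real.pi * ‖dualVec B z‖ ^ 2)) ≤ Real.exp (-T)) :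
    ((weightedPoints n b (latticeWeight B a M D τ)).card : ℝ) ≤
      ((M : ℝ) * D) ^ M * Real.exp (1 / D) := by
  obtain ⟨F, hzero, card_le⟩ := exists_card_weightedPoints_le_sum n b (latticeWeight B a M D τ)
  calc ((weightedPoints n b (latticeWeight B a M D τ)).card : ℝ)
      ≤ ∑ z ∈ F, (latticeWeight B a M D τ z : ℝ) := by exact_mod_cast card_le
    _ ≤ ∑ z ∈ F, ((M : ℝ) * D) ^ M * Real.exp (T + 1 / D) *
          Real.exp (-(Real.pi * ‖dualVec B z‖ ^ 2)) := by
        refine Finset.sum_le_sum fun z _ => (powWeight_le hM hD hτ).trans ?_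
        rw [mul_assoc, ← Real.exp_add]
        gcongr
        linarith [mul_le_mul_of_nonneg_right (pi_le_piApprox a) (sq_nonneg ‖dualVec B z‖)]
    _ ≤ ((M : ℝ) * D) ^ M * Real.exp (T + 1 / D) * Real.exp (-T) := by
        rw [← Finset.mul_sum]
        exact mul_le_mul_of_nonneg_left (hsmall F hzero) (by positivity)
    _ = ((M : ℝ) * D) ^ M * Real.exp (1 / D) := by
        rw [mul_assoc, ← Real.exp_add]
        ring_nf

theorem two_mul_pow_le_two_pow {M D h : ℕ} (hh : M * D * M < h) : 2 * (M * D) ^ M ≤ 2 ^ h := calc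
  2 * (M * D) ^ M ≤ 2 * (2 ^ (M * D)) ^ M :=
      Nat.mul_le_mul_left 2 (Nat.pow_le_pow_left Nat.lt_two_pow_self.le M)
  _ = 2 ^ (M * D * M + 1) := by rw [← pow_mul, pow_succ']
  _ ≤ 2 ^ h := Nat.pow_le_pow_right two_pos hh

theorem min_sum_latticeWeight_le_card (hB : B.det ≠ 0) {h : ℕ} {G : Finset (Fin n → ℤ)}
    (hzero : 0 ∉ G) (hG : ∀ z ∈ G, ‖dualVec B z‖ ≤ commonDen B + M)
    (hh : M + 4 * ((encodeMatrix B).length + 1) ^ 3 + 4 ≤ h) {K : ℝ}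
    (hKh : K ≤ (2 ^ h : ℕ)) (hK : K ≤ ∑ z ∈ G, (latticeWeight B a M D τ z : ℝ)) :
    K ≤ (weightedPoints n (2 ^ h) (latticeWeight B a M D τ)).card :=
  (le_min hKh hK).trans (by
    exact_mod_cast min_sum_le_card_weightedPoints (latticeWeight B a M D τ) hzero
      fun z hz => abs_coord_lt hB (hG z hz) hh)

theorem norm_dualVec_le_of_piApprox_mul_le {z : Fin n → ℤ} (hM : 0 < M)
    (hz : piApprox a * ‖dualVec B z‖ ^ 2 ≤ M) : ‖dualVec B z‖ ≤ commonDen B + M := by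
  have hM' : (1 : ℝ) ≤ M := by exact_mod_cast hM
  have norm_le : ‖dualVec B z‖ ≤ M := by
    refine abs_le_of_sq_le_sq' ?_ (by linarith) |>.2
    nlinarith [two_le_piApprox a, sq_nonneg ‖dualVec B z‖]
  exact norm_le.trans (le_add_of_nonneg_left (Nat.cast_nonneg _))

theorem exp_quarter_le_two {a : ℕ} (ha : 0 < a) : Real.exp (1 / (4 * a)) ≤ 2 := by
  have ha' : (1 : ℝ) ≤ a := by exact_mod_cast ha
  have le_half : 1 / (4 * (a : ℝ)) ≤ 1 / 2 := one_div_le_one_div_of_le two_pos (by linarith)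
  calc Real.exp (1 / (4 * a)) ≤ Real.exp (Real.log 2) :=
        Real.exp_le_exp.2 (by linarith [Real.log_two_gt_d9])
    _ = 2 := Real.exp_log two_pos

theorem exp_lt_sum_exp_piApprox (ha : 0 < a) {F : Finset (Fin n → ℤ)} {c : ℝ}
    (hlarge : c < ∑ z ∈ F, Real.exp (-(Real.pi * (1 + 1 / (a : ℝ)) ^ 2 * ‖dualVec B z‖ ^ 2))) :
    c < ∑ z ∈ F, Real.exp (-((1 + 1 / (a : ℝ)) * (piApprox a * ‖dualVec B z‖ ^ 2))) := by
  refine hlarge.trans_le (Finset.sum_le_sum fun z _ => Real.exp_le_exp.2 (neg_le_neg ?_))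
  calc (1 + 1 / (a : ℝ)) * (piApprox a * ‖dualVec B z‖ ^ 2)
      ≤ (1 + 1 / (a : ℝ)) * (Real.pi * (1 + 1 / a) * ‖dualVec B z‖ ^ 2) := by
        gcongr
        exact piApprox_le_mul ha
    _ = Real.pi * (1 + 1 / (a : ℝ)) ^ 2 * ‖dualVec B z‖ ^ 2 := by ring

theorem exists_two_mul_pow_le_latticeWeight (hB : B.det ≠ 0) (hM : 0 < M) (hD : 2 ≤ D)
    (hτ : |(τ : ℝ) - D * T| ≤ 1) {z₀ : Fin n → ℤ} (hz₀ : z₀ ≠ 0)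
    (norm_le : piApprox a * ‖dualVec B z₀‖ ^ 2 ≤ T - 2) :
    ∃ z ≠ 0, ‖dualVec B z‖ ≤ commonDen B ∧
      2 * ((M : ℝ) * D) ^ M ≤ latticeWeight B a M D τ z := by
  obtain ⟨z, hz, norm_le_den, norm_le_norm⟩ := exists_norm_dualVec_le hB hz₀
  have piApprox_nonneg : 0 ≤ piApprox a := by linarith [two_le_piApprox a]
  have two_div_le : 2 / (D : ℝ) ≤ 1 := div_le_one_of_le₀ (by exact_mod_cast hD) D.cast_nonneg
  have sq_le := mul_le_mul_of_nonneg_left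
    (pow_le_pow_left₀ (norm_nonneg (dualVec B z)) norm_le_norm 2) piApprox_nonneg
  exact ⟨z, hz, norm_le_den,
    two_mul_le_powWeight hM (by omega) (by positivity) hτ (by linarith)⟩

theorem le_card_weightedPoints_latticeWeight (hB : B.det ≠ 0) {P h : ℕ} (ha : 0 < a)
    (hP : (encodeMatrix B).length * (2 + a + 2 * ((encodeMatrix B).length + 1) ^ 3) ≤ P)
    (hM : 64 * a * (a * (2 * P + 6) + 1) ^ 2 ≤ M)
    (hh : M * (32 * a) * M + M + 4 * ((encodeMatrix B).length + 1) ^ 3 + 4 ≤ h)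
    (hτ : |(τ : ℝ) - (32 * a : ℕ) * T| ≤ 1) {F : Finset (Fin n → ℤ)} (hzero : 0 ∉ F)
    (hlarge : Real.exp (-T + 1 / (2 * a)) <
      ∑ z ∈ F, Real.exp (-(Real.pi * (1 + 1 / (a : ℝ)) ^ 2 * ‖dualVec B z‖ ^ 2))) :
    ((M : ℝ) * (32 * a : ℕ)) ^ M * Real.exp (1 / (4 * a)) ≤
      (weightedPoints n (2 ^ h) (latticeWeight B a M (32 * a) τ)).card := by
  have M_pos : 0 < M := lt_of_lt_of_le (by positivity) hM
  have ha' : (1 : ℝ) ≤ a := by exact_mod_cast ha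
  have piApprox_nonneg : 0 ≤ piApprox a := by linarith [two_le_piApprox a]
  set K : ℝ := ((M : ℝ) * (32 * a : ℕ)) ^ M with hK
  have le_two_mul : K * Real.exp (1 / (4 * a)) ≤ 2 * K := by
    rw [mul_comm 2]
    exact mul_le_mul_of_nonneg_left (exp_quarter_le_two ha) (by positivity)
  have le_two_pow : K * Real.exp (1 / (4 * a)) ≤ (2 ^ h : ℕ) := le_two_mul.trans (by
    rw [hK]
    exact_mod_cast two_mul_pow_le_two_pow (by omega : M * (32 * a) * M < h))
  rcases exists_le_or_mul_exp_le_sum_powWeight (fun z => by positivity) ha hM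
    (fun G _ => sum_exp_le_exp hB ha hP G) hτ (exp_lt_sum_exp_piApprox ha hlarge) with
    ⟨z₀, hz₀, norm_z₀_le⟩ | sum_near_ge
  · obtain ⟨z, hz, norm_le, heavy⟩ := exists_two_mul_pow_le_latticeWeight hB M_pos
      (by omega) hτ (ne_of_mem_of_not_mem hz₀ hzero) norm_z₀_le
    refine min_sum_latticeWeight_le_card hB (G := {z}) (by simpa using hz.symm)
      (fun z' hz' => ?_) (by omega) le_two_pow (by simpa using le_two_mul.trans heavy)
    rw [Finset.mem_singleton.1 hz']
    exact norm_le.trans (le_add_of_nonneg_right (Nat.cast_nonneg _))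
  · refine min_sum_latticeWeight_le_card hB (fun h => hzero (Finset.mem_filter.1 h).1)
      (fun z hz => norm_dualVec_le_of_piApprox_mul_le (a := a) M_pos ?_) (by omega) le_two_pow
      sum_near_ge
    exact (Finset.mem_filter.1 hz).2.trans (div_le_self (Nat.cast_nonneg _) (by linarith))

end LatticeWeight

/-! ## Reading the prover's message -/

/-- The base `b` digits of `m` spell out the instance code `X` as a matrix of dimension `n`. Digits
`5 * e + 1` to `5 * e + 4` are the absolute value of the numerator of the `e`-th entry, its
denominator, its sign, and the code of the entries from the `e`-th on. -/
def IsParse (X n b m : ℕ) : Prop :=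
  X = natCode n (digit b m 4) ∧ ∀ e < n * n, digit b m (5 * e + 4) =
    digit b m (5 * e + 3) % 2 + 2 * natCode (digit b m (5 * e + 1))
      (natCode (digit b m (5 * e + 2)) (digit b m (5 * (e + 1) + 4)))

/-- The value of `commonDen` according to the message. -/
def hintDen (n b m : ℕ) : ℕ := ∏ e ∈ Finset.range (n * n), digit b m (5 * e + 2)

/-- The value of `scaledEntry` according to the message. -/
def hintEntry (n b m e : ℕ) : ℤ :=
  (1 - 2 * ((digit b m (5 * e + 3) % 2 : ℕ) : ℤ)) * (digit b m (5 * e + 1) : ℕ) *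
    (hintDen n b m / digit b m (5 * e + 2) : ℕ)

/-- The `e`-th entry of the dual certificate in the message, shifted to allow for negative
entries. -/
def hintCoeff (b m e : ℕ) : ℤ := (digit b m (5 * e + 5) : ℕ) - (b / 2 : ℕ)

/-- The denominator of the dual certificate in the message. -/
def hintScale (n b m : ℕ) : ℕ := digit b m (5 * (n * n) + 1)

/-- The message contains a dual certificate of the matrix that it spells out. -/
def IsHintCertificate (n b m : ℕ) : Prop :=
  0 < hintScale n b m ∧ ∀ j < n, ∀ k < n,
    ∑ i ∈ Finset.range n, hintEntry n b m (i * n + j) * hintCoeff b m (i * n + k) =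
      if j = k then (hintScale n b m : ℤ) else 0

/-- The value of `certificateNorm` at the vector encoded by `f`, according to the message. -/
def hintNorm (n b m f : ℕ) : ℤ :=
  certificateNorm n (hintCoeff b m) fun k => (digit b f k : ℕ) - (b / 2 : ℕ)

/-- The value of `latticeWeight` at the vector encoded by `f`, according to the message. -/
def hintWeight (a M D : ℕ) (τ : ℤ) (n b m f : ℕ) : ℕ :=
  ((M * D : ℕ) + τ - (D * (wallisNum a * hintDen n b m ^ 2 * (hintNorm n b m f).toNat) /
    (wallisDen a * hintScale n b m ^ 2) + 1 : ℕ)).toNat ^ M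

/-- Membership of `f` in `weightedPoints`, according to the message. -/
def IsHintPoint (a M D : ℕ) (τ : ℤ) (n b m f : ℕ) : Prop :=
  (¬ ∀ k < n, digit b f k = b / 2) ∧ digit b f n < hintWeight a M D τ n b m f

section PolyTime

variable {Ω : Type*} [ProgramInput Ω]

namespace PolyTime

variable {a : Ω → ℕ}

theorem digit {b m i : Ω → ℕ} (hb : PolyTime b) (hm : PolyTime m) (hi : PolyTimeUnary i) :
    PolyTime fun ω => digit (b ω) (m ω) (i ω) :=
  (hm.div (hb.pow hi.1 hi.2)).mod hb

theorem natCode {k Y : Ω → ℕ} (hk : PolyTime k) (hY : PolyTime Y) :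
    PolyTime fun ω => natCode (k ω) (Y ω) := by
  have hsize := hk.size_unary
  have hterm : PolyTime fun p : ℕ × Ω => (1 + 2 * (k p.2 / 2 ^ p.1 % 2)) * 4 ^ p.1 :=
    ((const 1).add ((const 2).mul ((hk.comp_snd.div
      ((const 2).pow .index .index)).mod (.const 2)))).mul ((const 4).pow .index .index)
  have hshift := ((PolyTimeUnary.const 2).mul hsize).add (.const 1)
  exact (hterm.sum hsize.1 hsize.2).add (((const 2).pow hshift.1 hshift.2).mul hY)

theorem wallisNum (ha : PolyTimeUnary a) : PolyTime fun ω => wallisNum (a ω) := by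
  have hterm : PolyTime fun p : ℕ × Ω => 2 * p.1 + 2 := ((const 2).mul .index).add (.const 2)
  exact ((const 2).mul (((const 2).mul ha.1).add (.const 2))).mul
    ((hterm.mul hterm).prod ha.1 ha.2)

theorem wallisDen (ha : PolyTimeUnary a) : PolyTime fun ω => wallisDen (a ω) := by
  have hterm : ∀ k, PolyTime fun p : ℕ × Ω => 2 * p.1 + k := fun k =>
    ((const 2).mul .index).add (.const k)
  exact (((const 2).mul ha.1).add (.const 1)).mul (((hterm 1).mul (hterm 3)).prod ha.1 ha.2)

end PolyTime

theorem PolyTimeUnary.affine {i : Ω → ℕ} (hi : PolyTimeUnary i) (k : ℕ) :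
    PolyTimeUnary fun ω => 5 * i ω + k :=
  ((const 5).mul hi).add (.const k)

variable {X n b m f e a M D : Ω → ℕ} {τ : Ω → ℤ}

theorem PolyTimePred.isParse (hX : PolyTime X) (hn : PolyTimeUnary n) (hb : PolyTime b)
    (hm : PolyTime m) : PolyTimePred fun ω => IsParse (X ω) (n ω) (b ω) (m ω) := by
  have hdigit : ∀ k, PolyTime fun p : ℕ × Ω => digit (b p.2) (m p.2) (5 * p.1 + k) := fun k =>
    hb.comp_snd.digit hm.comp_snd (PolyTimeUnary.index.affine k)
  have hnext : PolyTime fun p : ℕ × Ω => digit (b p.2) (m p.2) (5 * (p.1 + 1) + 4) :=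
    hb.comp_snd.digit hm.comp_snd ((PolyTimeUnary.index.add (.const 1)).affine 4)
  exact (eq hX (hn.1.natCode (hb.digit hm (.const 4)))).and
    (forall_lt (hn.mul hn) (eq (hdigit 4) (((hdigit 3).mod (.const 2)).add
      ((PolyTime.const 2).mul ((hdigit 1).natCode ((hdigit 2).natCode hnext))))))

theorem PolyTime.hintDen (hn : PolyTimeUnary n) (hb : PolyTime b) (hm : PolyTime m) :
    PolyTime fun ω => hintDen (n ω) (b ω) (m ω) :=
  prod (f := fun p : ℕ × Ω => LatticeAM.digit (b p.2) (m p.2) (5 * p.1 + 2))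
    (hb.comp_snd.digit hm.comp_snd (PolyTimeUnary.index.affine 2)) (hn.mul hn).1 (hn.mul hn).2

theorem PolyTime.hintScale (hn : PolyTimeUnary n) (hb : PolyTime b) (hm : PolyTime m) :
    PolyTime fun ω => hintScale (n ω) (b ω) (m ω) :=
  hb.digit hm ((hn.mul hn).affine 1)

namespace PolyTimeInt

theorem hintEntry (hn : PolyTimeUnary n) (hb : PolyTime b) (hm : PolyTime m)
    (he : PolyTimeUnary e) : PolyTimeInt fun ω => hintEntry (n ω) (b ω) (m ω) (e ω) := by
  have hdigit : ∀ k, PolyTime fun ω => digit (b ω) (m ω) (5 * e ω + k) := fun k =>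
    hb.digit hm (he.affine k)
  exact (((ofNat (.const 1)).sub ((ofNat (.const 2)).mul
    (.ofNat ((hdigit 3).mod (.const 2))))).mul (.ofNat (hdigit 1))).mul
      (.ofNat ((PolyTime.hintDen hn hb hm).div (hdigit 2)))

theorem hintCoeff (hb : PolyTime b) (hm : PolyTime m) (he : PolyTimeUnary e) :
    PolyTimeInt fun ω => hintCoeff (b ω) (m ω) (e ω) :=
  (ofNat (hb.digit hm (he.affine 5))).sub (.ofNat (hb.div (.const 2)))

theorem hintNorm (hn : PolyTimeUnary n) (hb : PolyTime b) (hm : PolyTime m) (hf : PolyTime f) :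
    PolyTimeInt fun ω => hintNorm (n ω) (b ω) (m ω) (f ω) := by
  have hterm : PolyTimeInt fun p : ℕ × ℕ × Ω =>
      LatticeAM.hintCoeff (b p.2.2) (m p.2.2) (p.2.1 * n p.2.2 + p.1) *
        ((digit (b p.2.2) (f p.2.2) p.1 : ℕ) - (b p.2.2 / 2 : ℕ) : ℤ) :=
    (hintCoeff hb.comp_snd.comp_snd hm.comp_snd.comp_snd
      ((PolyTimeUnary.index.comp_snd.mul hn.comp_snd.comp_snd).add .index)).mul
      ((ofNat (hb.comp_snd.comp_snd.digit hf.comp_snd.comp_snd .index)).sub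
        (.ofNat (hb.comp_snd.comp_snd.div (.const 2))))
  have hcoord := hterm.sum hn.comp_snd
  simpa only [LatticeAM.hintNorm, certificateNorm, sq] using (hcoord.mul hcoord).sum hn

end PolyTimeInt

theorem PolyTimePred.isHintCertificate (hn : PolyTimeUnary n) (hb : PolyTime b)
    (hm : PolyTime m) : PolyTimePred fun ω => IsHintCertificate (n ω) (b ω) (m ω) := by
  have hscale := PolyTime.hintScale hn hb hm
  have hn' := hn.comp_snd.comp_snd.comp_snd
  have hb' := hb.comp_snd.comp_snd.comp_snd
  have hm' := hm.comp_snd.comp_snd.comp_snd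
  have hterm : PolyTimeInt fun p : ℕ × ℕ × ℕ × Ω =>
      hintEntry (n p.2.2.2) (b p.2.2.2) (m p.2.2.2) (p.1 * n p.2.2.2 + p.2.2.1) *
        hintCoeff (b p.2.2.2) (m p.2.2.2) (p.1 * n p.2.2.2 + p.2.1) :=
    (PolyTimeInt.hintEntry hn' hb' hm'
      ((PolyTimeUnary.index.mul hn').add PolyTimeUnary.index.comp_snd.comp_snd)).mul
      (.hintCoeff hb' hm' ((PolyTimeUnary.index.mul hn').add PolyTimeUnary.index.comp_snd))
  have hvalue := PolyTimeInt.ofNat (PolyTime.ite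
    (PolyTimePred.eq (PolyTime.index (Ω := Ω)).comp_snd .index) hscale.comp_snd.comp_snd (.const 0))
  have hidentity := forall_lt hn (forall_lt hn.comp_snd
    (int_eq (hterm.sum hn.comp_snd.comp_snd) hvalue))
  refine ((lt (.const 0) hscale).and hidentity).congr fun ω => ?_
  simp only [IsHintCertificate, Nat.cast_ite, Nat.cast_zero]

theorem PolyTime.hintWeight (ha : PolyTimeUnary a) (hM : PolyTimeUnary M) (hD : PolyTime D)
    (hτ : PolyTimeInt τ) (hn : PolyTimeUnary n) (hb : PolyTime b) (hm : PolyTime m)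
    (hf : PolyTime f) :
    PolyTime fun ω => hintWeight (a ω) (M ω) (D ω) (τ ω) (n ω) (b ω) (m ω) (f ω) := by
  have hsq := (hintDen hn hb hm).pow (.const 2) (.const 2)
  have hscale_sq := (hintScale hn hb hm).pow (.const 2) (.const 2)
  have hfloor := ((hD.mul (((wallisNum ha).mul hsq).mul
    (PolyTimeInt.hintNorm hn hb hm hf).toNat)).div ((wallisDen ha).mul hscale_sq)).add (.const 1)
  exact (((PolyTimeInt.ofNat (hM.1.mul hD)).add hτ).sub (.ofNat hfloor)).toNat.pow hM.1 hM.2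

theorem PolyTimePred.isHintPoint (ha : PolyTimeUnary a) (hM : PolyTimeUnary M) (hD : PolyTime D)
    (hτ : PolyTimeInt τ) (hn : PolyTimeUnary n) (hb : PolyTime b) (hm : PolyTime m)
    (hf : PolyTime f) :
    PolyTimePred fun ω => IsHintPoint (a ω) (M ω) (D ω) (τ ω) (n ω) (b ω) (m ω) (f ω) := by
  have hzero := forall_lt hn (P := fun p : ℕ × Ω => digit (b p.2) (f p.2) p.1 = b p.2 / 2)
    (eq (hb.comp_snd.digit hf.comp_snd .index) (hb.comp_snd.div (.const 2)))
  exact hzero.not.and (lt (hb.digit hf hn) (.hintWeight ha hM hD hτ hn hb hm hf))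

end PolyTime

/-! ## Soundness and completeness of the message -/

section Hints

variable {n : ℕ} {B : Matrix (Fin n) (Fin n) ℚ} {b m : ℕ}

namespace IsParse

variable {n' : ℕ}

theorem dim_eq (h : IsParse (codeBits (encodeMatrix B)) n' b m) : n' = n :=
  (parse_unique B (A := fun e => digit b m (5 * e + 1)) (D := fun e => digit b m (5 * e + 2))
    (S := fun e => digit b m (5 * e + 3) % 2) (Y := fun e => digit b m (5 * e + 4))
    (fun _ => Nat.mod_lt _ two_pos) h.1 h.2).1

theorem digit_eq (h : IsParse (codeBits (encodeMatrix B)) n b m) {e : ℕ} (he : e < n * n) :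
    digit b m (5 * e + 3) % 2 = (decide ((rowMajor B e).num < 0)).toNat ∧
      digit b m (5 * e + 1) = (rowMajor B e).num.natAbs ∧
      digit b m (5 * e + 2) = (rowMajor B e).den :=
  (parse_unique B (A := fun e => digit b m (5 * e + 1)) (D := fun e => digit b m (5 * e + 2))
    (S := fun e => digit b m (5 * e + 3) % 2) (Y := fun e => digit b m (5 * e + 4))
    (fun _ => Nat.mod_lt _ two_pos) h.1 h.2).2 e he

theorem hintDen_eq (h : IsParse (codeBits (encodeMatrix B)) n b m) :
    hintDen n b m = commonDen B :=
  Finset.prod_congr rfl fun _ he => (h.digit_eq (Finset.mem_range.1 he)).2.2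

theorem hintEntry_eq (h : IsParse (codeBits (encodeMatrix B)) n b m) {e : ℕ} (he : e < n * n) :
    hintEntry n b m e = scaledEntry B e := by
  obtain ⟨hsign, hnum, hden⟩ := h.digit_eq he
  rw [hintEntry, h.hintDen_eq, hsign, hnum, hden, scaledEntry]
  congr 1
  by_cases hneg : (rowMajor B e).num < 0 <;>
    simp only [hneg, decide_true, decide_false, Bool.toNat_true, Bool.toNat_false] <;> omega

theorem isHintCertificate_iff (h : IsParse (codeBits (encodeMatrix B)) n b m) :
    IsHintCertificate n b m ↔ IsDualCertificate B (hintCoeff b m) (hintScale n b m) := by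
  refine and_congr_right fun _ => forall₄_congr fun j hj k _ => ?_
  rw [Finset.sum_congr rfl fun i hi => ?_]
  rw [h.hintEntry_eq (mul_add_lt_sq ⟨i, Finset.mem_range.1 hi⟩ ⟨j, hj⟩)]

variable {a M D : ℕ} {τ : ℤ}

theorem hintWeight_eq (h : IsParse (codeBits (encodeMatrix B)) n b m)
    (hcert : IsHintCertificate n b m) (f : ℕ) :
    hintWeight a M D τ n b m f = latticeWeight B a M D τ (digitVec n b f) := by
  have hnorm : (hintNorm n b m f : ℝ) = ((hintNorm n b m f).toNat : ℝ) := by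
    have hnonneg : 0 ≤ hintNorm n b m f := by
      rw [hintNorm, certificateNorm]
      exact Finset.sum_nonneg fun i _ => sq_nonneg _
    exact_mod_cast (Int.toNat_of_nonneg hnonneg).symm
  have hquotient : (D : ℝ) * (piApprox a * ‖dualVec B (digitVec n b f)‖ ^ 2) =
      (D * (wallisNum a * hintDen n b m ^ 2 * (hintNorm n b m f).toNat) : ℕ) /
        (wallisDen a * hintScale n b m ^ 2 : ℕ) := by
    have hsq : ‖dualVec B (digitVec n b f)‖ ^ 2 =
        (commonDen B : ℝ) ^ 2 * hintNorm n b m f / (hintScale n b m : ℝ) ^ 2 :=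
      (h.isHintCertificate_iff.1 hcert).norm_dualVec_sq
        fun k => ((digit b f k : ℕ) : ℤ) - (b / 2 : ℕ)
    rw [hsq, hnorm, piApprox, h.hintDen_eq]
    push_cast
    rw [div_mul_div_comm, mul_div_assoc', mul_assoc]
  rw [hintWeight, latticeWeight, powWeight, hquotient, Nat.floor_div_eq_div]

theorem isHintPoint_iff (h : IsParse (codeBits (encodeMatrix B)) n b m)
    (hcert : IsHintCertificate n b m) {f : ℕ} (hf : f < b ^ (n + 1)) :
    IsHintPoint a M D τ n b m f ↔ f ∈ weightedPoints n b (latticeWeight B a M D τ) := by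
  have hzero : (∀ k < n, digit b f k = b / 2) ↔ digitVec n b f = 0 := by
    simp only [funext_iff, digitVec, Pi.zero_apply, sub_eq_zero, Nat.cast_inj, Fin.forall_iff]
  rw [mem_weightedPoints, IsHintPoint, h.hintWeight_eq hcert, hzero]
  exact (and_iff_right hf).symm

end IsParse

theorem digit_add_mul {b L f i : ℕ} (hi : i < L) (u : ℕ) :
    digit b (f + b ^ L * u) i = digit b f i := by
  obtain ⟨k, rfl⟩ : ∃ k, L = i + 1 + k := ⟨L - (i + 1), by omega⟩
  rcases Nat.eq_zero_or_pos b with rfl | hb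
  · simp [digit, pow_succ, pow_add]
  have hsplit : b ^ (i + 1 + k) * u = b ^ i * (b * (b ^ k * u)) := by ring
  rw [digit, hsplit, Nat.add_mul_div_left _ _ (Nat.pow_pos hb), Nat.add_mul_mod_self_left]

/-- The digits `5 * e + 1` to `5 * e + 5` of the honest message for the matrix `B` with dual
certificate `(E, d)`. -/
def honestEntryDigit (B : Matrix (Fin n) (Fin n) ℚ) (E : ℕ → ℤ) (d b e : ℕ) : ℕ → ℕ
  | 0 => if e < n * n then (rowMajor B e).num.natAbs else d
  | 1 => (rowMajor B e).den
  | 2 => (decide ((rowMajor B e).num < 0)).toNat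
  | 3 => suffixCode B e
  | _ => (E e + (b / 2 : ℕ)).toNat

/-- The digits of the honest message for the matrix `B` with dual certificate `(E, d)`. -/
def honestDigit (B : Matrix (Fin n) (Fin n) ℚ) (E : ℕ → ℤ) (d b : ℕ) : ℕ → ℕ
  | 0 => n
  | i + 1 => honestEntryDigit B E d b (i / 5) (i % 5)

variable {E : ℕ → ℤ} {d : ℕ}

theorem honestDigit_five_mul_add (e : ℕ) {k : ℕ} (hk : k < 5) :
    honestDigit B E d b (5 * e + (k + 1)) = honestEntryDigit B E d b e k := by
  rw [← add_assoc, honestDigit, show (5 * e + k) / 5 = e by omega,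
    show (5 * e + k) % 5 = k by omega]

theorem honestDigit_lt (hb : 2 ^ ((encodeMatrix B).length + 1) < b) (hd : d < b / 2)
    (hE : ∀ e, (E e).natAbs < b / 2) (i : ℕ) : honestDigit B E d b i < b := by
  rcases i with _ | i
  · have hdim := dim_le_length B
    have hpow : (encodeMatrix B).length + 1 < 2 ^ ((encodeMatrix B).length + 1) :=
      Nat.lt_two_pow_self
    change n < b
    omega
  change honestEntryDigit B E d b (i / 5) (i % 5) < b
  generalize i / 5 = e
  rcases i % 5 with _ | _ | _ | _ | k
  · change (if _ then _ else _) < b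
    split_ifs
    · exact (natAbs_num_lt B e).trans hb
    · omega
  · exact (den_lt B e).trans hb
  · have hsign := Bool.toNat_le (decide ((rowMajor B e).num < 0))
    change Bool.toNat _ < b
    omega
  · exact (suffixCode_lt B e).trans hb
  · have hEe := hE e
    change Int.toNat _ < b
    omega

section

variable (hm : ∀ i < 5 * (n * n) + 6, digit b m i = honestDigit B E d b i)

include hm

theorem isParse_of_honestDigit : IsParse (codeBits (encodeMatrix B)) n b m := by
  have hdigit : ∀ {e k}, e < n * n → k < 5 →
      digit b m (5 * e + (k + 1)) = honestEntryDigit B E d b e k := fun he hk => by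
    rw [hm _ (by omega), honestDigit_five_mul_add _ hk]
  have hcode : ∀ e ≤ n * n, digit b m (5 * e + 4) = suffixCode B e := fun e he =>
    (hm _ (by omega)).trans (honestDigit_five_mul_add e (k := 3) (by omega))
  have hnum : ∀ e < n * n, digit b m (5 * e + 1) = (rowMajor B e).num.natAbs := fun e he =>
    (hdigit (k := 0) he (by omega)).trans (if_pos he)
  have hden : ∀ e < n * n, digit b m (5 * e + 2) = (rowMajor B e).den := fun e he =>
    hdigit (k := 1) he (by omega)
  have hsign : ∀ e < n * n, digit b m (5 * e + 3) = (decide ((rowMajor B e).num < 0)).toNat :=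
    fun e he => hdigit (k := 2) he (by omega)
  refine ⟨?_, fun e he => ?_⟩
  · rw [codeBits_encodeMatrix, ← hcode 0 (Nat.zero_le _)]
  · rw [hcode e he.le, hcode (e + 1) he, hnum e he, hden e he, hsign e he,
      suffixCode_eq_natCode B he, Nat.mod_eq_of_lt (Bool.toNat_lt _)]

theorem isHintCertificate_of_honestDigit (hcert : IsDualCertificate B E d)
    (hE : ∀ e, (E e).natAbs < b / 2) : IsHintCertificate n b m := by
  have hscale : hintScale n b m = d := by
    rw [hintScale, hm _ (by omega), honestDigit_five_mul_add (n * n) (k := 0) (by omega)]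
    exact if_neg (lt_irrefl _)
  have hcoeff : ∀ e < n * n, hintCoeff b m e = E e := fun e he => by
    have hEe := hE e
    rw [hintCoeff, hm _ (by omega), honestDigit_five_mul_add e (k := 4) (by omega),
      honestEntryDigit, Int.toNat_of_nonneg (by omega), add_sub_cancel_right]
    all_goals omega
  rw [(isParse_of_honestDigit hm).isHintCertificate_iff, hscale]
  refine ⟨hcert.1, fun j hj k hk => ?_⟩
  rw [← hcert.2 j hj k hk]
  refine Finset.sum_congr rfl fun i hi => ?_
  rw [hcoeff _ (mul_add_lt_sq ⟨i, Finset.mem_range.1 hi⟩ ⟨k, hk⟩)]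

end

theorem exists_isHintCertificate (hB : B.det ≠ 0) {h : ℕ}
    (hh : 4 * ((encodeMatrix B).length + 1) ^ 3 + 4 ≤ h) :
    ∃ f < (2 ^ h) ^ (5 * (encodeMatrix B).length + 6), ∀ u,
      let m := f + (2 ^ h) ^ (5 * (encodeMatrix B).length + 6) * u
      m % 2 ^ h = n ∧ IsParse (codeBits (encodeMatrix B)) n (2 ^ h) m ∧
        IsHintCertificate n (2 ^ h) m := by
  obtain ⟨E, d, hcert, hd, hE⟩ := exists_isDualCertificate_le_two_pow hB
  have hsq := sq_dim_le_length B
  set l := (encodeMatrix B).length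
  have hlength : l + 1 ≤ (l + 1) ^ 3 := Nat.le_self_pow three_ne_zero _
  have hbase : 2 ^ (l + 1) < 2 ^ h := Nat.pow_lt_pow_right one_lt_two (by omega)
  have hhalf : 2 ^ (l + 1) ^ 3 < 2 ^ h / 2 := by
    have hdouble : 2 ^ h = 2 ^ (h - 1) * 2 := by rw [← pow_succ, Nat.sub_add_cancel (by omega)]
    rw [hdouble, Nat.mul_div_cancel _ two_pos]
    exact Nat.pow_lt_pow_right one_lt_two (by omega)
  have hE' : ∀ e, (E e).natAbs < 2 ^ h / 2 := fun e => (hE e).trans_lt hhalf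
  obtain ⟨f, hf, hdigit⟩ := exists_digit_eq (5 * l + 6) (honestDigit B E d (2 ^ h))
    fun i _ => honestDigit_lt hbase (hd.trans_lt hhalf) hE' i
  refine ⟨f, hf, fun u => ?_⟩
  have hm : ∀ i < 5 * l + 6,
      digit (2 ^ h) (f + (2 ^ h) ^ (5 * l + 6) * u) i = honestDigit B E d (2 ^ h) i :=
    fun i hi => (digit_add_mul hi u).trans (hdigit i hi)
  have hm' := fun i (hi : i < 5 * (n * n) + 6) => hm i (by omega)
  have hdim := hm 0 (by omega)
  rw [digit, pow_zero, Nat.div_one] at hdim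
  exact ⟨hdim, isParse_of_honestDigit hm', isHintCertificate_of_honestDigit hm' hcert hE'⟩

end Hints

/-! ## The protocol -/

/-- With `l` the length of the instance, `1 / accuracy` bounds from below both `α` and twice the
logarithm of `εN / εY`. -/
noncomputable def accuracy (c : ℕ) : Polynomial ℕ := (Polynomial.X + 1) ^ c

/-- The bound `P` on the logarithm of the damped Gaussian sums that `sum_exp_le_exp` requires. -/
noncomputable def logMassBound (c : ℕ) : Polynomial ℕ :=
  Polynomial.X * (2 + accuracy c + 2 * (Polynomial.X + 1) ^ 3)

/-- The exponent `M` of the weights `powWeight M D τ y`. -/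
noncomputable def exponent (c : ℕ) : Polynomial ℕ :=
  64 * accuracy c * (accuracy c * (2 * logMassBound c + 6) + 1) ^ 2

/-- The precision `D` of the weights `powWeight M D τ y`. -/
noncomputable def precision (c : ℕ) : Polynomial ℕ := 32 * accuracy c

/-- The length of the tuples of weighted points. It turns a ratio `exp (1 / poly)` of the numbers of
points into the ratio `12` of the numbers of tuples that the hashing needs. -/
noncomputable def repetitions (c : ℕ) : Polynomial ℕ := 16 * accuracy c

/-- The bit length of the digits of the message. -/
noncomputable def width (c : ℕ) : Polynomial ℕ :=
  exponent c * precision c * exponent c + exponent c + 4 * (Polynomial.X + 1) ^ 3 + 4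

/-- The number of digits of the message in front of the claimed tuple. -/
noncomputable def hintLength : Polynomial ℕ := 5 * Polynomial.X + 6

/-- The bit length of the modulus of the hash. -/
noncomputable def hashLength (c : ℕ) : Polynomial ℕ :=
  width c * (Polynomial.X + 1) * repetitions c + width c * hintLength + width c * repetitions c + 20

/-- The common length of the coins, which are a pair of keys modulo `2 ^ hashLength`, and the
message. -/
noncomputable def messageLength (c : ℕ) : Polynomial ℕ := 2 * hashLength c

/-- The base of the digits of the message. -/
noncomputable def digitBase (c l : ℕ) : ℕ := 2 ^ (width c).eval l

/-- Tuples of weighted points in dimension `n` are coded by numbers below `tupleBound`. -/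
noncomputable def tupleBound (c l n : ℕ) : ℕ := (digitBase c l ^ (n + 1)) ^ (repetitions c).eval l

/-- `threshold` lies above three times the number of tuples of weighted points on the instances to
be rejected, and below a quarter of their number on the instances to be accepted. -/
noncomputable def threshold (c l : ℕ) : ℕ :=
  9 * ((exponent c).eval l * (precision c).eval l) ^ ((exponent c).eval l * (repetitions c).eval l)

/-- The modulus of the hash. -/
noncomputable def hashModulus (c l : ℕ) : ℕ := 2 ^ (hashLength c).eval l

/-- The hash value of a claimed tuple must be below `hashWindow`. -/
noncomputable def hashWindow (c l : ℕ) : ℕ := hashModulus c l / threshold c l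

/-- The tuple that the message `m` claims to be hashed to a small value. -/
noncomputable def claimedTuple (c l n m : ℕ) : ℕ :=
  m / digitBase c l ^ hintLength.eval l % tupleBound c l n

/-- Arthur's checks on the message `m` to the coins `r`, for an instance of code `X`, dimension `n`
and length `l`. -/
def IsValidAnswer (c l : ℕ) (τ : ℤ) (n X r m : ℕ) : Prop :=
  0 < n ∧ IsParse X n (digitBase c l) m ∧ IsHintCertificate n (digitBase c l) m ∧
    (∀ t < (repetitions c).eval l,
      IsHintPoint ((accuracy c).eval l) ((exponent c).eval l) ((precision c).eval l) τ n
        (digitBase c l) m (digit (digitBase c l ^ (n + 1)) (claimedTuple c l n m) t)) ∧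
    HashHit (hashModulus c l) (hashWindow c l) r (claimedTuple c l n m)

/-- Arthur's verdict, where `τ n k` approximates `k * -log ε`. The length is read off the code of
the instance, and the dimension off the first digit of the message; `min` keeps the latter small
enough to be counted in unary. -/
def IsValidMessage (c : ℕ) (τ : ℕ → ℕ → ℤ) (X r m : ℕ) : Prop :=
  let l := Nat.size X - 1
  let n := min (m % digitBase c l) l
  IsValidAnswer c l (τ n ((precision c).eval l)) n X r m

section PolyTime

variable {Ω : Type*} [ProgramInput Ω] {c : ℕ} {X r m n l : Ω → ℕ} {τ : Ω → ℤ}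

theorem PolyTime.digitBase (hl : PolyTimeUnary l) : PolyTime fun ω => digitBase c (l ω) :=
  have hwidth := hl.polynomial_eval (width c)
  (const 2).pow hwidth.1 hwidth.2

theorem PolyTime.tupleBound (hl : PolyTimeUnary l) (hn : PolyTimeUnary n) :
    PolyTime fun ω => tupleBound c (l ω) (n ω) :=
  have hn' := hn.add (.const 1)
  have hreps := hl.polynomial_eval (repetitions c)
  ((digitBase hl).pow hn'.1 hn'.2).pow hreps.1 hreps.2

theorem PolyTime.hashModulus (hl : PolyTimeUnary l) : PolyTime fun ω => hashModulus c (l ω) :=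
  have hlength := hl.polynomial_eval (hashLength c)
  (const 2).pow hlength.1 hlength.2

theorem PolyTime.hashWindow (hl : PolyTimeUnary l) : PolyTime fun ω => hashWindow c (l ω) := by
  have hM := hl.polynomial_eval (exponent c)
  have hpower := hM.mul (hl.polynomial_eval (repetitions c))
  exact (hashModulus hl).div ((const 9).mul
    ((hM.1.mul (hl.polynomial_eval (precision c)).1).pow hpower.1 hpower.2))

theorem PolyTime.claimedTuple (hl : PolyTimeUnary l) (hn : PolyTimeUnary n) (hm : PolyTime m) :
    PolyTime fun ω => claimedTuple c (l ω) (n ω) (m ω) :=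
  have hhint := hl.polynomial_eval hintLength
  (hm.div ((digitBase hl).pow hhint.1 hhint.2)).mod (tupleBound hl hn)

theorem PolyTimePred.hashHit {Q I u : Ω → ℕ} (hQ : PolyTime Q) (hI : PolyTime I)
    (hr : PolyTime r) (hu : PolyTime u) :
    PolyTimePred fun ω => HashHit (Q ω) (I ω) (r ω) (u ω) :=
  lt ((((hr.mod hQ).mul hu).add (hr.div hQ)).mod hQ) hI

theorem PolyTimePred.isValidAnswer (hl : PolyTimeUnary l) (hτ : PolyTimeInt τ)
    (hn : PolyTimeUnary n) (hX : PolyTime X) (hr : PolyTime r) (hm : PolyTime m) :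
    PolyTimePred fun ω => IsValidAnswer c (l ω) (τ ω) (n ω) (X ω) (r ω) (m ω) := by
  have hbase := PolyTime.digitBase (c := c) hl
  have hclaim := PolyTime.claimedTuple (c := c) hl hn hm
  have hn' := hn.add (.const 1)
  have hreps := hl.polynomial_eval (repetitions c)
  have hpoints := forall_lt hreps (isHintPoint (hl.polynomial_eval (accuracy c)).comp_snd
    (hl.polynomial_eval (exponent c)).comp_snd (hl.polynomial_eval (precision c)).1.comp_snd
    hτ.comp_snd hn.comp_snd hbase.comp_snd hm.comp_snd
    ((hbase.pow hn'.1 hn'.2).comp_snd.digit hclaim.comp_snd .index))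
  exact (lt (.const 0) hn.1).and ((isParse hX hn hbase hm).and
    ((isHintCertificate hn hbase hm).and
      (hpoints.and (hashHit (.hashModulus hl) (.hashWindow hl) hr hclaim))))

/-- Arguments in unary: `τ` is computable in time polynomial in the values of its arguments, not
just in their lengths. -/
def PolyTimeOnUnary (τ : ℕ → ℕ → ℤ) : Prop :=
  ∀ f g : VerifierInput → ℕ, PolyTimeUnary f → PolyTimeUnary g → PolyTimeInt fun ω => τ (f ω) (g ω)

theorem PolyTimePred.isValidMessage {τ : ℕ → ℕ → ℤ} (hτ : PolyTimeOnUnary τ) :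
    PolyTimePred fun ω : VerifierInput =>
      IsValidMessage c τ ω.instanceCode ω.coins ω.message := by
  have hsize := PolyTime.instanceCode.size_unary
  have hl : PolyTimeUnary fun ω : VerifierInput => Nat.size ω.instanceCode - 1 :=
    ⟨hsize.1.sub (.const 1), hsize.2.mono fun ω => Nat.sub_le _ _⟩
  have hn : PolyTimeUnary fun ω : VerifierInput =>
      min (ω.message % digitBase c (Nat.size ω.instanceCode - 1))
        (Nat.size ω.instanceCode - 1) :=
    ⟨(PolyTime.message.mod (.digitBase hl)).min hl.1, hl.2.mono fun ω => min_le_right _ _⟩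
  exact isValidAnswer hl (hτ _ _ hn (hl.polynomial_eval (precision c))) hn
    .instanceCode .coins .message

end PolyTime

/-! ## Acceptance probabilities -/

section Evaluation

variable (c l : ℕ)

theorem accuracy_eval : (accuracy c).eval l = (l + 1) ^ c := by simp [accuracy]

theorem precision_eval : (precision c).eval l = 32 * (accuracy c).eval l := by simp [precision]

theorem repetitions_eval : (repetitions c).eval l = 16 * (accuracy c).eval l := by
  simp [repetitions]

theorem logMassBound_eval : (logMassBound c).eval l =
    l * (2 + (accuracy c).eval l + 2 * (l + 1) ^ 3) := by
  simp [logMassBound]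

theorem exponent_eval : (exponent c).eval l = 64 * (accuracy c).eval l *
    ((accuracy c).eval l * (2 * (logMassBound c).eval l + 6) + 1) ^ 2 := by
  simp [exponent]

theorem width_eval : (width c).eval l =
    (exponent c).eval l * (precision c).eval l * (exponent c).eval l + (exponent c).eval l +
      4 * (l + 1) ^ 3 + 4 := by
  simp [width]

theorem hintLength_eval : hintLength.eval l = 5 * l + 6 := by simp [hintLength]

theorem hashLength_eval : (hashLength c).eval l =
    (width c).eval l * (l + 1) * (repetitions c).eval l + (width c).eval l * hintLength.eval l +
      (width c).eval l * (repetitions c).eval l + 20 := by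
  simp [hashLength]

theorem two_pow_messageLength :
    2 ^ (messageLength c).eval l = hashModulus c l * hashModulus c l := by
  rw [messageLength, hashModulus, ← pow_add, ← two_mul, Polynomial.eval_mul, Polynomial.eval_ofNat]

theorem accuracy_pos : 0 < (accuracy c).eval l := by rw [accuracy_eval]; positivity

theorem exponent_pos : 0 < (exponent c).eval l := by
  have := accuracy_pos c l
  rw [exponent_eval]
  positivity

theorem precision_pos : 0 < (precision c).eval l := by
  have := accuracy_pos c l
  rw [precision_eval]
  positivity

theorem digitBase_pos : 0 < digitBase c l := Nat.two_pow_pos _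

theorem tupleBound_pos (n : ℕ) : 0 < tupleBound c l n :=
  Nat.pow_pos (Nat.pow_pos (digitBase_pos c l))

theorem hashModulus_pos : 0 < hashModulus c l := Nat.two_pow_pos _

theorem threshold_pos : 0 < threshold c l := by
  have := exponent_pos c l
  have := precision_pos c l
  rw [threshold]
  positivity

theorem threshold_le_two_pow :
    threshold c l ≤ 2 ^ ((width c).eval l * (repetitions c).eval l + 4) := by
  rw [threshold, pow_add, mul_comm]
  refine Nat.mul_le_mul ((Nat.pow_le_pow_left Nat.lt_two_pow_self.le _).trans ?_) (by norm_num)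
  rw [← pow_mul, ← mul_assoc]
  refine Nat.pow_le_pow_right two_pos (Nat.mul_le_mul_right _ ?_)
  rw [width_eval]
  omega

variable {l} {n : ℕ}

theorem tupleBound_le_two_pow (hn : n ≤ l) :
    tupleBound c l n ≤ 2 ^ ((width c).eval l * (l + 1) * (repetitions c).eval l) := by
  rw [tupleBound, digitBase, ← pow_mul, ← pow_mul]
  rw [← mul_assoc]
  exact Nat.pow_le_pow_right two_pos
    (Nat.mul_le_mul_right _ (Nat.mul_le_mul_left _ (Nat.succ_le_succ hn)))

theorem mul_tupleBound_le_two_pow_messageLength (hn : n ≤ l) :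
    digitBase c l ^ hintLength.eval l * tupleBound c l n ≤ 2 ^ (messageLength c).eval l := by
  refine (Nat.mul_le_mul_left _ (tupleBound_le_two_pow c hn)).trans ?_
  rw [digitBase, ← pow_mul, ← pow_add]
  refine Nat.pow_le_pow_right two_pos ?_
  rw [messageLength, Polynomial.eval_mul, Polynomial.eval_ofNat, hashLength_eval]
  omega

theorem five_mul_tupleBound_le_hashWindow (hn : n ≤ l) :
    5 * tupleBound c l n ≤ hashWindow c l := by
  rw [hashWindow, Nat.le_div_iff_mul_le (threshold_pos c l)]
  refine (Nat.mul_le_mul (Nat.mul_le_mul (show 5 ≤ 2 ^ 3 by norm_num)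
    (tupleBound_le_two_pow c hn)) (threshold_le_two_pow c l)).trans ?_
  rw [hashModulus, ← pow_add, ← pow_add, hashLength_eval]
  exact Nat.pow_le_pow_right two_pos (by omega)

end Evaluation

section Protocol

variable {n : ℕ}

/-- The codes of the points whose number the protocol estimates. -/
noncomputable def protocolPoints (c l : ℕ) (τ : ℤ) (B : Matrix (Fin n) (Fin n) ℚ) : Finset ℕ :=
  weightedPoints n (digitBase c l)
    (latticeWeight B ((accuracy c).eval l) ((exponent c).eval l) ((precision c).eval l) τ)

/-- The codes of the tuples of such points. -/
noncomputable def protocolTuples (c l : ℕ) (τ : ℤ) (B : Matrix (Fin n) (Fin n) ℚ) : Finset ℕ :=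
  (Finset.range (tupleBound c l n)).filter fun u => ∀ t < (repetitions c).eval l,
    digit (digitBase c l ^ (n + 1)) u t ∈ protocolPoints c l τ B

variable {B : Matrix (Fin n) (Fin n) ℚ} {c l u : ℕ}

theorem mem_protocolTuples {τ : ℤ} : u ∈ protocolTuples c l τ B ↔ u < tupleBound c l n ∧
    ∀ t < (repetitions c).eval l,
      digit (digitBase c l ^ (n + 1)) u t ∈ protocolPoints c l τ B := by
  rw [protocolTuples, Finset.mem_filter, Finset.mem_range]

theorem card_protocolTuples (c l : ℕ) (τ : ℤ) (B : Matrix (Fin n) (Fin n) ℚ) :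
    (protocolTuples c l τ B).card = (protocolPoints c l τ B).card ^ (repetitions c).eval l :=
  card_filter_forall_digit_mem fun _ hf => (mem_weightedPoints.1 hf).1

theorem isValidAnswer_iff {τ : ℤ} {X r m : ℕ} (hn : 0 < n)
    (hX : X = codeBits (encodeMatrix B)) : IsValidAnswer c l τ n X r m ↔
      (IsParse X n (digitBase c l) m ∧ IsHintCertificate n (digitBase c l) m) ∧
        claimedTuple c l n m ∈ protocolTuples c l τ B ∧
        HashHit (hashModulus c l) (hashWindow c l) r (claimedTuple c l n m) := by
  subst hX
  rw [IsValidAnswer, and_iff_right hn, ← and_assoc]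
  refine and_congr_right fun ⟨hparse, hcert⟩ => and_congr_left' ?_
  have hclaim : claimedTuple c l n m < tupleBound c l n := Nat.mod_lt _ (tupleBound_pos c l n)
  rw [mem_protocolTuples, and_iff_right hclaim]
  exact forall₂_congr fun t _ =>
    hparse.isHintPoint_iff hcert (Nat.mod_lt _ (Nat.pow_pos (digitBase_pos c l)))

theorem size_codeBits_sub_one (x : List Bool) : Nat.size (codeBits x) - 1 = x.length := by
  rw [size_codeBits, Nat.add_sub_cancel]

variable {τ : ℕ → ℕ → ℤ} {r : ℕ}

theorem exists_mem_protocolTuples_of_isValidMessage {m : ℕ}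
    (hm : IsValidMessage c τ (codeBits (encodeMatrix B)) r m) (hl : (encodeMatrix B).length = l) :
    ∃ u ∈ protocolTuples c l (τ n ((precision c).eval l)) B,
      HashHit (hashModulus c l) (hashWindow c l) r u := by
  rw [IsValidMessage, size_codeBits_sub_one, hl] at hm
  have hdim := hm.2.1.dim_eq
  rw [hdim] at hm
  exact ⟨claimedTuple c l n m, ((isValidAnswer_iff hm.1 rfl).1 hm).2⟩

theorem exists_isValidMessage_of_mem_protocolTuples (hB : B.det ≠ 0) (hn : 0 < n)
    (hl : (encodeMatrix B).length = l)
    (hu : u ∈ protocolTuples c l (τ n ((precision c).eval l)) B)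
    (hhit : HashHit (hashModulus c l) (hashWindow c l) r u) :
    ∃ m < 2 ^ (messageLength c).eval l,
      IsValidMessage c τ (codeBits (encodeMatrix B)) r m := by
  have hnl : n ≤ l := hl ▸ dim_le_length B
  have hbound := (mem_protocolTuples.1 hu).1
  obtain ⟨f, hf, hhint⟩ := exists_isHintCertificate hB (h := (width c).eval l)
    (by rw [hl, width_eval]; omega)
  rw [hl, ← hintLength_eval, ← digitBase] at hf hhint
  obtain ⟨hdim, hparse, hcert⟩ := hhint u
  set m := f + digitBase c l ^ hintLength.eval l * u with hm
  have hclaim : claimedTuple c l n m = u := by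
    rw [claimedTuple, hm, Nat.add_mul_div_left _ _ (Nat.pow_pos (digitBase_pos c l)),
      Nat.div_eq_of_lt hf, zero_add, Nat.mod_eq_of_lt hbound]
  refine ⟨m, ?_, ?_⟩
  · calc m < digitBase c l ^ hintLength.eval l * (u + 1) := by rw [mul_add_one]; omega
      _ ≤ digitBase c l ^ hintLength.eval l * tupleBound c l n := Nat.mul_le_mul_left _ hbound
      _ ≤ 2 ^ (messageLength c).eval l := mul_tupleBound_le_two_pow_messageLength c hnl
  · rw [IsValidMessage, size_codeBits_sub_one, hl, hdim, min_eq_left hnl,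
      isValidAnswer_iff hn rfl, hclaim]
    exact ⟨⟨hparse, hcert⟩, hu, hhit⟩

theorem winningCoins_eq_hitKeys (hB : B.det ≠ 0) (hn : 0 < n)
    (hl : (encodeMatrix B).length = l) :
    winningCoins (IsValidMessage c τ (codeBits (encodeMatrix B))) ((messageLength c).eval l) =
      hitKeys (hashModulus c l) (hashWindow c l)
        (protocolTuples c l (τ n ((precision c).eval l)) B) := by
  classical
  rw [winningCoins, hitKeys, ← two_pow_messageLength]
  refine Finset.filter_congr fun r _ => ⟨fun ⟨m, _, hm⟩ => ?_, fun ⟨u, hu, hhit⟩ => ?_⟩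
  · exact exists_mem_protocolTuples_of_isValidMessage hm hl
  · exact exists_isValidMessage_of_mem_protocolTuples hB hn hl hu hhit

end Protocol

section Acceptance

variable {n : ℕ} {B : Matrix (Fin n) (Fin n) ℚ} {c : ℕ} {T : ℝ}

theorem exp_repetitions_div_precision_le (c l : ℕ) :
    Real.exp (((repetitions c).eval l : ℕ) * (1 / ((precision c).eval l : ℕ))) ≤ 3 := by
  have ha : (0 : ℝ) < ((accuracy c).eval l : ℕ) := by exact_mod_cast accuracy_pos c l
  have le_one : (((repetitions c).eval l : ℕ) : ℝ) * (1 / ((precision c).eval l : ℕ)) ≤ 1 := by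
    rw [precision_eval, repetitions_eval, mul_one_div]
    push_cast
    rw [div_le_one (by positivity)]
    linarith
  exact (Real.exp_le_exp.2 le_one).trans (by linarith [Real.exp_one_lt_d9])

theorem le_exp_repetitions_div_accuracy (c l : ℕ) :
    36 ≤ Real.exp (((repetitions c).eval l : ℕ) * (1 / (4 * ((accuracy c).eval l : ℕ)))) := by
  have ha : (0 : ℝ) < ((accuracy c).eval l : ℕ) := by exact_mod_cast accuracy_pos c l
  have eq_four : (((repetitions c).eval l : ℕ) : ℝ) * (1 / (4 * ((accuracy c).eval l : ℕ))) =
      (4 : ℕ) * 1 := by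
    rw [repetitions_eval]
    push_cast
    field_simp
    norm_num
  rw [eq_four, Real.exp_nat_mul]
  calc (36 : ℝ) ≤ 2.7 ^ 4 := by norm_num
    _ ≤ Real.exp 1 ^ 4 := pow_le_pow_left₀ (by norm_num) (by linarith [Real.exp_one_gt_d9]) 4

theorem three_mul_card_protocolTuples_le {τ : ℤ} (l : ℕ)
    (hτ : |(τ : ℝ) - (((precision c).eval l : ℕ) : ℝ) * T| ≤ 1)
    (hsmall : ∀ F : Finset (Fin n → ℤ), 0 ∉ F →
      ∑ z ∈ F, Real.exp (-(Real.pi * ‖dualVec B z‖ ^ 2)) ≤ Real.exp (-T)) :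
    3 * (protocolTuples c l τ B).card ≤ threshold c l := by
  have hcard := card_weightedPoints_latticeWeight_le (a := (accuracy c).eval l)
    (b := digitBase c l) (exponent_pos c l) (precision_pos c l) hτ hsmall
  have hpow := (pow_le_pow_left₀ (Nat.cast_nonneg _) hcard ((repetitions c).eval l)).trans_eq
    (mul_pow _ _ _)
  rw [← pow_mul, ← Real.exp_nat_mul] at hpow
  have hthree := hpow.trans
    (mul_le_mul_of_nonneg_left (exp_repetitions_div_precision_le c l) (by positivity))
  norm_cast at hthree
  rw [card_protocolTuples, threshold, protocolPoints]
  omega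

theorem four_mul_threshold_le_card_protocolTuples {τ : ℤ} {l : ℕ} (hB : B.det ≠ 0)
    (hl : (encodeMatrix B).length = l) (hτ : |(τ : ℝ) - (((precision c).eval l : ℕ) : ℝ) * T| ≤ 1)
    {F : Finset (Fin n → ℤ)} (hzero : 0 ∉ F)
    (hlarge : Real.exp (-T + 1 / (2 * ((accuracy c).eval l : ℕ))) <
      ∑ z ∈ F, Real.exp (-(Real.pi * (1 + 1 / (((accuracy c).eval l : ℕ) : ℝ)) ^ 2 *
        ‖dualVec B z‖ ^ 2))) :
    4 * threshold c l ≤ (protocolTuples c l τ B).card := by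
  subst hl
  set l := (encodeMatrix B).length
  rw [precision_eval] at hτ
  have hcard := le_card_weightedPoints_latticeWeight hB (h := (width c).eval l) (accuracy_pos c l)
    (logMassBound_eval c l).ge (exponent_eval c l).ge
    (by rw [width_eval, precision_eval]) hτ hzero hlarge
  have hpow := (mul_pow _ _ _).symm.trans_le
    (pow_le_pow_left₀ (by positivity) hcard ((repetitions c).eval l))
  rw [← pow_mul, ← Real.exp_nat_mul] at hpow
  have hfour := (mul_le_mul_of_nonneg_left (le_exp_repetitions_div_accuracy c l)
    (by positivity)).trans hpow
  norm_cast at hfour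
  rw [card_protocolTuples, threshold, protocolPoints, precision_eval, digitBase]
  omega

variable {τ : ℕ → ℕ → ℤ}

theorem card_winningCoins_div_le {l : ℕ} (hB : B.det ≠ 0) (hn : 0 < n)
    (hl : (encodeMatrix B).length = l)
    (hτ : |(τ n ((precision c).eval l) : ℝ) - (((precision c).eval l : ℕ) : ℝ) * T| ≤ 1)
    (hsmall : ∀ F : Finset (Fin n → ℤ), 0 ∉ F →
      ∑ z ∈ F, Real.exp (-(Real.pi * ‖dualVec B z‖ ^ 2)) ≤ Real.exp (-T)) :
    ((winningCoins (IsValidMessage c τ (codeBits (encodeMatrix B)))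
      ((messageLength c).eval l)).card : ℝ) / 2 ^ (messageLength c).eval l ≤ 1 / 3 := by
  have hcard := three_mul_card_hitKeys_le (hashModulus_pos c l) (Nat.div_le_self _ _)
    (Nat.mul_div_le _ _) (three_mul_card_protocolTuples_le l hτ hsmall)
  rw [← hashWindow, ← winningCoins_eq_hitKeys hB hn hl, ← two_pow_messageLength] at hcard
  rw [div_le_div_iff₀ (by positivity) three_pos, mul_comm, one_mul]
  exact_mod_cast hcard

theorem le_card_winningCoins_div {l : ℕ} (hB : B.det ≠ 0) (hn : 0 < n)
    (hl : (encodeMatrix B).length = l)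
    (hτ : |(τ n ((precision c).eval l) : ℝ) - (((precision c).eval l : ℕ) : ℝ) * T| ≤ 1)
    {F : Finset (Fin n → ℤ)} (hzero : 0 ∉ F)
    (hlarge : Real.exp (-T + 1 / (2 * ((accuracy c).eval l : ℕ))) <
      ∑ z ∈ F, Real.exp (-(Real.pi * (1 + 1 / (((accuracy c).eval l : ℕ) : ℝ)) ^ 2 *
        ‖dualVec B z‖ ^ 2))) :
    2 / 3 ≤ ((winningCoins (IsValidMessage c τ (codeBits (encodeMatrix B)))
      ((messageLength c).eval l)).card : ℝ) / 2 ^ (messageLength c).eval l := by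
  have hwindow := five_mul_tupleBound_le_hashWindow c (hl ▸ dim_le_length B : n ≤ l)
  have hbound := tupleBound_pos c l n
  have hcard := two_mul_sq_le_three_mul_card_hitKeys (hashModulus_pos c l)
    (Nat.div_le_self _ _) (Nat.lt_mul_div_succ _ (threshold_pos c l)).le
    (by rw [← hashWindow]; omega) (fun u hu => (mem_protocolTuples.1 hu).1.le)
    (four_mul_threshold_le_card_protocolTuples hB hl hτ hzero hlarge)
  rw [← hashWindow, ← winningCoins_eq_hitKeys hB hn hl, ← two_pow_messageLength] at hcard
  rw [div_le_div_iff₀ three_pos (by positivity), mul_comm _ (3 : ℝ)]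
  exact_mod_cast hcard

end Acceptance

/-! ## Approximating the logarithm of the mass bound -/

theorem inCoAM_of_approx {α εY εN : ℕ → ℝ} {c : ℕ} {τ : ℕ → ℕ → ℤ} {T : ℕ → ℕ → ℝ}
    (hτ : PolyTimeOnUnary τ)
    (hT : ∀ n l : ℕ, 0 < n →
      |(τ n ((precision c).eval l) : ℝ) - ((precision c).eval l : ℕ) * T n l| ≤ 1)
    (hα : ∀ n l : ℕ, 0 < n → n ≤ l → 1 / (((accuracy c).eval l : ℕ) : ℝ) ≤ α n)
    (hεY : ∀ n : ℕ, 0 < n → 0 < εY n)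
    (hY : ∀ n l : ℕ, 0 < n → n ≤ l → εY n ≤ Real.exp (-T n l))
    (hN : ∀ n l : ℕ, 0 < n → n ≤ l →
      Real.exp (-T n l + 1 / (2 * ((accuracy c).eval l : ℕ))) ≤ εN n) :
    InCoAM (gapSPP (fun n => 1 + α n) εY εN) := by
  refine inAM_of_winningCoins (PolyTimePred.isValidMessage (c := c) hτ) (messageLength c) ?_ ?_
  · rintro x ⟨n, B, hn, hB, rfl, hη⟩
    have hN := hN n _ hn (dim_le_length B)
    obtain ⟨F, hzero, hF⟩ := exists_lt_sum_exp_of_lt_smoothingParameter hB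
      ((Real.exp_pos _).le.trans hN) (by positivity)
      ((add_le_add_right (hα n _ hn (dim_le_length B)) 1).trans_lt hη)
    exact le_card_winningCoins_div hB hn rfl (hT n _ hn) hzero (hN.trans_lt hF)
  · rintro x ⟨n, B, hn, hB, rfl, hη⟩
    refine card_winningCoins_div_le hB hn rfl (hT n _ hn) fun F hzero => ?_
    have hF := sum_exp_le_of_smoothingParameter_le hB (hεY n hn) hη hzero
    rw [one_pow, mul_one] at hF
    exact hF.trans (hY n _ hn (dim_le_length B))

theorem EfficientlyApproximable.exists_polyTimeOnUnary {ε : ℕ → ℝ}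
    (hε : EfficientlyApproximable ε) :
    ∃ τ : ℕ → ℕ → ℤ, PolyTimeOnUnary τ ∧
      ∀ n k : ℕ, 0 < n → |(τ n k : ℝ) - k * -Real.log (ε n)| ≤ 1 := by
  obtain ⟨p, q, hp⟩ := hε
  -- The program is only specified for `0 < n`; `n + (1 - n)` is `max n 1`.
  choose t σ hrun ht happrox using fun n k => hp (n + (1 - n)) k (by omega)
  have add_one_sub : ∀ n, 0 < n → n + (1 - n) = n := fun n hn => by omega
  have hoffset : ∀ {f : VerifierInput → ℕ}, PolyTimeUnary f →
      PolyTimeUnary fun ω => f ω + (1 - f ω) := fun hf =>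
    ⟨hf.1.add ((PolyTime.const 1).sub hf.1),
      hf.2.add ((PolyBounded.const 1).mono fun ω => Nat.sub_le _ _)⟩
  have houtput : ∀ (j : ℕ) {f g : VerifierInput → ℕ}, PolyTimeUnary f → PolyTimeUnary g →
      PolyTime fun ω => σ (f ω) (g ω) j := fun j f g hf hg =>
    PolyTime.call (hoffset hf).1 hg.1 (hoffset hf).2 hg.2 fun ω =>
      ⟨t _ _, σ _ _, hrun _ _, ht _ _, rfl⟩
  refine ⟨fun n k => (σ n k 1 : ℤ) - σ n k 0, fun f g hf hg =>
    (PolyTimeInt.ofNat (houtput 1 hf hg)).sub (.ofNat (houtput 0 hf hg)), fun n k hn => ?_⟩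
  have hlog := happrox n k
  rw [add_one_sub n hn, abs_sub_comm] at hlog
  push_cast
  convert hlog using 2
  ring

theorem exp_half_le_one_add {x : ℝ} (h₀ : 0 ≤ x) (h₁ : x ≤ 1) : Real.exp (x / 2) ≤ 1 + x := by
  rw [← Real.le_log_iff_exp_le (by linarith)]
  calc x / 2 ≤ x / (1 + x) := div_le_div_of_nonneg_left h₀ (by linarith) (by linarith)
    _ = 1 - (1 + x)⁻¹ := by field_simp; ring
    _ ≤ Real.log (1 + x) := Real.one_sub_inv_le_log_of_pos (by linarith)

theorem one_div_accuracy_le {c c' n l : ℕ} (hc : c' ≤ c) (hn : n ≤ l) :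
    1 / (((accuracy c).eval l : ℕ) : ℝ) ≤ 1 / ((n : ℝ) + 1) ^ c' := by
  rw [accuracy_eval]
  refine one_div_le_one_div_of_le (by positivity) ?_
  exact_mod_cast (Nat.pow_le_pow_left (Nat.succ_le_succ hn) c').trans
    (Nat.pow_le_pow_right l.succ_pos hc)

theorem precision_mul_one_div_two_mul_accuracy (c l : ℕ) :
    ((precision c).eval l : ℕ) * (1 / (2 * ((accuracy c).eval l : ℕ)) : ℝ) = 16 := by
  have haccuracy : (0 : ℝ) < ((accuracy c).eval l : ℕ) := by exact_mod_cast accuracy_pos c l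
  rw [precision_eval]
  push_cast
  field_simp
  norm_num

theorem exp_mul_le_of_one_add_le {c c' n l : ℕ} {x y : ℝ} (hc : c' ≤ c) (hn : n ≤ l) (hx : 0 ≤ x)
    (h : (1 + 1 / ((n : ℝ) + 1) ^ c') * x ≤ y) :
    Real.exp (1 / (2 * ((accuracy c).eval l : ℕ))) * x ≤ y := by
  have haccuracy : (1 : ℝ) ≤ ((accuracy c).eval l : ℕ) := by exact_mod_cast accuracy_pos c l
  refine le_trans (mul_le_mul_of_nonneg_right ?_ hx) h
  calc Real.exp (1 / (2 * ((accuracy c).eval l : ℕ)))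
      = Real.exp (1 / ((accuracy c).eval l : ℕ) / 2) := by rw [div_div, mul_comm (2 : ℝ)]
    _ ≤ 1 + 1 / ((accuracy c).eval l : ℕ) :=
        exp_half_le_one_add (by positivity) ((div_le_one (by linarith)).2 haccuracy)
    _ ≤ 1 + 1 / ((n : ℝ) + 1) ^ c' := add_le_add_right (one_div_accuracy_le hc hn) 1

section

variable {α εY εN : ℕ → ℝ} {c : ℕ}
  (hα : ∀ n l : ℕ, 0 < n → n ≤ l → 1 / (((accuracy c).eval l : ℕ) : ℝ) ≤ α n)
  (hεY : ∀ n : ℕ, 0 < n → 0 < εY n)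
  (hgap : ∀ n l : ℕ, 0 < n → n ≤ l →
    Real.exp (1 / (2 * ((accuracy c).eval l : ℕ))) * εY n ≤ εN n)
include hα hεY hgap

theorem inCoAM_of_efficientlyApproximable_left (h : EfficientlyApproximable εY) :
    InCoAM (gapSPP (fun n => 1 + α n) εY εN) := by
  obtain ⟨τ, hτ, hlog⟩ := h.exists_polyTimeOnUnary
  refine inCoAM_of_approx (c := c) (T := fun n _ => -Real.log (εY n)) hτ
    (fun n l hn => hlog n _ hn) hα hεY (fun n l hn _ => ?_) fun n l hn hl => ?_
  · rw [neg_neg, Real.exp_log (hεY n hn)]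
  · rw [neg_neg, add_comm, Real.exp_add, Real.exp_log (hεY n hn)]
    exact hgap n l hn hl

theorem inCoAM_of_efficientlyApproximable_right (h : EfficientlyApproximable εN) :
    InCoAM (gapSPP (fun n => 1 + α n) εY εN) := by
  obtain ⟨τ, hτ, hlog⟩ := h.exists_polyTimeOnUnary
  have hεN : ∀ n, 0 < n → 0 < εN n := fun n hn =>
    (mul_pos (Real.exp_pos _) (hεY n hn)).trans_le (hgap n n hn le_rfl)
  refine inCoAM_of_approx (c := c) (τ := fun n k => τ n k + 16)
    (T := fun n l => -Real.log (εN n) + 1 / (2 * ((accuracy c).eval l : ℕ)))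
    (fun f g hf hg => (hτ f g hf hg).add (.ofNat (.const 16))) (fun n l hn => ?_) hα hεY
    (fun n l hn hl => ?_) fun n l hn _ => ?_
  · rw [mul_add, precision_mul_one_div_two_mul_accuracy]
    push_cast
    rw [add_sub_add_right_eq_sub]
    exact hlog n _ hn
  · rw [neg_add, neg_neg, Real.exp_add, Real.exp_log (hεN n hn), Real.exp_neg,
      ← div_eq_mul_inv, le_div_iff₀' (Real.exp_pos _)]
    exact hgap n l hn hl
  · rw [neg_add, neg_neg, neg_add_cancel_right, Real.exp_log (hεN n hn)]

end

end LatticeAM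

theorem mainTheorem5 (α εY εN : ℕ → ℝ)
    (hα : ∃ c : ℕ, ∀ n : ℕ, 0 < n → 1 / ((n : ℝ) + 1) ^ c ≤ α n)
    (hεY : ∀ n : ℕ, 0 < n → 0 < εY n)
    (hε : ∃ c : ℕ, ∀ n : ℕ, 0 < n → (1 + 1 / ((n : ℝ) + 1) ^ c) * εY n ≤ εN n)
    (hcomp : LatticeAM.EfficientlyApproximable εY ∨ LatticeAM.EfficientlyApproximable εN) :
    LatticeAM.InCoAM (LatticeAM.gapSPP (fun n => 1 + α n) εY εN) := by
  obtain ⟨c₁, hα⟩ := hα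
  obtain ⟨c₂, hε⟩ := hε
  have hα' : ∀ n l : ℕ, 0 < n → n ≤ l →
      1 / (((LatticeAM.accuracy (max c₁ c₂)).eval l : ℕ) : ℝ) ≤ α n := fun n l hn hl =>
    (LatticeAM.one_div_accuracy_le (le_max_left c₁ c₂) hl).trans (hα n hn)
  have hgap : ∀ n l : ℕ, 0 < n → n ≤ l →
      Real.exp (1 / (2 * ((LatticeAM.accuracy (max c₁ c₂)).eval l : ℕ))) * εY n ≤ εN n :=
    fun n l hn hl => LatticeAM.exp_mul_le_of_one_add_le (le_max_right c₁ c₂) hl (hεY n hn).le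
      (hε n hn)
  rcases hcomp with hY | hN
  · exact LatticeAM.inCoAM_of_efficientlyApproximable_left hα' hεY hgap hY
  · exact LatticeAM.inCoAM_of_efficientlyApproximable_right hα' hεY hgap hN
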